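/- Let $M$ be the hyperbolic plane $\mathbb{H}^2$ (curvature $-1$) or the unit sphere $\mathbb{S}^2$ (curvature $1$), and let $\gamma$ be a closed embedded rectifiable curve in $M$, parametrized so that the side from which its geodesic curvature is measured is on its left. For a subarc $\gamma_1$ let $s(\gamma_1)$ be its length and $\tau(\gamma_1)$ its integral geodesic curvature (swerve) from the left: the limit, as the mesh tends to $0$, of the sums of the signed exterior angles (left turns positive) at the inner vertices of the geodesic broken lines inscribed in $\gamma_1$ with the same endpoints. A support line of $\gamma$ at $P\in\gamma$ is a geodesic line (in $\mathbb{S}^2$, a great circle) through $P$ such that $\gamma$ lies in one of the two closed half-planes (hemispheres) bounded by it. I. Let $M=\mathbb{H}^2$ and $R_0>0$. Suppose that every proper subarc $\gamma_1$ of $\gamma$ has a swerve and $$\frac{\tau(\gamma_1)}{s(\gamma_1)}\ \ge\ \coth R_0 .$$ Then at every point $P\in\gamma$ there is a support line of $\gamma$, and for every support line $\ell$ of $\gamma$ at $P$ the curve $\gamma$ lies in the closed disc bounded by the circle of radius $R_0$ that is tangent to $\ell$ at $P$ from the side of $\ell$ containing $\gamma$. II. Let $M=\mathbb{S}^2$ and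 $0<R_0<\pi/2$. Suppose that every proper subarc $\gamma_1$ of $\gamma$ has a swerve and $$\frac{\tau(\gamma_1)}{s(\gamma_1)}\ \ge\ \cot R_0 .$$ Then the same conclusion holds: at every point $P\in\gamma$ there is a support line of $\gamma$, and for every support line $\ell$ of $\gamma$ at $P$ the curve $\gamma$ lies in the closed disc bounded by the circle of (spherical) radius $R_0$ that is tangent to $\ell$ at $P$ from the side of $\ell$ containing $\gamma$. -/

import Mathlib

open scoped UpperHalfPlane

noncomputable section

namespace SpaceForm

/-! ## Closed curves, swerve and support lines (common part)

`M` is a plane of constant curvature, `turn p q r` is the signed exterior angle at `q` of the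
geodesic broken line `p, q, r` (positive for a turn to the left). -/

/-- A closed embedded rectifiable curve, parametrized with period `1`. -/
structure IsClosedEmbeddedRectifiable {M : Type} [MetricSpace M] (γ : ℝ → M) : Prop where
  continuous : Continuous γ
  periodic : Function.Periodic γ 1
  injOn : Set.InjOn γ (Set.Ico 0 1)
  rectifiable : eVariationOn γ (Set.Icc 0 1) ≠ ⊤

/-- The length of the subarc `γ|[a,b]`. -/
def arcLength {M : Type} [MetricSpace M] (γ : ℝ → M) (a b : ℝ) : ℝ :=
  (eVariationOn γ (Set.Icc a b)).toReal

/-- The integral geodesic curvature (swerve), measured from the left, of the subarc `γ|[a,b]` exists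
and equals `τ`: the sums of the exterior angles at the inner vertices of the geodesic broken lines
`γ (t 0), γ (t 1), …, γ (t (n + 1))` inscribed in the subarc, with `a = t 0 < ⋯ < t (n + 1) = b`,
tend to `τ` as the mesh of the partition tends to `0`. -/
def HasSwerve {M : Type} (turn : M → M → M → ℝ) (γ : ℝ → M) (a b τ : ℝ) : Prop :=
  ∀ ε : ℝ, 0 < ε → ∃ δ : ℝ, 0 < δ ∧ ∀ (n : ℕ) (t : ℕ → ℝ), t 0 = a → t (n + 1) = b →
    (∀ i ≤ n, t i < t (i + 1) ∧ t (i + 1) < t i + δ) →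
    |(∑ i ∈ Finset.range n, turn (γ (t i)) (γ (t (i + 1))) (γ (t (i + 2)))) - τ| < ε

/-- Every (proper) subarc of the closed curve `γ` has a swerve, and its specific curvature, the ratio
of the swerve to the length, is at least `k`. -/
def SpecificCurvatureGE {M : Type} [MetricSpace M] (turn : M → M → M → ℝ) (γ : ℝ → M) (k : ℝ) :
    Prop :=
  ∀ a b : ℝ, a < b → b < a + 1 → ∃ τ : ℝ, HasSwerve turn γ a b τ ∧ k ≤ τ / arcLength γ a b

/-- The geodesic line `{f = 0}` is a support line of `γ` at the point `P`, and `γ` is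
contained in the half-plane `{f ≥ 0}`. Here `IsLine f` says that `{f = 0}` is a geodesic line with
the two sides `{f ≥ 0}` and `{f ≤ 0}`. -/
def IsSupportLine {M : Type} (IsLine : (M → ℝ) → Prop) (γ : ℝ → M) (P : M) (f : M → ℝ) : Prop :=
  IsLine f ∧ f P = 0 ∧ ∀ s, 0 ≤ f (γ s)

/-- The curve `γ` lies in the closed disc that is bounded by the circle of radius `R` tangent to the
line `{f = 0}` at `P` from the side `{f ≥ 0}`: the centre `c` is on that side, and the line and the
circle have exactly the point `P` in common. -/
def LiesInTangentDisc {M : Type} (d : M → M → ℝ) (γ : ℝ → M) (P : M) (f : M → ℝ) (R : ℝ) : Prop :=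
  ∃ c : M, 0 ≤ f c ∧ {x | f x = 0} ∩ {x | d c x = R} = {P} ∧ ∀ s, d c (γ s) ≤ R

/-! ## The hyperbolic plane: Mathlib's upper half-plane with its metric of curvature `-1` -/

/-- For `p ≠ q`, a vector at `q` (as a complex number, up to a positive factor) tangent to the
geodesic ray from `q` through `p`. The conformal map `z ↦ (z - q) / (z - conj q)` of the
upper half-plane onto the unit disc takes the geodesic rays from `q` to radii, and its derivative at
`q` is a positive multiple of `-I`. -/
def hypDir (q p : ℍ) : ℂ :=
  Complex.I * (((p : ℂ) - (q : ℂ)) / ((p : ℂ) - (starRingEnd ℂ) (q : ℂ)))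

/-- The exterior angle at `q`, in `(-π, π]`, of the hyperbolic broken line `p, q, r`: the angle from
the direction of arrival `-hypDir q p` to the direction of departure `hypDir q r`. -/
def hypTurn (p q r : ℍ) : ℝ := Complex.arg (hypDir q r / (-hypDir q p))

/-- Geodesic lines of the upper half-plane (semicircles centred on the real axis and
vertical half-lines) with a choice of side. -/
def IsHypLine (f : ℍ → ℝ) : Prop :=
  ∃ A B C : ℝ, 4 * A * C < B ^ 2 ∧
    ∀ z : ℍ, f z = A * Complex.normSq (z : ℂ) + B * z.re + C

/-! ## The unit sphere -/

/-- Euclidean three-space. -/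
abbrev E3 : Type := EuclideanSpace ℝ (Fin 3)

/-- The unit sphere. Its metric as a subspace of `E3` gives its curves their
usual length. -/
abbrev S2 : Type := Metric.sphere (0 : E3) 1

/-- The intrinsic (angular) distance of the unit sphere. -/
def sphDist (p q : S2) : ℝ := InnerProductGeometry.angle (p : E3) (q : E3)

/-- The determinant of three vectors. -/
def det3 (u v w : E3) : ℝ := Matrix.det (Matrix.of fun i j => (![u, v, w] i) j)

/-- For `p ≠ ± q`, a vector tangent at `q` to the shortest great circle arc from `q` to `p`: the
orthogonal projection of `p` to the tangent plane at `q`. -/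
def sphDir (q p : S2) : E3 := (p : E3) - inner ℝ (p : E3) (q : E3) • (q : E3)

/-- The exterior angle at `q`, in `(-π, π]`, of the spherical broken line `p, q, r`: the angle from
the direction of arrival `-sphDir q p` to the direction of departure `sphDir q r`, counterclockwise
as seen from outside. -/
def sphTurn (p q r : S2) : ℝ :=
  Complex.arg ⟨inner ℝ (-sphDir q p) (sphDir q r), det3 (q : E3) (-sphDir q p) (sphDir q r)⟩

/-- Great circles of the unit sphere with a choice of side. -/
def IsSphLine (f : S2 → ℝ) : Prop :=
  ∃ n : E3, n ≠ 0 ∧ ∀ x : S2, f x = inner ℝ n (x : E3)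

end SpaceForm

end

noncomputable section

namespace CayleyKlein

/-! Both planes are treated at once, as the sphere (`ε = 1`) and the upper sheet of the hyperboloid
(`ε = -1`) in a three-space with the form `bil ε`. For points, `bil ε x y` is the cosine or
hyperbolic cosine of the distance, so a larger `ε * bil ε x y` means a smaller distance. The sign of
`det x y z` tells whether `x, y, z` is a left turn. A radius `r` is encoded by `(h, S)`, its cosine
and sine or their hyperbolic analogues, so that the circle of radius `r` has curvature `h / S`;
`(C₀, S₀)` belongs to `R₀`.

The only use of the full curvature hypothesis is `IsCurved.no_touch`. Measure the edges of an
inscribed broken line against the radial directions from a centre `c`. The exterior angles telescope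
to boundary angles plus the rotations along the edges, and outside a circle of radius `r > R₀` these
rotations are at most about `cot r` (or `coth r`) times the edge lengths. If both ends are farthest
from `c`, the boundary angles contribute nothing positive, so the swerve is smaller than `C₀ / S₀`
times the length, a contradiction. Hence an arc lying slightly inside some circle of radius larger
than `R₀` cannot dip towards its centre (`IsCurved.no_dip`).

Convexity. Existence of the swerve forces the sums of exterior angles of two fine broken lines with
common last edges to agree (`IsCurved.turn_last`). This gives one-sided tangents in the strong sense
that all short chords on one side have nearly the same direction (`IsCurved.exists_direction`). A
short arc of this kind is convex by comparison with a large circle through its end points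
(`IsCurved.det_pos_of_isStraight`). Positivity of the swerve excludes right turns and cusps, so the
curve is locally convex (`IsCurved.det_pos_near_zero`). Local convexity and embeddedness give global
convexity (`IsLocConvex.convex`): at the first failure the curve enters the hull of its own convex
arc, can leave only through the chord, and before leaving must produce another such trap, which
cannot go on within a bounded parameter range.

Discs. For a convex arc take the circle of radius `r > R₀` through its end points with centre on the
other side of the chord. The arc does not enter it, by rotating the circle about one end point to
the first contact (`IsCurved.bil_le_of_chord`). So at that end the support line is at least as steep
as the circle, which says that the other end point lies in the tangent disc of radius `r`
(`IsCurved.normal_bound`, `IsCurved.bil_center_le_of_lt`). This needs the end points to be closer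
than `2 r`; otherwise two different points of the curve would both be the point of the tangent disc
diametrically opposite to the point of support (`IsCurved.lt_bil`). Finally `r` tends to `R₀`.
Convexity also makes the right tangent a support line (`IsCurved.exists_isSupport`). -/

/-- Vectors of the ambient three-space of the sphere and of the hyperboloid. -/
abbrev Vec : Type := Fin 3 → ℝ

/-- The ambient bilinear form: Euclidean for `ε = 1`, Lorentzian for `ε = -1`. -/
def bil (ε : ℝ) (x y : Vec) : ℝ := x 0 * y 0 + ε * (x 1 * y 1 + x 2 * y 2)

/-- The determinant of three vectors. -/
def det (x y z : Vec) : ℝ :=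
  x 0 * (y 1 * z 2 - y 2 * z 1) - x 1 * (y 0 * z 2 - y 2 * z 0) + x 2 * (y 0 * z 1 - y 1 * z 0)

/-- The complex number whose argument is the exterior angle at `q` of the broken line `p, q, r`. -/
def turnC (ε : ℝ) (p q r : Vec) : ℂ := ⟨ε * (bil ε p q * bil ε q r - bil ε p r), det p q r⟩

/-- The exterior angle at `q` of the broken line `p, q, r`. -/
def turn (ε : ℝ) (p q r : Vec) : ℝ := (turnC ε p q r).arg

/-- Points of the unit sphere (`ε = 1`) or of the upper sheet of the hyperboloid (`ε = -1`). -/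
def IsPt (ε : ℝ) (x : Vec) : Prop := bil ε x x = 1 ∧ (ε = -1 → 0 < x 0)

/-- The chord `2 sin (d / 2)` or `2 sinh (d / 2)` of two points at the distance `d`. -/
def chord (ε : ℝ) (x y : Vec) : ℝ := √(2 * (ε * (1 - bil ε x y)))

/-! ### Algebra of the form and the determinant; distances of points -/

lemma bil_comm (ε : ℝ) (x y : Vec) : bil ε x y = bil ε y x := by simp only [bil]; ring

lemma bil_add_left (ε : ℝ) (x y z : Vec) : bil ε (x + y) z = bil ε x z + bil ε y z := by
  simp only [bil, Pi.add_apply]; ring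

lemma bil_sub_left (ε : ℝ) (x y z : Vec) : bil ε (x - y) z = bil ε x z - bil ε y z := by
  simp only [bil, Pi.sub_apply]; ring

lemma bil_smul_left (ε a : ℝ) (x z : Vec) : bil ε (a • x) z = a * bil ε x z := by
  simp only [bil, Pi.smul_apply, smul_eq_mul]; ring

lemma bil_add_right (ε : ℝ) (x y z : Vec) : bil ε z (x + y) = bil ε z x + bil ε z y := by
  simp only [bil, Pi.add_apply]; ring

lemma bil_sub_right (ε : ℝ) (x y z : Vec) : bil ε z (x - y) = bil ε z x - bil ε z y := by
  simp only [bil, Pi.sub_apply]; ring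

lemma bil_smul_right (ε a : ℝ) (x z : Vec) : bil ε z (a • x) = a * bil ε z x := by
  simp only [bil, Pi.smul_apply, smul_eq_mul]; ring

lemma det_rotate (x y z : Vec) : det x y z = det y z x := by simp only [det]; ring

lemma det_swap (x y z : Vec) : det x y z = -det y x z := by simp only [det]; ring

lemma det_swap' (x y z : Vec) : det x y z = -det x z y := by simp only [det]; ring

@[simp] lemma det_self_left (x z : Vec) : det x x z = 0 := by simp only [det]; ring

@[simp] lemma det_self_right (x z : Vec) : det x z z = 0 := by simp only [det]; ring

@[simp] lemma det_self_outer (x z : Vec) : det x z x = 0 := by simp only [det]; ring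

lemma det_add_right (x y z w : Vec) : det x y (z + w) = det x y z + det x y w := by
  simp only [det, Pi.add_apply]; ring

lemma det_sub_right (x y z w : Vec) : det x y (z - w) = det x y z - det x y w := by
  simp only [det, Pi.sub_apply]; ring

lemma det_smul_right (a : ℝ) (x y z : Vec) : det x y (a • z) = a * det x y z := by
  simp only [det, Pi.smul_apply, smul_eq_mul]; ring

lemma continuous_bil (ε : ℝ) : Continuous fun p : Vec × Vec => bil ε p.1 p.2 := by
  unfold bil; fun_prop

lemma continuous_det : Continuous fun p : Vec × Vec × Vec => det p.1 p.2.1 p.2.2 := by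
  unfold det; fun_prop

@[fun_prop] lemma _root_.Continuous.ckBil {α : Type*} [TopologicalSpace α] {f g : α → Vec} (ε : ℝ)
    (hf : Continuous f) (hg : Continuous g) : Continuous fun a => bil ε (f a) (g a) :=
  (continuous_bil ε).comp (hf.prodMk hg)

@[fun_prop] lemma _root_.Continuous.ckDet {α : Type*} [TopologicalSpace α] {f g h : α → Vec}
    (hf : Continuous f) (hg : Continuous g) (hh : Continuous h) :
    Continuous fun a => det (f a) (g a) (h a) :=
  continuous_det.comp (hf.prodMk (hg.prodMk hh))

lemma _root_.Filter.Tendsto.ckDet {α : Type*} {l : Filter α} {f g h : α → Vec} {a b c : Vec}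
    (hf : Filter.Tendsto f l (nhds a)) (hg : Filter.Tendsto g l (nhds b))
    (hh : Filter.Tendsto h l (nhds c)) :
    Filter.Tendsto (fun t => det (f t) (g t) (h t)) l (nhds (det a b c)) :=
  (continuous_det.tendsto (a, b, c)).comp (hf.prodMk_nhds (hg.prodMk_nhds hh))

lemma _root_.Filter.Tendsto.ckBil {α : Type*} {l : Filter α} {f g : α → Vec} {a b : Vec} (ε : ℝ)
    (hf : Filter.Tendsto f l (nhds a)) (hg : Filter.Tendsto g l (nhds b)) :
    Filter.Tendsto (fun t => bil ε (f t) (g t)) l (nhds (bil ε a b)) :=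
  ((continuous_bil ε).tendsto (a, b)).comp (hf.prodMk_nhds hg)

/-- The Gram determinant identity. -/
lemma det_mul_det {ε : ℝ} (hε : ε ^ 2 = 1) (a b c d e f : Vec) :
    det a b c * det d e f =
      bil ε a d * (bil ε b e * bil ε c f - bil ε b f * bil ε c e)
      - bil ε a e * (bil ε b d * bil ε c f - bil ε b f * bil ε c d)
      + bil ε a f * (bil ε b d * bil ε c e - bil ε b e * bil ε c d) := by
  have h : det a b c * det d e f * ε ^ 2 =
      bil ε a d * (bil ε b e * bil ε c f - bil ε b f * bil ε c e)
      - bil ε a e * (bil ε b d * bil ε c f - bil ε b f * bil ε c d)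
      + bil ε a f * (bil ε b d * bil ε c e - bil ε b e * bil ε c d) := by
    simp only [det, bil]; ring
  rw [← h, hε, mul_one]

/-- The linear relation between four vectors, paired with a fifth one. -/
lemma cramer_bil (ε : ℝ) (a b c d w : Vec) :
    det b c d * bil ε a w - det a c d * bil ε b w + det a b d * bil ε c w
      - det a b c * bil ε d w = 0 := by
  simp only [det, bil]; ring

/-- The linear relation between four vectors. -/
lemma cramer (a b c x : Vec) :
    det a b c • x = det x b c • a + det a x c • b + det a b x • c := by
  ext i; fin_cases i <;> simp [det] <;> ring

/-- The Grassmann–Plücker relation. -/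
lemma grassmann_pluecker (p q e r a : Vec) :
    det p q e * det p r a - det p q r * det p e a + det p q a * det p e r = 0 := by
  simp only [det]; ring

lemma sq_of_sign {ε : ℝ} (hε : ε = 1 ∨ ε = -1) : ε ^ 2 = 1 := by
  rcases hε with rfl | rfl <;> norm_num

/-- Cauchy–Schwarz on the sphere; on the hyperboloid the reversed inequality `bil ≥ 1`, which comes
from ordinary Cauchy–Schwarz for the last two coordinates and needs both points on the upper sheet.
-/
lemma bil_cases {ε : ℝ} (hε : ε = 1 ∨ ε = -1) {x y : Vec} (hx : IsPt ε x) (hy : IsPt ε y) :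
    0 ≤ ε * (1 - bil ε x y) ∧ (bil ε x y = 1 → x = y) := by
  obtain ⟨hx1, hx0⟩ := hx
  obtain ⟨hy1, hy0⟩ := hy
  rcases hε with rfl | rfl
  · simp only [bil] at *
    constructor
    · nlinarith [sq_nonneg (x 0 - y 0), sq_nonneg (x 1 - y 1), sq_nonneg (x 2 - y 2)]
    · intro h
      have h2 : (x 0 - y 0) ^ 2 + (x 1 - y 1) ^ 2 + (x 2 - y 2) ^ 2 = 0 := by nlinarith
      have e0 : (x 0 - y 0) ^ 2 = 0 := by
        nlinarith [sq_nonneg (x 0 - y 0), sq_nonneg (x 1 - y 1), sq_nonneg (x 2 - y 2)]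
      have e1 : (x 1 - y 1) ^ 2 = 0 := by
        nlinarith [sq_nonneg (x 0 - y 0), sq_nonneg (x 1 - y 1), sq_nonneg (x 2 - y 2)]
      have e2 : (x 2 - y 2) ^ 2 = 0 := by
        nlinarith [sq_nonneg (x 0 - y 0), sq_nonneg (x 1 - y 1), sq_nonneg (x 2 - y 2)]
      rw [pow_eq_zero_iff two_ne_zero, sub_eq_zero] at e0 e1 e2
      ext i; fin_cases i <;> assumption
  · replace hx0 := hx0 rfl
    replace hy0 := hy0 rfl
    simp only [bil] at hx1 hy1 ⊢
    obtain ⟨a, ha⟩ : ∃ a, a = x 1 ^ 2 + x 2 ^ 2 := ⟨_, rfl⟩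
    obtain ⟨b, hb⟩ : ∃ b, b = y 1 ^ 2 + y 2 ^ 2 := ⟨_, rfl⟩
    obtain ⟨p, hp⟩ : ∃ p, p = x 1 * y 1 + x 2 * y 2 := ⟨_, rfl⟩
    have hxa : x 0 ^ 2 = 1 + a := by rw [ha]; linarith
    have hyb : y 0 ^ 2 = 1 + b := by rw [hb]; linarith
    have hpab : p ^ 2 + (x 1 * y 2 - x 2 * y 1) ^ 2 = a * b := by simp only [ha, hb, hp]; ring
    have h2p : a + b - 2 * p = (x 1 - y 1) ^ 2 + (x 2 - y 2) ^ 2 := by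
      simp only [ha, hb, hp]; ring
    have hxy : 0 < x 0 * y 0 := mul_pos hx0 hy0
    have hsq : (x 0 * y 0) ^ 2 = (1 + a) * (1 + b) := by rw [mul_pow, hxa, hyb]
    have key : 1 + p ≤ x 0 * y 0 := by
      refine (abs_le_of_sq_le_sq' ?_ hxy.le).2
      rw [hsq]
      linarith [sq_nonneg (x 1 - y 1), sq_nonneg (x 2 - y 2), sq_nonneg (x 1 * y 2 - x 2 * y 1)]
    constructor
    · linarith
    · intro h
      have h1 : x 0 * y 0 = 1 + p := by linarith
      rw [h1] at hsq
      have h2 : (x 1 - y 1) ^ 2 + (x 2 - y 2) ^ 2 + (x 1 * y 2 - x 2 * y 1) ^ 2 = 0 := by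
        linear_combination -hsq - h2p + hpab
      have e1 : (x 1 - y 1) ^ 2 = 0 := by
        nlinarith [sq_nonneg (x 1 - y 1), sq_nonneg (x 2 - y 2), sq_nonneg (x 1 * y 2 - x 2 * y 1)]
      have e2 : (x 2 - y 2) ^ 2 = 0 := by
        nlinarith [sq_nonneg (x 1 - y 1), sq_nonneg (x 2 - y 2), sq_nonneg (x 1 * y 2 - x 2 * y 1)]
      rw [pow_eq_zero_iff two_ne_zero, sub_eq_zero] at e1 e2
      have e0 : x 0 = y 0 := by
        have : x 0 ^ 2 = y 0 ^ 2 := by rw [hxa, hyb, ha, hb, e1, e2]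
        exact (sq_eq_sq₀ hx0.le hy0.le).1 this
      ext i; fin_cases i <;> assumption

lemma bil_le {ε : ℝ} (hε : ε = 1 ∨ ε = -1) {x y : Vec} (hx : IsPt ε x) (hy : IsPt ε y) :
    0 ≤ ε * (1 - bil ε x y) := (bil_cases hε hx hy).1

lemma bil_lt {ε : ℝ} (hε : ε = 1 ∨ ε = -1) {x y : Vec} (hx : IsPt ε x) (hy : IsPt ε y)
    (hxy : x ≠ y) : 0 < ε * (1 - bil ε x y) := by
  refine lt_of_le_of_ne (bil_le hε hx hy) fun h => hxy ((bil_cases hε hx hy).2 ?_)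
  rcases hε with rfl | rfl <;> linarith

/-! ### Broken lines given by lists of parameters -/

/-- The sum of `f` over the consecutive triples of a list. -/
def tripleSum (f : ℝ → ℝ → ℝ → ℝ) : List ℝ → ℝ
  | a :: b :: c :: l => f a b c + tripleSum f (b :: c :: l)
  | _ => 0

/-- The sum of `g` over the consecutive pairs of a list. -/
def pairSum (g : ℝ → ℝ → ℝ) : List ℝ → ℝ
  | a :: b :: l => g a b + pairSum g (b :: l)
  | _ => 0

/-- Increasing lists with gaps less than `δ`. -/
def IsFine (δ : ℝ) (l : List ℝ) : Prop := l.IsChain fun x y => x < y ∧ y < x + δ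

/-- A closed embedded curve of points such that the swerve of each proper subarc is at least `k`
times its length. -/
structure IsCurved (ε k : ℝ) (X : ℝ → Vec) : Prop where
  continuous : Continuous X
  isPt : ∀ t, IsPt ε (X t)
  periodic : ∀ t, X (t + 1) = X t
  injective : ∀ s t, s < t → t < s + 1 → X s ≠ X t
  swerve : ∀ a b, a < b → b < a + 1 → ∃ τ ℓ : ℝ, 0 < ℓ ∧ k * ℓ ≤ τ ∧
    (∀ η > 0, ∃ δ > 0, ∀ l : List ℝ, IsFine δ (a :: (l ++ [b])) →
      |tripleSum (fun p q r => turn ε (X p) (X q) (X r)) (a :: (l ++ [b])) - τ| < η) ∧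
    (∀ η > 0, ∃ δ > 0, ∀ l : List ℝ, IsFine δ (a :: (l ++ [b])) →
      pairSum (fun p q => chord ε (X p) (X q)) (a :: (l ++ [b])) ≤ ℓ + η)

/-- An exterior angle involves two edges, so the two pieces have to share the whole edge `x, y`, not
just a vertex. -/
lemma tripleSum_append (f : ℝ → ℝ → ℝ → ℝ) (l l' : List ℝ) (x y : ℝ) :
    tripleSum f (l ++ x :: y :: l') = tripleSum f (l ++ [x, y]) + tripleSum f (x :: y :: l') := by
  induction l with
  | nil => simp [tripleSum]
  | cons a l ih =>
    match l with
    | [] => simp [tripleSum]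
    | [b] => simp [tripleSum] at ih ⊢; linarith
    | b :: c :: l => simp [tripleSum] at ih ⊢; linarith

lemma IsFine.mono {δ δ' : ℝ} (h : δ ≤ δ') {l : List ℝ} (hl : IsFine δ l) : IsFine δ' l :=
  hl.imp fun _ _ hxy => ⟨hxy.1, by linarith⟩

lemma isFine_cons_cons {δ x y : ℝ} {l : List ℝ} :
    IsFine δ (x :: y :: l) ↔ (x < y ∧ y < x + δ) ∧ IsFine δ (y :: l) :=
  List.isChain_cons_cons

lemma isFine_append {δ x y : ℝ} {l l' : List ℝ} :
    IsFine δ (l ++ x :: y :: l') ↔ IsFine δ (l ++ [x]) ∧ (x < y ∧ y < x + δ) ∧ IsFine δ (y :: l') :=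
  List.isChain_append_cons_cons

lemma exists_isFine {δ : ℝ} (hδ : 0 < δ) {a b : ℝ} (hab : a < b) :
    ∃ l : List ℝ, IsFine δ (a :: (l ++ [b])) := by
  obtain ⟨n, hn⟩ := exists_nat_gt ((b - a) / (δ / 2))
  rw [div_lt_iff₀ (by linarith)] at hn
  induction n generalizing a with
  | zero => simp at hn; linarith
  | succ n ih =>
    by_cases h : b < a + δ
    · exact ⟨[], isFine_cons_cons.2 ⟨⟨hab, h⟩, List.isChain_singleton _⟩⟩
    · push Not at h
      obtain ⟨l, hl⟩ := ih (a := a + δ / 2) (by linarith) (by push_cast at hn; linarith)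
      exact ⟨(a + δ / 2) :: l, isFine_cons_cons.2 ⟨⟨by linarith, by linarith⟩, hl⟩⟩

/-! ### The touching lemma -/

/-- Two arguments in `(0, π)` differ by less than `π`, so no multiple of `2π` intervenes. -/
lemma arg_mul_conj {z w : ℂ} (hz : 0 < z.im) (hw : 0 < w.im) :
    (z * (starRingEnd ℂ) w).arg = z.arg - w.arg := by
  have hz0 : z ≠ 0 := fun h => by simp [h] at hz
  have hw0 : w ≠ 0 := fun h => by simp [h] at hw
  have h1 : 0 ≤ z.arg ∧ z.arg < Real.pi :=
    ⟨Complex.arg_nonneg_iff.2 hz.le, Complex.arg_lt_pi_iff.2 (Or.inr hz.ne')⟩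
  have h2 : 0 ≤ w.arg ∧ w.arg < Real.pi :=
    ⟨Complex.arg_nonneg_iff.2 hw.le, Complex.arg_lt_pi_iff.2 (Or.inr hw.ne')⟩
  have h3 : ((starRingEnd ℂ) w).arg = -w.arg := by
    rw [Complex.arg_conj, if_neg h2.2.ne]
  rw [(Complex.arg_mul_eq_add_arg_iff hz0 (by simpa using hw0)).2, h3, sub_eq_add_neg]
  rw [h3]
  exact ⟨by linarith, by linarith⟩

/-- For a broken line with the edge `x, y` seen from `c`: the angle at `x` from the radial
direction to the edge. -/
def outC (ε : ℝ) (c x y : Vec) : ℂ := turnC ε c x y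

/-- The angle at `y` from the radial direction to the edge `x, y`. -/
def inC (ε : ℝ) (c x y : Vec) : ℂ := ⟨ε * (bil ε c x - bil ε c y * bil ε x y), det c x y⟩

/-- This makes the exterior angle at `q` the angle of the departing edge with the radial direction
minus that of the arriving edge. The real factor is the squared sine (hyperbolic sine) of the
distance from `c` to `q`. The real part is a Gram determinant, the imaginary part the linear
relation between four vectors. -/
lemma outC_mul_conj_inC {ε : ℝ} (hε : ε = 1 ∨ ε = -1) {c p q r : Vec} (hc : bil ε c c = 1)
    (hq : bil ε q q = 1) :
    outC ε c q r * (starRingEnd ℂ) (inC ε c p q) =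
      ((ε * (1 - bil ε c q ^ 2) : ℝ) : ℂ) * turnC ε p q r := by
  have h2 := sq_of_sign hε
  have g := det_mul_det h2 c q r c p q
  have e := cramer_bil ε c p q r (c - bil ε c q • q)
  simp only [bil_sub_right, bil_smul_right, hc, hq] at e
  rw [hc, hq, bil_comm ε q c, bil_comm ε q p, bil_comm ε r p, bil_comm ε r q, bil_comm ε r c] at g
  rw [bil_comm ε p c, bil_comm ε q c, bil_comm ε r c, bil_comm ε r q] at e
  apply Complex.ext
  · simp only [outC, inC, turnC, Complex.mul_re, Complex.conj_re, Complex.conj_im,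
      Complex.ofReal_re, Complex.ofReal_im]
    linear_combination g + ((bil ε c q * bil ε q r - bil ε c r) *
      (bil ε c p - bil ε c q * bil ε p q) -
      (1 - bil ε c q ^ 2) * (bil ε p q * bil ε q r - bil ε p r)) * h2
  · simp only [outC, inC, turnC, Complex.mul_im, Complex.conj_re, Complex.conj_im,
      Complex.ofReal_re, Complex.ofReal_im]
    linear_combination (-ε) * e

lemma turn_eq_sub {ε : ℝ} (hε : ε = 1 ∨ ε = -1) {c p q r : Vec} (hc : IsPt ε c) (hq : IsPt ε q)
    (hpq : 0 < det c p q) (hqr : 0 < det c q r) :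
    turn ε p q r = (outC ε c q r).arg - (inC ε c p q).arg := by
  rw [← arg_mul_conj (by exact hqr) (by exact hpq), outC_mul_conj_inC hε hc.1 hq.1,
    Complex.arg_real_mul, turn]
  have hcq : c ≠ q := by rintro rfl; simp at hqr
  have h1 := bil_lt hε hc hq hcq
  have hpos : 0 < 1 + bil ε c q ∨ ¬ 0 < 1 + bil ε c q := em _
  have g := det_mul_det (sq_of_sign hε) c p q c p q
  rw [hc.1, hq.1, bil_comm ε q c, bil_comm ε q p, bil_comm ε p c] at g
  rcases hε with rfl | rfl
  -- On the sphere the factor would also vanish at the antipode of `c`, where `det c q r` is zero.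
  · have h2 : -1 < bil 1 c q := by
      have : IsPt 1 (-q) := ⟨by simpa [bil] using hq.1, by norm_num⟩
      have hne : c ≠ -q := by
        rintro rfl
        simp only [det, Pi.neg_apply] at hqr
        nlinarith
      have := bil_lt (Or.inl rfl) hc this hne
      have e : bil 1 c (-q) = -bil 1 c q := by simp [bil]; ring
      rw [e] at this
      linarith
    nlinarith
  · nlinarith

/-- The rotation of the radial angle along one edge. Divided by `ε * (1 - bil ε x y)`, the
right-hand side stays away from zero for short edges, and its slope can be estimated in `edge_real`.
-/
lemma outC_mul_conj_inC_edge {ε : ℝ} (hε : ε = 1 ∨ ε = -1) {c x y : Vec} (hc : bil ε c c = 1)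
    (hx : bil ε x x = 1) (hy : bil ε y y = 1) :
    outC ε c x y * (starRingEnd ℂ) (inC ε c x y) = ((ε * (1 - bil ε x y) : ℝ) : ℂ) *
      ⟨ε * (1 - bil ε c x ^ 2) + ε * (1 - bil ε c y ^ 2)
        - ε * (1 - bil ε x y) * (1 + bil ε c x * bil ε c y),
        det c x y * (bil ε c x + bil ε c y)⟩ := by
  have h2 := sq_of_sign hε
  have g := det_mul_det h2 c x y c x y
  rw [hc, hx, hy, bil_comm ε x c, bil_comm ε y c, bil_comm ε y x] at g
  apply Complex.ext
  · simp only [outC, inC, turnC, Complex.mul_re, Complex.conj_re, Complex.conj_im,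
      Complex.ofReal_re, Complex.ofReal_im]
    linear_combination g + ((bil ε c x * bil ε x y - bil ε c y) *
      (bil ε c x - bil ε c y * bil ε x y) - (1 - bil ε x y) * ((1 - bil ε c x ^ 2) +
      (1 - bil ε c y ^ 2) - (1 - bil ε x y) * (1 + bil ε c x * bil ε c y))) * h2
  · simp only [outC, inC, turnC, Complex.mul_im, Complex.conj_re, Complex.conj_im,
      Complex.ofReal_re, Complex.ofReal_im]
    ring

lemma sqrt_one_add_le {q : ℝ} (hq : 0 ≤ q) : √(q * (2 + q)) ≤ √(2 * q) * (1 + q) := by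
  rw [Real.sqrt_le_left (by positivity), mul_pow, Real.sq_sqrt (by positivity)]
  nlinarith [mul_nonneg hq hq, mul_nonneg (mul_nonneg hq hq) hq]

lemma arg_mk_le_div {x y : ℝ} (hx : 0 < x) (hy : 0 < y) : Complex.arg ⟨x, y⟩ ≤ y / x := by
  have h1 : 0 ≤ Complex.arg ⟨x, y⟩ := Complex.arg_nonneg_iff.2 hy.le
  have h2 : Complex.arg ⟨x, y⟩ < Real.pi / 2 :=
    lt_of_le_of_lt (le_abs_self _) (Complex.abs_arg_lt_pi_div_two_iff.2 (Or.inl hx))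
  calc Complex.arg ⟨x, y⟩ ≤ Real.tan (Complex.arg ⟨x, y⟩) := Real.le_tan h1 h2
    _ = y / x := Complex.tan_arg _

lemma radius_bounds {ε : ℝ} (hε : ε = 1 ∨ ε = -1) {h₀ s₀ h : ℝ} (hh₀ : 0 < h₀) (hs₀ : 0 < s₀)
    (hs : s₀ ^ 2 = ε * (1 - h₀ ^ 2)) (hh : 0 < h) (hle : ε * h ≤ ε * h₀) :
    s₀ ^ 2 ≤ ε * (1 - h ^ 2) ∧ h ≤ h₀ / s₀ * √(ε * (1 - h ^ 2)) := by
  have h3 : s₀ ^ 2 ≤ ε * (1 - h ^ 2) := by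
    rw [hs]; rcases hε with rfl | rfl <;> nlinarith
  refine ⟨h3, ?_⟩
  rw [div_mul_eq_mul_div, le_div_iff₀ hs₀]
  refine (abs_le_of_sq_le_sq' ?_ (by positivity)).2
  rw [mul_pow, mul_pow, Real.sq_sqrt (le_trans (by positivity) h3), hs]
  rcases hε with rfl | rfl <;> nlinarith

lemma edge_num_le {a A D k₀ σ : ℝ} (ha : 0 < a) (hA : 0 < A) (hσ : 0 ≤ σ)
    (hD : D ≤ √A * σ) (hak : a ≤ k₀ * √A) : D * a ≤ k₀ * σ * A := by
  calc D * a ≤ (√A * σ) * (k₀ * √A) := by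
        apply mul_le_mul hD hak ha.le; positivity
    _ = k₀ * σ * (√A * √A) := by ring
    _ = k₀ * σ * A := by rw [Real.mul_self_sqrt hA.le]

lemma edge_den_le {ε : ℝ} (hε : ε = 1 ∨ ε = -1) {a b A B q s₀ M : ℝ} (hs₀ : 0 < s₀)
    (hq : 0 < q) (hA : A = ε * (1 - a ^ 2)) (hB : B = ε * (1 - b ^ 2)) (hA' : s₀ ^ 2 ≤ A)
    (hB' : s₀ ^ 2 ≤ B) (hM : M = 1 / s₀ ^ 2 + 1 / 2) :
    (A + B) * (1 - q * M) ≤ A + B - q * (1 + a * b) := by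
  have hs2 : 0 < s₀ ^ 2 := by positivity
  have e2 : a * b ≤ 1 + (A + B) / 2 := by
    have h1 : 2 * (a * b) ≤ a ^ 2 + b ^ 2 := by nlinarith [sq_nonneg (a - b)]
    rcases hε with rfl | rfl <;> linarith
  have e3 : 2 ≤ (A + B) * (1 / s₀ ^ 2) := by
    rw [mul_one_div, le_div_iff₀ hs2]; linarith
  have e1 : 1 + a * b ≤ (A + B) * M := by rw [hM]; linarith
  have := mul_le_mul_of_nonneg_left e1 hq.le
  linarith

/-- Here `a`, `b`, `β` are the products of `c` with the ends of the edge and of the ends with each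
other, and `√(2 * q)` is the chord. With `A`, `B` the squared sines of the radii, the numerator is
at most `(h₀ / s₀) * σ * (A + B)` and the denominator at least `(A + B) * (1 - q * M)`. So the slope
is about `h₀ / s₀` times the chord, and the slack up to `k₁` absorbs the terms of order `q`. -/
lemma edge_real {ε : ℝ} (hε : ε = 1 ∨ ε = -1) {a b β D q h₀ s₀ k₁ M : ℝ} (hh₀ : 0 < h₀)
    (hs₀ : 0 < s₀) (hs : s₀ ^ 2 = ε * (1 - h₀ ^ 2)) (hM : M = 1 / s₀ ^ 2 + 1 / 2) (ha : 0 < a)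
    (hb : 0 < b) (ha₀ : ε * a ≤ ε * h₀) (hb₀ : ε * b ≤ ε * h₀) (hD : 0 < D)
    (hqd : q = ε * (1 - β)) (hq0 : 0 < q) (hk₁ : 0 < k₁)
    (g : D ^ 2 = 1 + 2 * a * b * β - a ^ 2 - b ^ 2 - β ^ 2)
    (hq1 : q * M < 1) (hq : q * (h₀ / s₀ + k₁ * M) ≤ k₁ - h₀ / s₀) :
    Complex.arg ⟨ε * (1 - a ^ 2) + ε * (1 - b ^ 2) - q * (1 + a * b), D * (a + b)⟩ ≤
      k₁ * √(2 * q) := by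
  have h2 := sq_of_sign hε
  obtain ⟨ha1, ha2⟩ := radius_bounds hε hh₀ hs₀ hs ha ha₀
  obtain ⟨hb1, hb2⟩ := radius_bounds hε hh₀ hs₀ hs hb hb₀
  obtain ⟨A, hA⟩ : ∃ A, A = ε * (1 - a ^ 2) := ⟨_, rfl⟩
  obtain ⟨B, hB⟩ : ∃ B, B = ε * (1 - b ^ 2) := ⟨_, rfl⟩
  rw [← hA] at ha1 ha2 ⊢
  rw [← hB] at hb1 hb2 ⊢
  have hs2 : 0 < s₀ ^ 2 := by positivity
  have hA0 : 0 < A := lt_of_lt_of_le hs2 ha1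
  have hB0 : 0 < B := lt_of_lt_of_le hs2 hb1
  have hβq : β = 1 - ε * q := by rw [hqd]; linear_combination (1 - β) * h2
  have hqq : ε * (1 - β ^ 2) ≤ q * (2 + q) := by
    have h3 : ε * (1 - β ^ 2) = q * (2 - ε * q) := by
      rw [hβq]; linear_combination (q * 2 - ε * q ^ 2) * h2
    rw [h3]
    apply mul_le_mul_of_nonneg_left _ hq0.le
    rcases hε with rfl | rfl <;> linarith
  -- The Gram determinant is a product of two squared sines minus a square: the height of the
  -- triangle over its side is at most that side.
  have hDA : D ^ 2 ≤ A * (q * (2 + q)) := by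
    refine le_trans ?_ (mul_le_mul_of_nonneg_left hqq hA0.le)
    have h3 : D ^ 2 = A * (ε * (1 - β ^ 2)) - (b - a * β) ^ 2 := by
      rw [hA]; linear_combination g - (1 - a ^ 2) * (1 - β ^ 2) * h2
    linarith [sq_nonneg (b - a * β)]
  have hDB : D ^ 2 ≤ B * (q * (2 + q)) := by
    refine le_trans ?_ (mul_le_mul_of_nonneg_left hqq hB0.le)
    have h3 : D ^ 2 = B * (ε * (1 - β ^ 2)) - (a - b * β) ^ 2 := by
      rw [hB]; linear_combination g - (1 - b ^ 2) * (1 - β ^ 2) * h2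
    linarith [sq_nonneg (a - b * β)]
  obtain ⟨σ, hσ⟩ : ∃ σ, σ = √(q * (2 + q)) := ⟨_, rfl⟩
  have hσ0 : 0 ≤ σ := hσ ▸ Real.sqrt_nonneg _
  have hDA' : D ≤ √A * σ := by
    rw [hσ, ← Real.sqrt_mul hA0.le]; exact Real.le_sqrt_of_sq_le hDA
  have hDB' : D ≤ √B * σ := by
    rw [hσ, ← Real.sqrt_mul hB0.le]; exact Real.le_sqrt_of_sq_le hDB
  have hk0 : 0 < h₀ / s₀ := by positivity
  obtain ⟨k₀, hk₀⟩ : ∃ k₀, k₀ = h₀ / s₀ := ⟨_, rfl⟩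
  rw [← hk₀] at ha2 hb2 hk0 hq
  have hnum : D * (a + b) ≤ k₀ * σ * (A + B) := by
    linarith [edge_num_le ha hA0 hσ0 hDA' ha2, edge_num_le hb hB0 hσ0 hDB' hb2]
  have hden := edge_den_le hε hs₀ hq0 hA hB ha1 hb1 hM
  have hden0 : 0 < (A + B) * (1 - q * M) := mul_pos (by linarith) (by linarith)
  have hden1 : 0 < A + B - q * (1 + a * b) := lt_of_lt_of_le hden0 hden
  have hσq : σ ≤ √(2 * q) * (1 + q) := hσ ▸ sqrt_one_add_le hq0.le
  have hsq0 : 0 ≤ √(2 * q) := Real.sqrt_nonneg _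
  refine (arg_mk_le_div hden1 (by positivity)).trans ?_
  rw [div_le_iff₀ hden1]
  calc D * (a + b) ≤ k₀ * σ * (A + B) := hnum
    _ ≤ k₀ * (√(2 * q) * (1 + q)) * (A + B) := by gcongr
    _ = √(2 * q) * (A + B) * (k₀ * (1 + q)) := by ring
    _ ≤ √(2 * q) * (A + B) * (k₁ * (1 - q * M)) := by
        apply mul_le_mul_of_nonneg_left _ (by positivity)
        linarith
    _ = k₁ * √(2 * q) * ((A + B) * (1 - q * M)) := by ring
    _ ≤ k₁ * √(2 * q) * (A + B - q * (1 + a * b)) := by gcongr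

/-- The rotation of the edge relative to the radial direction is at most the curvature of the
circle times the length, up to a factor close to `1`. -/
lemma edge_le {ε : ℝ} (hε : ε = 1 ∨ ε = -1) {c x y : Vec} (hc : IsPt ε c) (hx : IsPt ε x)
    (hy : IsPt ε y) {h₀ s₀ k₁ M : ℝ} (hh₀ : 0 < h₀) (hs₀ : 0 < s₀) (hs : s₀ ^ 2 = ε * (1 - h₀ ^ 2))
    (hM : M = 1 / s₀ ^ 2 + 1 / 2) (hcx : 0 < bil ε c x) (hcy : 0 < bil ε c y)
    (hcx₀ : ε * bil ε c x ≤ ε * h₀) (hcy₀ : ε * bil ε c y ≤ ε * h₀) (hD : 0 < det c x y)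
    (hk₁ : 0 < k₁) (hq1 : ε * (1 - bil ε x y) * M < 1)
    (hq : ε * (1 - bil ε x y) * (h₀ / s₀ + k₁ * M) ≤ k₁ - h₀ / s₀) :
    (outC ε c x y).arg - (inC ε c x y).arg ≤ k₁ * chord ε x y := by
  have hxy : x ≠ y := by rintro rfl; simp at hD
  have hq0 := bil_lt hε hx hy hxy
  rw [← arg_mul_conj (by exact hD) (by exact hD), outC_mul_conj_inC_edge hε hc.1 hx.1 hy.1,
    Complex.arg_real_mul _ hq0]
  have g := det_mul_det (sq_of_sign hε) c x y c x y
  rw [hc.1, hx.1, hy.1, bil_comm ε x c, bil_comm ε y c, bil_comm ε y x] at g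
  exact edge_real hε hh₀ hs₀ hs hM hcx hcy hcx₀ hcy₀ hD rfl hq0 hk₁ (by rw [sq, g]; ring) hq1 hq

lemma IsFine.lt {δ a b : ℝ} {l : List ℝ} (h : IsFine δ (a :: (l ++ [b]))) : a < b := by
  induction l generalizing a with
  | nil => exact (isFine_cons_cons.1 h).1.1
  | cons y l ih =>
    have h' := isFine_cons_cons.1 h
    exact h'.1.1.trans (ih h'.2)

lemma exists_fine_bound {X : ℝ → Vec} (hX : Continuous X) {ε : ℝ} (hpt : ∀ t, IsPt ε (X t))
    {s u q : ℝ} (hq : 0 < q) : ∃ δ > 0, ∀ a ∈ Set.Icc s u, ∀ b ∈ Set.Icc s u, |b - a| < δ →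
      ε * (1 - bil ε (X a) (X b)) < q := by
  have hF : Continuous fun p : ℝ × ℝ => ε * (1 - bil ε (X p.1) (X p.2)) := by fun_prop
  have hK := (isCompact_Icc (a := s) (b := u)).prod (isCompact_Icc (a := s) (b := u))
  obtain ⟨δ, hδ, h⟩ := Metric.uniformContinuousOn_iff.1
    (hK.uniformContinuousOn_of_continuous hF.continuousOn) q hq
  refine ⟨δ, hδ, fun a ha b hb hab => ?_⟩
  have := h (a, b) ⟨ha, hb⟩ (a, a) ⟨ha, ha⟩ (by simpa [Prod.dist_eq, Real.dist_eq] using hab)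
  simp only [(hpt a).1, sub_self, mul_zero, Real.dist_eq, sub_zero] at this
  exact (le_abs_self _).trans_lt this

lemma half_pi_le_arg {z : ℂ} (hi : 0 < z.im) (hr : z.re ≤ 0) : Real.pi / 2 ≤ z.arg := by
  by_contra! h
  rcases Complex.arg_lt_pi_div_two_iff.1 h with h | h | h
  · linarith
  · linarith
  · simp [h] at hi

lemma curvature_lt {ε : ℝ} (hε : ε = 1 ∨ ε = -1) {C₀ S₀ h₀ : ℝ} (hC₀ : 0 < C₀) (hS₀ : 0 < S₀)
    (hCS : S₀ ^ 2 = ε * (1 - C₀ ^ 2)) (hh₀ : 0 < h₀) (hlt : ε * h₀ < ε * C₀) :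
    ∃ s₀ > 0, s₀ ^ 2 = ε * (1 - h₀ ^ 2) ∧ h₀ / s₀ < C₀ / S₀ := by
  have hS2 : 0 < S₀ ^ 2 := by positivity
  have h1 : 0 < ε * (1 - h₀ ^ 2) := by rcases hε with rfl | rfl <;> nlinarith
  refine ⟨√(ε * (1 - h₀ ^ 2)), Real.sqrt_pos.2 h1, Real.sq_sqrt h1.le, ?_⟩
  rw [div_lt_div_iff₀ (Real.sqrt_pos.2 h1) hS₀]
  refine lt_of_pow_lt_pow_left₀ 2 (by positivity) ?_
  rw [mul_pow, mul_pow, Real.sq_sqrt h1.le, hCS]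
  rcases hε with rfl | rfl <;> nlinarith

/-- A curved arc cannot touch, from outside and at its points nearest to the centre, a circle whose
radius is larger than the radius of the given curvature. -/
theorem IsCurved.no_touch {ε C₀ S₀ : ℝ} (hε : ε = 1 ∨ ε = -1) {X : ℝ → Vec}
    (hX : IsCurved ε (C₀ / S₀) X) (hC₀ : 0 < C₀) (hS₀ : 0 < S₀)
    (hCS : S₀ ^ 2 = ε * (1 - C₀ ^ 2)) {c : Vec} (hc : IsPt ε c) {s u : ℝ} (hsu : s < u)
    (hu : u < s + 1) {h₀ : ℝ} (hh₀ : 0 < h₀) (hlt : ε * h₀ < ε * C₀)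
    (hpos : ∀ t ∈ Set.Icc s u, 0 < bil ε c (X t))
    (hle : ∀ t ∈ Set.Icc s u, ε * bil ε c (X t) ≤ ε * h₀)
    (hends : ∀ t ∈ Set.Icc s u, ε * bil ε c (X s) ≤ ε * bil ε c (X t))
    (hendu : ∀ t ∈ Set.Icc s u, ε * bil ε c (X u) ≤ ε * bil ε c (X t))
    (hdet : ∀ t t', s ≤ t → t < t' → t' ≤ u → 0 < det c (X t) (X t')) : False := by
  obtain ⟨s₀, hs₀, hs, hk⟩ := curvature_lt hε hC₀ hS₀ hCS hh₀ hlt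
  -- The curvature `k₁` lies strictly between those of the circles of radius `r₀` and `R₀`: the
  -- lower gap pays for the finite edge lengths, the upper one gives the contradiction.
  obtain ⟨k₁, hk1, hk2⟩ := exists_between hk
  have hk0 : 0 < h₀ / s₀ := by positivity
  have hk₁ : 0 < k₁ := hk0.trans hk1
  obtain ⟨M, hM⟩ : ∃ M, M = 1 / s₀ ^ 2 + 1 / 2 := ⟨_, rfl⟩
  have hM0 : 0 < M := by rw [hM]; positivity
  obtain ⟨δ₀, hδ₀, hδb⟩ := exists_fine_bound hX.continuous hX.isPt (s := s) (u := u)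
    (q := min (1 / M) ((k₁ - h₀ / s₀) / (h₀ / s₀ + k₁ * M)))
    (lt_min (by positivity) (div_pos (by linarith) (by positivity)))
  obtain ⟨τ, ℓ, hℓ, hkτ, hτ, hlen⟩ := hX.swerve s u hsu hu
  -- Errors of `η` in the swerve and in the length cost `(1 + k₁) * η` together, half of the gap
  -- `(C₀ / S₀ - k₁) * ℓ`.
  obtain ⟨η, hη⟩ : ∃ η, η = (C₀ / S₀ - k₁) * ℓ / (2 * (1 + k₁)) := ⟨_, rfl⟩
  have hη0 : 0 < η := by rw [hη]; exact div_pos (mul_pos (by linarith) hℓ) (by linarith)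
  obtain ⟨δ₁, hδ₁, h1⟩ := hτ η hη0
  obtain ⟨δ₂, hδ₂, h2⟩ := hlen η hη0
  obtain ⟨l, hl⟩ := exists_isFine (lt_min hδ₀ (lt_min hδ₁ hδ₂)) hsu
  have hl0 := hl.mono (min_le_left _ _)
  have hl1 := h1 l (hl.mono ((min_le_right _ _).trans (min_le_left _ _)))
  have hl2 := h2 l (hl.mono ((min_le_right _ _).trans (min_le_right _ _)))
  have hedge : ∀ x y, s ≤ x → x < y → y < x + δ₀ → y ≤ u →
      (outC ε c (X x) (X y)).arg - (inC ε c (X x) (X y)).arg ≤ k₁ * chord ε (X x) (X y) := by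
    intro x y hsx hxy hyx hyu
    have hx : x ∈ Set.Icc s u := ⟨hsx, hxy.le.trans hyu⟩
    have hy : y ∈ Set.Icc s u := ⟨hsx.trans hxy.le, hyu⟩
    have hq := hδb x hx y hy (by rw [abs_of_pos (by linarith)]; linarith)
    refine edge_le hε hc (hX.isPt x) (hX.isPt y) hh₀ hs₀ hs hM (hpos x hx) (hpos y hy) (hle x hx)
      (hle y hy) (hdet x y hsx hxy hyu) hk₁ ?_ ?_
    · exact (lt_div_iff₀ hM0).1 (hq.trans_le (min_le_left _ _))
    · exact ((lt_div_iff₀ (by positivity)).1 (hq.trans_le (min_le_right _ _))).le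
  -- As `X u` is farthest from `c`, the last edge does not point inwards; likewise the first edge in
  -- `hout` does not point outwards.
  have hin : ∀ x, s ≤ x → x < u → (inC ε c (X x) (X u)).arg ≤ Real.pi / 2 := by
    intro x hsx hxu
    have hx : x ∈ Set.Icc s u := ⟨hsx, hxu.le⟩
    refine Complex.arg_le_pi_div_two_iff.2 (Or.inl ?_)
    have e1 := hendu x hx
    have e2 := bil_le hε (hX.isPt x) (hX.isPt u)
    have e3 := hpos u ⟨hsu.le, le_rfl⟩
    simp only [inC]
    rcases hε with rfl | rfl <;> nlinarith
  have hout : ∀ x, s < x → x ≤ u → Real.pi / 2 ≤ (outC ε c (X s) (X x)).arg := by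
    intro x hsx hxu
    have hx : x ∈ Set.Icc s u := ⟨hsx.le, hxu⟩
    refine half_pi_le_arg (hdet s x le_rfl hsx hxu) ?_
    have e1 := hends x hx
    have e2 := bil_le hε (hX.isPt s) (hX.isPt x)
    have e3 := hpos s ⟨le_rfl, hsu.le⟩
    simp only [outC, turnC]
    rcases hε with rfl | rfl <;> nlinarith
  -- Telescoping from the far end: each `turn` is an outgoing minus an incoming radial angle, and
  -- the two angles of one edge differ by at most `k₁` times its chord.
  have key : ∀ (l : List ℝ) (x : ℝ), s ≤ x → IsFine δ₀ (x :: (l ++ [u])) →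
      tripleSum (fun p q r => turn ε (X p) (X q) (X r)) (x :: (l ++ [u])) +
        (outC ε c (X x) (X ((l ++ [u]).headI))).arg ≤ Real.pi / 2 +
        k₁ * pairSum (fun p q => chord ε (X p) (X q)) (x :: (l ++ [u])) := by
    intro l
    induction l with
    | nil =>
      intro x hsx hf
      obtain ⟨hxu, -⟩ := isFine_cons_cons.1 hf
      have := hedge x u hsx hxu.1 hxu.2 le_rfl
      have := hin x hsx hxu.1
      simp [tripleSum, pairSum]
      linarith
    | cons y l ih =>
      intro x hsx hf
      obtain ⟨hxy, hf'⟩ := isFine_cons_cons.1 hf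
      replace hf' : IsFine δ₀ (y :: (l ++ [u])) := hf'
      have ih' := ih y (hsx.trans hxy.1.le) hf'
      have e := hedge x y hsx hxy.1 hxy.2 hf'.lt.le
      obtain ⟨z, r, hzr⟩ : ∃ z r, l ++ [u] = z :: r := by
        cases l with
        | nil => exact ⟨_, _, rfl⟩
        | cons a l => exact ⟨_, _, rfl⟩
      have hyz : y < z ∧ z ≤ u := by
        rw [hzr] at hf'
        refine ⟨(isFine_cons_cons.1 hf').1.1, ?_⟩
        cases l with
        | nil => simp at hzr; exact hzr.1.symm.le
        | cons a l =>
          simp at hzr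
          have := (isFine_cons_cons.1 hf').2
          rw [← hzr.2] at this
          exact this.lt.le
      simp only [List.cons_append, hzr, tripleSum, pairSum, List.headI] at ih' ⊢
      rw [turn_eq_sub hε hc (hX.isPt y) (hdet x y hsx hxy.1 hf'.lt.le)
        (hdet y z (hsx.trans hxy.1.le) hyz.1 hyz.2)]
      linarith
  have hfin := key l s le_rfl hl0
  have hhead : s < (l ++ [u]).headI ∧ (l ++ [u]).headI ≤ u := by
    cases l with
    | nil => exact ⟨hsu, le_rfl⟩
    | cons a l =>
      obtain ⟨h3, h4⟩ := isFine_cons_cons.1 hl0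
      exact ⟨h3.1, h4.lt.le⟩
  have h3 := hout _ hhead.1 hhead.2
  rw [abs_lt] at hl1
  have h4 : k₁ * pairSum (fun p q => chord ε (X p) (X q)) (s :: (l ++ [u])) ≤ k₁ * (ℓ + η) :=
    mul_le_mul_of_nonneg_left hl2 hk₁.le
  have h5 : η * (2 * (1 + k₁)) = (C₀ / S₀ - k₁) * ℓ := by
    rw [hη]; field_simp
  have h6 : 0 < (1 + k₁) * η := by positivity
  linarith [hl1.1]

/-! ### Symmetries -/

lemma tripleSum_congr {f g : ℝ → ℝ → ℝ → ℝ} (h : ∀ a b c, f a b c = g a b c) (l : List ℝ) :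
    tripleSum f l = tripleSum g l := by
  have : f = g := by funext a b c; exact h a b c
  rw [this]

lemma pairSum_append (g : ℝ → ℝ → ℝ) (l l' : List ℝ) (x : ℝ) :
    pairSum g (l ++ x :: l') = pairSum g (l ++ [x]) + pairSum g (x :: l') := by
  induction l with
  | nil => simp [pairSum]
  | cons a l ih =>
    match l with
    | [] => simp [pairSum]
    | b :: l => simp [pairSum] at ih ⊢; linarith

lemma tripleSum_map (f : ℝ → ℝ → ℝ → ℝ) (φ : ℝ → ℝ) (l : List ℝ) :
    tripleSum f (l.map φ) = tripleSum (fun a b c => f (φ a) (φ b) (φ c)) l := by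
  induction l with
  | nil => simp [tripleSum]
  | cons a l ih =>
    match l with
    | [] => simp [tripleSum]
    | [b] => simp [tripleSum]
    | b :: c :: l => simp [tripleSum] at ih ⊢; linarith

lemma pairSum_map (g : ℝ → ℝ → ℝ) (φ : ℝ → ℝ) (l : List ℝ) :
    pairSum g (l.map φ) = pairSum (fun a b => g (φ a) (φ b)) l := by
  induction l with
  | nil => simp [pairSum]
  | cons a l ih =>
    match l with
    | [] => simp [pairSum]
    | b :: l => simp [pairSum] at ih ⊢; linarith

lemma tripleSum_reverse (f : ℝ → ℝ → ℝ → ℝ) (l : List ℝ) :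
    tripleSum f l.reverse = tripleSum (fun a b c => f c b a) l := by
  induction l with
  | nil => simp [tripleSum]
  | cons a l ih =>
    match l with
    | [] => simp [tripleSum]
    | [b] => simp [tripleSum]
    | b :: c :: l =>
      have e : (a :: b :: c :: l).reverse = l.reverse ++ c :: b :: [a] := by simp
      have e' : (b :: c :: l).reverse = l.reverse ++ [c, b] := by simp
      rw [e, tripleSum_append, ← e', ih]
      simp [tripleSum]; ring

lemma pairSum_reverse (g : ℝ → ℝ → ℝ) (l : List ℝ) :
    pairSum g l.reverse = pairSum (fun a b => g b a) l := by
  induction l with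
  | nil => simp [pairSum]
  | cons a l ih =>
    match l with
    | [] => simp [pairSum]
    | b :: l =>
      have e : (a :: b :: l).reverse = l.reverse ++ b :: [a] := by simp
      have e' : (b :: l).reverse = l.reverse ++ [b] := by simp
      rw [e, pairSum_append, ← e', ih]
      simp [pairSum]; ring

lemma IsFine.map_add {δ : ℝ} {l : List ℝ} (h : IsFine δ l) (c : ℝ) :
    IsFine δ (l.map (· + c)) := by
  unfold IsFine at *
  rw [List.isChain_map]
  exact h.imp fun x y hxy => ⟨by linarith [hxy.1], by linarith [hxy.2]⟩

lemma IsFine.reverse_neg {δ : ℝ} {l : List ℝ} (h : IsFine δ l) :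
    IsFine δ (l.reverse.map (fun x => -x)) := by
  unfold IsFine at *
  rw [List.isChain_map, List.isChain_reverse]
  exact h.imp fun x y hxy => ⟨by linarith [hxy.1], by linarith [hxy.2]⟩

/-- Proper isometries of the sphere and of the hyperboloid. -/
structure IsIso (ε : ℝ) (g : Vec →ₗ[ℝ] Vec) : Prop where
  bil : ∀ x y, bil ε (g x) (g y) = bil ε x y
  det : ∀ x y z, det (g x) (g y) (g z) = det x y z
  pos : ∀ x, IsPt ε x → IsPt ε (g x)

lemma IsCurved.map {ε k : ℝ} (hε : ε = 1 ∨ ε = -1) {X : ℝ → Vec} (hX : IsCurved ε k X)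
    {g : Vec →ₗ[ℝ] Vec} (hg : IsIso ε g) : IsCurved ε k fun t => g (X t) where
  continuous := (LinearMap.continuous_of_finiteDimensional g).comp hX.continuous
  isPt t := hg.pos _ (hX.isPt t)
  periodic t := by rw [hX.periodic]
  injective s t hs ht h := by
    refine hX.injective s t hs ht ((bil_cases hε (hX.isPt s) (hX.isPt t)).2 ?_)
    have h1 := hg.bil (X s) (X t)
    rwa [← h, hg.bil, (hX.isPt s).1, eq_comm] at h1
  swerve a b hab hb := by
    obtain ⟨τ, ℓ, h1, h2, h3, h4⟩ := hX.swerve a b hab hb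
    refine ⟨τ, ℓ, h1, h2, ?_, ?_⟩
    · simpa only [turn, turnC, hg.bil, hg.det] using h3
    · simpa only [chord, hg.bil] using h4

lemma IsCurved.shift {ε k : ℝ} {X : ℝ → Vec} (hX : IsCurved ε k X) (c : ℝ) :
    IsCurved ε k fun t => X (t + c) where
  continuous := hX.continuous.comp (continuous_id.add continuous_const)
  isPt t := hX.isPt _
  periodic t := by rw [add_right_comm, hX.periodic]
  injective s t hs ht := hX.injective _ _ (by linarith) (by linarith)
  swerve a b hab hb := by
    obtain ⟨τ, ℓ, h1, h2, h3, h4⟩ := hX.swerve (a + c) (b + c) (by linarith) (by linarith)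
    have e : ∀ l : List ℝ, (a + c) :: (l.map (· + c) ++ [b + c]) = (a :: (l ++ [b])).map (· + c) := by
      intro l; simp
    refine ⟨τ, ℓ, h1, h2, fun η hη => ?_, fun η hη => ?_⟩
    · obtain ⟨δ, hδ, h⟩ := h3 η hη
      refine ⟨δ, hδ, fun l hl => ?_⟩
      have := h (l.map (· + c)) (by rw [e]; exact hl.map_add c)
      rwa [e, tripleSum_map] at this
    · obtain ⟨δ, hδ, h⟩ := h4 η hη
      refine ⟨δ, hδ, fun l hl => ?_⟩
      have := h (l.map (· + c)) (by rw [e]; exact hl.map_add c)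
      rwa [e, pairSum_map] at this

/-- The reflection in the last coordinate. -/
def mirror (x : Vec) : Vec := ![x 0, x 1, -x 2]

lemma bil_mirror (ε : ℝ) (x y : Vec) : bil ε (mirror x) (mirror y) = bil ε x y := by
  simp [bil, mirror]

lemma det_mirror (x y z : Vec) : det (mirror x) (mirror y) (mirror z) = -det x y z := by
  simp [det, mirror]; ring

lemma mirror_mirror (x : Vec) : mirror (mirror x) = x := by
  ext i; fin_cases i <;> simp [mirror]

lemma continuous_mirror : Continuous mirror := by
  refine continuous_pi fun i => ?_
  fin_cases i <;> simp [mirror] <;> fun_prop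

lemma IsPt.mirror {ε : ℝ} {x : Vec} (h : IsPt ε x) : IsPt ε (mirror x) :=
  ⟨by rw [bil_mirror]; exact h.1, fun hε => by simpa [CayleyKlein.mirror] using h.2 hε⟩

/-- Reflection and reversal of the direction each change the sign of an exterior angle. -/
lemma turn_mirror (ε : ℝ) (p q r : Vec) :
    turn ε (mirror r) (mirror q) (mirror p) = turn ε p q r := by
  have : det r q p = -det p q r := by simp only [det]; ring
  simp only [turn, turnC, bil_mirror, det_mirror, this, neg_neg]
  rw [bil_comm ε r q, bil_comm ε q p, bil_comm ε r p, mul_comm (bil ε q r)]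

/-- The mirror image of the curve run through in the opposite direction. -/
lemma IsCurved.mirror {ε k : ℝ} {X : ℝ → Vec} (hX : IsCurved ε k X) :
    IsCurved ε k fun t => mirror (X (-t)) where
  continuous := continuous_mirror.comp (hX.continuous.comp continuous_neg)
  isPt t := (hX.isPt _).mirror
  periodic t := by rw [← hX.periodic (-(t + 1))]; congr 2; ring
  injective s t hs ht h := by
    have h' := congrArg CayleyKlein.mirror h
    simp only [mirror_mirror] at h'
    exact hX.injective (-t) (-s) (by linarith) (by linarith) h'.symm
  swerve a b hab hb := by
    obtain ⟨τ, ℓ, h1, h2, h3, h4⟩ := hX.swerve (-b) (-a) (by linarith) (by linarith)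
    have e : ∀ l : List ℝ, -b :: (l.reverse.map (fun x => -x) ++ [-a]) =
        (a :: (l ++ [b])).reverse.map (fun x => -x) := by
      intro l; simp
    refine ⟨τ, ℓ, h1, h2, fun η hη => ?_, fun η hη => ?_⟩
    · obtain ⟨δ, hδ, h⟩ := h3 η hη
      refine ⟨δ, hδ, fun l hl => ?_⟩
      have := h (l.reverse.map (fun x => -x)) (by rw [e]; exact hl.reverse_neg)
      rw [e, tripleSum_map, tripleSum_reverse] at this
      rwa [tripleSum_congr fun a b c => turn_mirror ε (X (-c)) (X (-b)) (X (-a))]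
    · obtain ⟨δ, hδ, h⟩ := h4 η hη
      refine ⟨δ, hδ, fun l hl => ?_⟩
      have := h (l.reverse.map (fun x => -x)) (by rw [e]; exact hl.reverse_neg)
      rw [e, pairSum_map, pairSum_reverse] at this
      convert this using 4 with p q
      simp only [chord, bil_mirror, bil_comm]

/-- The base point of the frame. -/
def e₀ : Vec := ![1, 0, 0]

/-- Two distinct, non-antipodal points can be moved to the first coordinate plane. -/
lemma exists_frame {ε : ℝ} (hε : ε = 1 ∨ ε = -1) {p y : Vec} (hp : IsPt ε p) (hy : IsPt ε y)
    (hB : 0 < ε * (1 - bil ε p y ^ 2)) :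
    ∃ g : Vec →ₗ[ℝ] Vec, IsIso ε g ∧ g p = e₀ ∧
      g y = ![bil ε p y, √(ε * (1 - bil ε p y ^ 2)), 0] := by
  have h2 := sq_of_sign hε
  obtain ⟨σ, hσ⟩ : ∃ σ, σ = √(ε * (1 - bil ε p y ^ 2)) := ⟨_, rfl⟩
  have hσ0 : 0 < σ := hσ ▸ Real.sqrt_pos.2 hB
  have hσ2 : σ ^ 2 = ε * (1 - bil ε p y ^ 2) := hσ ▸ Real.sq_sqrt hB.le
  rw [← hσ]
  -- The unit tangent vector at `p` towards `y`. The isometry consists of the coordinates with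
  -- respect to `p`, `T` and their cross product.
  obtain ⟨T, hT⟩ : ∃ T : Vec, T = σ⁻¹ • (y - bil ε p y • p) := ⟨_, rfl⟩
  have hpT : bil ε p T = 0 := by
    rw [hT, bil_smul_right, bil_sub_right, bil_smul_right, hp.1]; ring
  have hyT : bil ε T y = ε * σ := by
    rw [hT, bil_smul_left, bil_sub_left, bil_smul_left, hy.1]
    field_simp
    linear_combination (bil ε p y ^ 2 - 1) * h2 - ε * hσ2
  have hTT : bil ε T T = ε := by
    have e : bil ε T T = σ⁻¹ * bil ε T y - σ⁻¹ * bil ε p y * bil ε T p := by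
      conv_lhs => rw [hT, bil_smul_right, bil_sub_right, bil_smul_right]
      rw [← hT]; ring
    rw [e, hyT, bil_comm ε T p, hpT]
    field_simp
    ring
  have hpyT : det p T y = 0 := by
    rw [hT]; simp only [det, Pi.smul_apply, Pi.sub_apply, smul_eq_mul]; ring
  have hpTp : det p T p = 0 := det_self_outer _ _
  -- This expression is the determinant of `g`.
  have hc : (p 1 * T 2 - p 2 * T 1) ^ 2 * ε + (p 0 * T 2 - p 2 * T 0) ^ 2 +
      (p 0 * T 1 - p 1 * T 0) ^ 2 = 1 := by
    have h1 := hp.1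
    simp only [bil] at h1 hTT hpT
    rcases hε with rfl | rfl
    · linear_combination (T 0 * T 0 + (T 1 * T 1 + T 2 * T 2)) * h1 + hTT -
        (p 0 * T 0 + (p 1 * T 1 + p 2 * T 2)) * hpT
    · linear_combination (-(T 0 * T 0 - (T 1 * T 1 + T 2 * T 2))) * h1 - hTT +
        (p 0 * T 0 - (p 1 * T 1 + p 2 * T 2)) * hpT
  let g : Vec →ₗ[ℝ] Vec :=
    { toFun := fun x => ![bil ε p x, ε * bil ε T x, det p T x]
      map_add' := fun x y => by
        ext i; fin_cases i <;> simp [bil_add_right, det_add_right, mul_add]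
      map_smul' := fun a x => by
        ext i; fin_cases i <;> simp [bil_smul_right, det_smul_right]; ring }
  have hg : ∀ x, g x = ![bil ε p x, ε * bil ε T x, det p T x] := fun _ => rfl
  have hbil : ∀ x y, bil ε (g x) (g y) = bil ε x y := by
    intro x y
    have h := det_mul_det h2 p T x p T y
    rw [hp.1, hpT, bil_comm ε T p, hpT, hTT, bil_comm ε x p, bil_comm ε x T] at h
    rw [hg, hg, bil]
    simp
    linear_combination ε * h + (bil ε x y - bil ε p x * bil ε p y + ε * bil ε T x * bil ε T y) * h2
  refine ⟨g, ⟨hbil, ?_, ?_⟩, ?_, ?_⟩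
  · intro x y z
    have h : det (g x) (g y) (g z) = det x y z * ((p 1 * T 2 - p 2 * T 1) ^ 2 * ε +
        (p 0 * T 2 - p 2 * T 0) ^ 2 + (p 0 * T 1 - p 1 * T 0) ^ 2) := by
      rw [hg, hg, hg]
      rcases hε with rfl | rfl <;> simp [det, bil] <;> ring
    rw [h, hc, mul_one]
  · intro x hx
    refine ⟨by rw [hbil]; exact hx.1, fun h => ?_⟩
    have h1 := bil_le hε hp hx
    rw [hg]
    simp
    subst h
    linarith
  · rw [hg, hp.1, bil_comm ε T p, hpT, hpTp, mul_zero, e₀]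
  · rw [hg, hyT, hpyT]
    congr 2
    linear_combination σ * h2

/-! ### Local convexity and embeddedness imply convexity -/

/-- A closed curve of rays without multiple points all of whose short arcs are convex. -/
structure IsLocConvex (X : ℝ → Vec) (ρ : ℝ) : Prop where
  continuous : Continuous X
  periodic : ∀ t, X (t + 1) = X t
  ray : ∀ s t, s < t → t < s + 1 → ∀ a : ℝ, 0 < a → X t ≠ a • X s
  pos : 0 < ρ
  det_pos : ∀ s t u, s < t → t < u → u < s + ρ → 0 < det (X s) (X t) (X u)

/-- The arc of the curve from `a` to `b` is convex. -/
def ConvArc (X : ℝ → Vec) (a b : ℝ) : Prop :=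
  ∀ s t u, a ≤ s → s < t → t < u → u ≤ b → 0 < det (X s) (X t) (X u)

lemma det_pos_near {X : ℝ → Vec} (hX : Continuous X) {a b c : ℝ}
    (h : 0 < det (X a) (X b) (X c)) : ∃ η > 0, ∀ a' b' c', |a' - a| < η → |b' - b| < η →
      |c' - c| < η → 0 < det (X a') (X b') (X c') := by
  have hF : Continuous fun p : ℝ × ℝ × ℝ => det (X p.1) (X p.2.1) (X p.2.2) := by fun_prop
  have := (hF.tendsto (a, b, c)).eventually (lt_mem_nhds h)
  obtain ⟨η, hη, h'⟩ := Metric.eventually_nhds_iff.1 this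
  refine ⟨η, hη, fun a' b' c' ha hb hc => h' (y := (a', b', c')) ?_⟩
  simp [Prod.dist_eq, Real.dist_eq, ha, hb, hc]

lemma det_cycle (x y z : Vec) : det x y z = det z x y := by simp only [det]; ring

lemma det_comb (x y a b c : Vec) (α β γ : ℝ) :
    det x y (α • a + β • b + γ • c) = α * det x y a + β * det x y b + γ * det x y c := by
  rw [det_add_right, det_add_right, det_smul_right, det_smul_right, det_smul_right]

namespace IsLocConvex

variable {X : ℝ → Vec} {ρ : ℝ}

lemma ne_zero (hX : IsLocConvex X ρ) (t : ℝ) : X t ≠ 0 := by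
  intro h
  have := hX.det_pos t (t + ρ / 3) (t + ρ / 2) (by linarith [hX.pos]) (by linarith [hX.pos])
    (by linarith [hX.pos])
  rw [h] at this
  simp [det] at this

lemma mirror (hX : IsLocConvex X ρ) : IsLocConvex (fun t => mirror (X (-t))) ρ where
  continuous := continuous_mirror.comp (hX.continuous.comp continuous_neg)
  periodic t := by rw [← hX.periodic (-(t + 1))]; congr 2; ring
  ray s t hs ht a ha h := by
    have h' := congrArg CayleyKlein.mirror h
    rw [mirror_mirror] at h'
    have e : CayleyKlein.mirror (a • CayleyKlein.mirror (X (-s))) = a • X (-s) := by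
      ext i; fin_cases i <;> simp [CayleyKlein.mirror]
    rw [e] at h'
    refine hX.ray (-t) (-s) (by linarith) (by linarith) a⁻¹ (by positivity) ?_
    rw [h', smul_smul, inv_mul_cancel₀ ha.ne', one_smul]
  pos := hX.pos
  det_pos s t u hs ht hu := by
    have := hX.det_pos (-u) (-t) (-s) (by linarith) (by linarith) (by linarith)
    rw [det_mirror]
    have e : det (X (-u)) (X (-t)) (X (-s)) = -det (X (-s)) (X (-t)) (X (-u)) := by
      simp only [det]; ring
    linarith

/-- The limit of growing convex arcs is convex. -/
lemma convArc_of_lt (hX : IsLocConvex X ρ) {a σ : ℝ} (hσ : σ < a + 1)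
    (h : ∀ b < σ, ConvArc X a b) : ConvArc X a σ := by
  have hlim : ∀ s t, a ≤ s → s < t → t < σ → 0 ≤ det (X s) (X t) (X σ) := by
    intro s t hs hst ht
    by_contra! hneg
    have hneg' : 0 < det (X t) (X s) (X σ) := by rw [det_swap]; linarith
    obtain ⟨η, hη, h'⟩ := det_pos_near hX.continuous hneg'
    obtain ⟨u, hu1, hu2⟩ := exists_between (max_lt ht (sub_lt_self σ hη))
    have h1 := h u hu2 s t u hs hst ((le_max_left _ _).trans_lt hu1) le_rfl
    have h2 := h' t s u (by simpa using hη) (by simpa using hη)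
      (by rw [abs_lt]; constructor <;> linarith [(le_max_right t (σ - η)).trans_lt hu1])
    rw [det_swap] at h2
    linarith
  intro p q u hp hpq hqu hu
  rcases hu.lt_or_eq with hu | rfl
  · exact h u hu p q u hp hpq hqu le_rfl
  refine lt_of_le_of_ne (hlim p q hp hpq hqu) fun h0 => ?_
  obtain ⟨t₁, h1, h1'⟩ := exists_between hpq
  obtain ⟨t₂, h2, h2'⟩ := exists_between hqu
  have d1 := h q hqu p t₁ q hp h1 h1' le_rfl
  have d2 := h t₂ h2' p q t₂ hp hpq h2 le_rfl
  have d3 := hlim p t₁ hp h1 (h1'.trans hqu)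
  have d4 := hlim p t₂ hp (hpq.trans h2) h2'
  have d5 := hlim q t₂ (hp.trans hpq.le) h2 h2'
  -- If the limiting determinant vanished, `X u` would be a combination of `X p` and `X q`. Testing
  -- against the chord from `p` to `t₁` makes the coefficient of `X q` zero, so `X u` is a positive
  -- multiple of `X p`, against embeddedness.
  have c := cramer (X p) (X q) (X t₂) (X u)
  rw [← h0, zero_smul, add_zero] at c
  have e := congrArg (det (X p) (X t₁)) c
  rw [det_smul_right, det_add_right, det_smul_right, det_smul_right, det_self_outer,
    det_swap' (X p) (X u)] at e
  have d6 : det (X p) (X t₂) (X u) = 0 := by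
    by_contra hne
    have : 0 < det (X p) (X t₂) (X u) := lt_of_le_of_ne d4 (Ne.symm hne)
    nlinarith [mul_pos this d1, mul_nonneg d2.le d3]
  rw [det_swap' (X p) (X u), d6, neg_zero, zero_smul, add_zero,
    det_rotate (X u) (X q) (X t₂)] at c
  have d7 : 0 < det (X q) (X t₂) (X u) := by
    refine lt_of_le_of_ne d5 fun h0 => ?_
    rw [← h0, zero_smul, smul_eq_zero] at c
    rcases c with c | c
    · linarith
    · exact hX.ne_zero _ c
  refine hX.ray p u (hpq.trans hqu) (by linarith)
    ((det (X p) (X q) (X t₂))⁻¹ * det (X q) (X t₂) (X u)) (by positivity) ?_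
  rw [mul_smul, ← c, smul_smul, inv_mul_cancel₀ d2.ne', one_smul]

/-- After the broken line turns away from `a` near `σ`, the curve keeps turning away from `a`. -/
lemma turn_away (hX : IsLocConvex X ρ) {a σ : ℝ} (ha : a < σ)
    (hconv : ∀ f, a < f → f < σ → 0 < det (X a) (X f) (X σ))
    (hseq : ∀ η > 0, ∃ a' q r, |a' - a| < η ∧ |q - σ| < η ∧ q < r ∧ r < σ + η ∧
      det (X a') (X q) (X r) ≤ 0) :
    ∃ h > 0, ∀ z, σ < z → z < σ + h → det (X a) (X σ) (X z) < 0 ∧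
      ∀ z', z < z' → z' < σ + h → det (X a) (X z) (X z') < 0 := by
  have hρ := hX.pos
  obtain ⟨f, hf1, hf2⟩ := exists_between (max_lt ha (sub_lt_self σ (half_pos hρ)))
  have hfa := (le_max_left _ _).trans_lt hf1
  have hfρ := (le_max_right _ _).trans_lt hf1
  obtain ⟨η, hη, hnear⟩ := det_pos_near hX.continuous (hconv f hfa hf2)
  -- Once a chord near `σ` turns away from `a'`, all later ones do. This follows from two Plücker
  -- relations involving a point `f` shortly before `σ`: the triples of `f` with curve points are
  -- left turns by local convexity, those of `a'` and `f` by continuity.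
  have step : ∀ a' x y z, |a' - a| < η → |x - σ| < η → |y - σ| < η → f < x → x < y → y < z →
      z < σ + ρ / 2 → det (X a') (X x) (X y) ≤ 0 →
      det (X a') (X y) (X z) < 0 ∧ det (X a') (X x) (X z) < 0 := by
    intro a' x y z ha' hx' hy' hfx hxy hyz hz h0
    have g1 := grassmann_pluecker (X y) (X a') (X x) (X z) (X f)
    have g2 := grassmann_pluecker (X x) (X a') (X y) (X z) (X f)
    have p1 := hX.det_pos x y z hxy hyz (by linarith)
    have p2 := hX.det_pos f y z (hfx.trans hxy) hyz (by linarith)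
    have p3 := hX.det_pos f x y hfx hxy (by linarith)
    have p4 := hX.det_pos f x z hfx (hxy.trans hyz) (by linarith)
    have p5 := hnear a' f y ha' (by simpa using hη) hy'
    have p6 := hnear a' f x ha' (by simpa using hη) hx'
    have q1 : det (X y) (X a') (X x) = det (X a') (X x) (X y) := by simp only [det]; ring
    have q2 : det (X y) (X z) (X f) = det (X f) (X y) (X z) := by simp only [det]; ring
    have q3 : det (X y) (X a') (X z) = -det (X a') (X y) (X z) := by simp only [det]; ring
    have q4 : det (X y) (X x) (X f) = -det (X f) (X x) (X y) := by simp only [det]; ring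
    have q5 : det (X y) (X a') (X f) = det (X a') (X f) (X y) := by simp only [det]; ring
    have q6 : det (X y) (X x) (X z) = -det (X x) (X y) (X z) := by simp only [det]; ring
    have q7 : det (X x) (X a') (X y) = -det (X a') (X x) (X y) := by simp only [det]; ring
    have q8 : det (X x) (X z) (X f) = det (X f) (X x) (X z) := by simp only [det]; ring
    have q9 : det (X x) (X a') (X z) = -det (X a') (X x) (X z) := by simp only [det]; ring
    have q10 : det (X x) (X y) (X f) = det (X f) (X x) (X y) := by simp only [det]; ring
    have q11 : det (X x) (X a') (X f) = det (X a') (X f) (X x) := by simp only [det]; ring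
    rw [q1, q2, q3, q4, q5, q6] at g1
    rw [q7, q8, q9, q10, q11] at g2
    have m1 := mul_pos p5 p1
    have m2 := mul_nonneg (neg_nonneg.2 h0) p2.le
    have m3 := mul_pos p6 p1
    have m4 := mul_nonneg (neg_nonneg.2 h0) p4.le
    constructor
    · by_contra! hc
      have := mul_nonneg hc p3.le
      linarith
    · by_contra! hc
      have := mul_nonneg hc p3.le
      linarith
  have hlim : ∀ z, σ < z → z < σ + ρ / 2 → det (X a) (X σ) (X z) ≤ 0 := by
    intro z hz1 hz2
    by_contra! hpos
    obtain ⟨θ, hθ, hnear'⟩ := det_pos_near hX.continuous hpos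
    obtain ⟨a', q, r, h1, h2, h3, h4, h5⟩ := hseq (min (min η θ) (min (z - σ) (σ - f)))
      (lt_min (lt_min hη hθ) (lt_min (by linarith) (by linarith)))
    simp only [lt_min_iff] at h1 h2
    have h4' : r < z ∧ r < σ + η := by
      have := min_le_right (min η θ) (min (z - σ) (σ - f))
      have := min_le_left (z - σ) (σ - f)
      have := min_le_left (min η θ) (min (z - σ) (σ - f))
      have := min_le_left η θ
      constructor <;> linarith
    have hq := abs_lt.1 h2.1.1
    have hq' := abs_lt.1 h2.2.2
    have := (step a' q r z h1.1.1 h2.1.1 (abs_lt.2 ⟨by linarith, by linarith⟩) (by linarith) h3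
      h4'.1 hz2 h5).2
    have := hnear' a' q z h1.1.2 h2.1.2 (by simpa using hθ)
    linarith
  have hlim' : ∀ z, σ < z → z < σ + min η (ρ / 2) → det (X a) (X σ) (X z) < 0 := by
    intro z hz1 hz2
    obtain ⟨y, hy1, hy2⟩ := exists_between hz1
    have e1 := min_le_left η (ρ / 2)
    have e2 := min_le_right η (ρ / 2)
    exact (step a σ y z (by simpa using hη) (by simpa using hη)
      (abs_lt.2 ⟨by linarith, by linarith⟩) hf2 hy1 hy2 (by linarith)
      (hlim y hy1 (by linarith))).2
  refine ⟨min η (ρ / 2), lt_min hη (by linarith), fun z hz1 hz2 => ⟨hlim' z hz1 hz2, ?_⟩⟩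
  intro z' hz' hz2'
  have e1 := min_le_left η (ρ / 2)
  have e2 := min_le_right η (ρ / 2)
  exact (step a σ z z' (by simpa using hη) (by simpa using hη)
    (abs_lt.2 ⟨by linarith, by linarith⟩) hf2 hz1 hz' (by linarith) (hlim' z hz1 hz2).le).1

/-- The ways in which a growing arc with the fixed first point `a` ceases to be convex. -/
lemma first_failure (hX : IsLocConvex X ρ) {a b : ℝ} (hb : b < a + 1) (hn : ¬ ConvArc X a b) :
    ∃ σ, a + ρ ≤ σ ∧ σ ≤ b ∧ ConvArc X a σ ∧
      ((∃ h > 0, ∀ z, σ < z → z < σ + h → det (X a) (X σ) (X z) < 0 ∧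
        ∀ z', z < z' → z' < σ + h → det (X a) (X z) (X z') < 0) ∨
      (∀ η > 0, ∃ p q r, a ≤ p ∧ p < q ∧ q < a + η ∧ |r - σ| < η ∧
        det (X p) (X q) (X r) ≤ 0)) := by
  have hρ := hX.pos
  have hbdd : BddBelow {b | ¬ ConvArc X a b} := by
    refine ⟨a, fun x hx => ?_⟩
    by_contra! hxa
    exact hx fun s t u h1 h2 h3 h4 => by linarith
  have hne : {b | ¬ ConvArc X a b}.Nonempty := ⟨b, hn⟩
  obtain ⟨σ, hσ⟩ : ∃ σ, σ = sInf {b | ¬ ConvArc X a b} := ⟨_, rfl⟩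
  have hlt : ∀ b < σ, ConvArc X a b := fun b hb => by
    by_contra h; exact absurd (csInf_le hbdd h) (by rw [← hσ]; exact not_le.2 hb)
  have hσb : σ ≤ b := hσ ▸ csInf_le hbdd hn
  have hσρ : a + ρ ≤ σ := by
    rw [hσ]
    refine le_csInf hne fun x hx => ?_
    by_contra! hxa
    exact hx fun s t u h1 h2 h3 h4 => hX.det_pos s t u h2 h3 (by linarith)
  have hconv : ConvArc X a σ := hX.convArc_of_lt (by linarith) hlt
  refine ⟨σ, hσρ, hσb, hconv, ?_⟩
  have hseq : ∀ n : ℕ, ∃ p q r, a ≤ p ∧ p < q ∧ q < r ∧ σ < r ∧ r < σ + 1 / ((n : ℝ) + 1) ∧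
      det (X p) (X q) (X r) ≤ 0 := by
    intro n
    obtain ⟨c, hc, hc'⟩ := exists_lt_of_csInf_lt hne
      (show sInf {b | ¬ ConvArc X a b} < σ + 1 / ((n : ℝ) + 1) by
        rw [← hσ]; exact lt_add_of_pos_right _ Nat.one_div_pos_of_nat)
    simp only [Set.mem_ofPred_eq, ConvArc, not_forall] at hc
    obtain ⟨p, q, r, h1, h2, h3, h4, h5⟩ := hc
    refine ⟨p, q, r, h1, h2, h3, ?_, by linarith, not_lt.1 h5⟩
    by_contra! hr
    exact h5 (hconv p q r h1 h2 h3 hr)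
  choose p q r hp hpq hqr hr hr' hdet using hseq
  have hr1 : ∀ n, r n < σ + 1 := fun n => (hr' n).trans_le (by
    have : 1 / ((n : ℝ) + 1) ≤ 1 := by
      rw [div_le_one (by positivity)]; linarith [n.cast_nonneg (α := ℝ)]
    linarith)
  have hK := (isCompact_Icc (a := a) (b := σ + 1)).prod (isCompact_Icc (a := a) (b := σ + 1))
  -- Failing triples `p, q, r` with `r` decreasing to `σ` accumulate at some `P ≤ Q ≤ σ`. By
  -- continuity `P < Q < σ` is impossible. `Q = σ` gives turning away at the end of the arc, and `P
  -- = Q < σ` is possible only at `P = a`.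
  obtain ⟨⟨P, Q⟩, hPQ, φ, hφ, hlim⟩ := hK.tendsto_subseq (x := fun n => (p n, q n)) fun n =>
    ⟨⟨hp n, by linarith [hpq n, hqr n, hr1 n]⟩,
      ⟨by linarith [hp n, hpq n], by linarith [hqr n, hr1 n]⟩⟩
  have hlim1 : Filter.Tendsto (fun n => p (φ n)) Filter.atTop (nhds P) :=
    ((continuous_fst.tendsto _).comp hlim)
  have hlim2 : Filter.Tendsto (fun n => q (φ n)) Filter.atTop (nhds Q) :=
    ((continuous_snd.tendsto _).comp hlim)
  have hlim3 : Filter.Tendsto (fun n => r n) Filter.atTop (nhds σ) := by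
    refine tendsto_of_tendsto_of_tendsto_of_le_of_le tendsto_const_nhds (g := fun _ => σ)
      (h := fun n : ℕ => σ + 1 / ((n : ℝ) + 1)) ?_ (fun n => (hr n).le) (fun n => (hr' n).le)
    simpa using (tendsto_one_div_add_atTop_nhds_zero_nat (𝕜 := ℝ)).const_add σ
  have hlim3 := hlim3.comp hφ.tendsto_atTop
  have hlimit : ∀ η > 0, ∃ p q r, a ≤ p ∧ p < q ∧ q < r ∧ σ < r ∧ |p - P| < η ∧ |q - Q| < η ∧
      |r - σ| < η ∧ det (X p) (X q) (X r) ≤ 0 := by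
    intro η hη
    obtain ⟨n, h1, h2, h3⟩ := ((Metric.tendsto_nhds.1 hlim1 η hη).and
      ((Metric.tendsto_nhds.1 hlim2 η hη).and (Metric.tendsto_nhds.1 hlim3 η hη))).exists
    exact ⟨p (φ n), q (φ n), r (φ n), hp _, hpq _, hqr _, hr _, h1, h2, h3, hdet _⟩
  have hPQ' : P ≤ Q := le_of_tendsto_of_tendsto' hlim1 hlim2 fun n => (hpq _).le
  have hQσ : Q ≤ σ := le_of_tendsto_of_tendsto' hlim2 hlim3 fun n => (hqr _).le
  have haP : a ≤ P := hPQ.1.1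
  rcases hQσ.lt_or_eq with hQ | rfl
  · rcases hPQ'.lt_or_eq with hP | rfl
    · exfalso
      obtain ⟨η, hη, hnear⟩ := det_pos_near hX.continuous (hconv P Q σ haP hP hQ le_rfl)
      obtain ⟨p, q, r, -, -, -, -, h1, h2, h3, h4⟩ := hlimit η hη
      exact absurd (hnear p q r h1 h2 h3) (not_lt.2 h4)
    · right
      rcases haP.lt_or_eq with haP | rfl
      · exfalso
        obtain ⟨e, he1, he2⟩ := exists_between hQ
        have c1 := hconv a P σ le_rfl haP hQ le_rfl
        have c2 := hconv P e σ haP.le he1 he2 le_rfl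
        obtain ⟨η₁, hη₁, n1⟩ := det_pos_near hX.continuous c1
        obtain ⟨η₂, hη₂, n2⟩ := det_pos_near hX.continuous c2
        obtain ⟨p, q, r, h1, h2, h3, h4, h5, h6, h7, h8⟩ := hlimit
          (min (min η₁ η₂) (min (e - P) (P - a)))
          (lt_min (lt_min hη₁ hη₂) (lt_min (by linarith) (by linarith)))
        simp only [lt_min_iff] at h5 h6 h7
        have hq := abs_lt.1 h6.2.1
        have hp := abs_lt.1 h5.2.2
        have d1 := n1 a p r (by simpa using hη₁) h5.1.1 h7.1.1
        have d2 := n2 p e r h5.1.2 (by simpa using hη₂) h7.1.2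
        have d3 := hconv p q e h1 h2 (by linarith) he2.le
        have d4 := hconv a p q le_rfl (by linarith) h2 (by linarith)
        have d5 := hconv a p e le_rfl (by linarith) (by linarith) he2.le
        -- Seen from `X p`, the relation writes `det (X p) (X q) (X r) * det (X a) (X p) (X e)` as a
        -- sum of two positive products.
        have g := grassmann_pluecker (X p) (X q) (X e) (X r) (X a)
        rw [← det_rotate (X a) (X p) (X r), ← det_rotate (X a) (X p) (X e),
          ← det_rotate (X a) (X p) (X q)] at g
        nlinarith [mul_pos d3 d1, mul_pos d4 d2, mul_nonneg (neg_nonneg.2 h8) d5.le]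
      · intro η hη
        obtain ⟨p, q, r, h1, h2, h3, h4, h5, h6, h7, h8⟩ := hlimit η hη
        exact ⟨p, q, r, h1, h2, by linarith [(abs_lt.1 h6).2], h7, h8⟩
  · left
    have hPlt : P < Q := by
      refine lt_of_le_of_ne hPQ' ?_
      rintro rfl
      obtain ⟨p, q, r, h1, h2, h3, h4, h5, h6, h7, h8⟩ := hlimit (ρ / 2) (by linarith)
      have := hX.det_pos p q r h2 h3 (by linarith [(abs_lt.1 h5).1, (abs_lt.1 h7).2])
      linarith
    refine hX.turn_away (by linarith) (fun f h1 h2 => hconv a f Q le_rfl h1 h2 le_rfl) ?_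
    intro η hη
    rcases haP.lt_or_eq with haP | rfl
    · obtain ⟨f, hf1, hf2⟩ := exists_between (max_lt hPlt (sub_lt_self Q (half_pos hρ)))
      have hfP := (le_max_left _ _).trans_lt hf1
      have hfρ := (le_max_right _ _).trans_lt hf1
      obtain ⟨η₁, hη₁, n1⟩ := det_pos_near hX.continuous (hconv P f Q haP.le hfP hf2 le_rfl)
      obtain ⟨η₂, hη₂, n2⟩ := det_pos_near hX.continuous
        (hconv a f Q le_rfl (haP.trans hfP) hf2 le_rfl)
      obtain ⟨η₃, hη₃, n3⟩ := det_pos_near hX.continuous (hconv a P Q le_rfl haP hPlt le_rfl)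
      obtain ⟨p, q, r, h1, h2, h3, h4, h5, h6, h7, h8⟩ := hlimit
        (min (min η (min η₁ η₂)) (min η₃ (min (Q - f) (ρ / 2))))
        (lt_min (lt_min hη (lt_min hη₁ hη₂)) (lt_min hη₃ (lt_min (by linarith) (by linarith))))
      simp only [lt_min_iff] at h5 h6 h7
      have hq := abs_lt.1 h6.2.2.1
      have hrr := abs_lt.1 h7.2.2.2
      refine ⟨a, q, r, by simpa using hη, h6.1.1, h3, by linarith [(abs_lt.1 h7.1.1).2], ?_⟩
      have d1 := n1 p f q h5.1.2.1 (by simpa using hη₁) h6.1.2.1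
      have d2 := n2 a f q (by simpa using hη₂) (by simpa using hη₂) h6.1.2.2
      have d3 := n3 a p q (by simpa using hη₃) h5.2.1 h6.2.1
      have d4 := hX.det_pos f q r (by linarith) h3 (by linarith)
      -- Replaces the first vertex of the failing triple by `a`, the form that `turn_away` needs.
      have g := grassmann_pluecker (X q) (X r) (X f) (X p) (X a)
      have q1 : det (X q) (X r) (X f) = det (X f) (X q) (X r) := by simp only [det]; ring
      have q2 : det (X q) (X p) (X a) = det (X a) (X q) (X p) := by simp only [det]; ring
      have q2' : det (X a) (X q) (X p) = -det (X a) (X p) (X q) := by simp only [det]; ring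
      have q3 : det (X q) (X r) (X p) = det (X p) (X q) (X r) := by simp only [det]; ring
      have q4 : det (X q) (X f) (X a) = -det (X a) (X f) (X q) := by simp only [det]; ring
      have q5 : det (X q) (X r) (X a) = det (X a) (X q) (X r) := by simp only [det]; ring
      have q6 : det (X q) (X f) (X p) = -det (X p) (X f) (X q) := by simp only [det]; ring
      rw [q1, q2, q2', q3, q4, q5, q6] at g
      by_contra! hc
      nlinarith [mul_pos d4 d3, mul_pos hc d1, mul_nonneg (neg_nonneg.2 h8) d2.le]
    · obtain ⟨p, q, r, h1, h2, h3, h4, h5, h6, h7, h8⟩ := hlimit η hη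
      exact ⟨p, q, r, h5, h6, h3, by linarith [(abs_lt.1 h7).2], h8⟩

end IsLocConvex

/-! ### Traps: the curve enters the hull of its own arc -/

/-- A convex arc from `a` to `σ` after which the curve turns into the convex hull of the arc. -/
structure IsTrap (X : ℝ → Vec) (a σ : ℝ) : Prop where
  lt : a < σ
  lt_add : σ < a + 1
  convArc : ConvArc X a σ
  turns : ∃ h > 0, ∀ z, σ < z → z < σ + h → det (X a) (X σ) (X z) < 0 ∧
    ∀ z', z < z' → z' < σ + h → det (X a) (X z) (X z') < 0

/-- The ray of `x` lies in the cone over a triangle `X a, X t, X σ` with `t` between `a` and `σ`. -/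
def InCone (X : ℝ → Vec) (a σ : ℝ) (x : Vec) : Prop :=
  ∃ t r α β γ : ℝ, (a ≤ t ∧ t ≤ σ) ∧ (0 ≤ r ∧ 0 ≤ α ∧ 0 ≤ β ∧ 0 ≤ γ) ∧ r + α + β + γ = 1 ∧
    r • x = α • X a + β • X t + γ • X σ

/-- Cramer's rule. All four coefficients, including that of `x`, are scaled to sum `1`, which keeps
the coefficients in a compact set. -/
lemma inCone_of_det {X : ℝ → Vec} {a σ t : ℝ} {x : Vec} (hat : a ≤ t) (htσ : t ≤ σ)
    (h : 0 < det (X a) (X t) (X σ)) (h1 : 0 ≤ det x (X t) (X σ)) (h2 : 0 ≤ det (X a) x (X σ))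
    (h3 : 0 ≤ det (X a) (X t) x) : InCone X a σ x := by
  obtain ⟨S, hS⟩ : ∃ S, S = det (X a) (X t) (X σ) + det x (X t) (X σ) + det (X a) x (X σ) +
    det (X a) (X t) x := ⟨_, rfl⟩
  have hS0 : 0 < S := by rw [hS]; positivity
  refine ⟨t, S⁻¹ * det (X a) (X t) (X σ), S⁻¹ * det x (X t) (X σ), S⁻¹ * det (X a) x (X σ),
    S⁻¹ * det (X a) (X t) x, ⟨hat, htσ⟩, ⟨by positivity, by positivity, by positivity,
    by positivity⟩, ?_, ?_⟩
  · rw [← mul_add, ← mul_add, ← mul_add, ← hS, inv_mul_cancel₀ hS0.ne']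
  · simp only [mul_smul]
    rw [cramer (X a) (X t) (X σ) x, smul_add, smul_add]

namespace IsLocConvex

variable {X : ℝ → Vec} {ρ : ℝ}

/-- The coefficient of the point itself does not vanish. -/
lemma InCone.pos {a σ : ℝ} (ha : a < σ) (hconv : ConvArc X a σ)
    {t r α β γ : ℝ} {x : Vec} (ht : a ≤ t ∧ t ≤ σ)
    (h0 : 0 ≤ r ∧ 0 ≤ α ∧ 0 ≤ β ∧ 0 ≤ γ) (hsum : r + α + β + γ = 1)
    (h : r • x = α • X a + β • X t + γ • X σ) : 0 < r := by
  refine lt_of_le_of_ne h0.1 fun hr => ?_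
  obtain ⟨e, he1, he2⟩ := exists_between ha
  have hd := hconv a e σ le_rfl he1 he2 le_rfl
  rw [← hr, zero_smul] at h
  have h1 := congrArg (det (X σ) (X a)) h
  have h2 := congrArg (det (X a) (X e)) h
  have h3 := congrArg (det (X e) (X σ)) h
  rw [det_comb] at h1 h2 h3
  have z : ∀ x y : Vec, det x y 0 = 0 := fun x y => by simp [det]
  rw [z] at h1 h2 h3
  have q1 : det (X e) (X σ) (X a) = det (X a) (X e) (X σ) := by simp only [det]; ring
  simp only [det_self_outer, det_self_right, mul_zero, zero_add, add_zero, q1] at h1 h2 h3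
  rcases ht.1.eq_or_lt with h4 | h4
  · rw [← h4] at h2 h3
    rw [q1] at h3
    simp only [det_self_outer, mul_zero, zero_add] at h2
    have : γ = 0 := by nlinarith
    have : α + β = 0 := by nlinarith
    linarith
  · rcases ht.2.eq_or_lt with h5 | h5
    · rw [h5] at h2 h3
      simp only [det_self_right, mul_zero, add_zero] at h3
      have : α = 0 := by nlinarith
      have : β + γ = 0 := by nlinarith
      linarith
    · have hd' := hconv a t σ le_rfl h4 h5 le_rfl
      have q2 : det (X σ) (X a) (X t) = det (X a) (X t) (X σ) := by simp only [det]; ring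
      rw [q2] at h1
      have hβ : β = 0 := by nlinarith
      rw [hβ] at h2 h3
      simp only [zero_mul, zero_add, add_zero] at h2 h3
      have : γ = 0 := by nlinarith
      have : α = 0 := by nlinarith
      linarith

/-- Points of the cone off its chord. -/
lemma InCone.interior {a σ : ℝ} (ha : a < σ) (hconv : ConvArc X a σ) {x : Vec}
    (hx : InCone X a σ x) (hpos : 0 < det (X a) x (X σ)) :
    ∃ t r α β γ : ℝ, (a < t ∧ t < σ) ∧ (0 < r ∧ 0 ≤ α ∧ 0 < β ∧ 0 ≤ γ) ∧
    r • x = α • X a + β • X t + γ • X σ := by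
  obtain ⟨t, r, α, β, γ, ht, h0, hsum, h⟩ := hx
  have hr := InCone.pos ha hconv ht h0 hsum h
  have h1 := congrArg (det (X σ) (X a)) h
  rw [det_comb, det_smul_right] at h1
  have q1 : det (X σ) (X a) x = det (X a) x (X σ) := by simp only [det]; ring
  simp only [det_self_outer, det_self_right, mul_zero, zero_add, add_zero, q1] at h1
  have hp := mul_pos hr hpos
  refine ⟨t, r, α, β, γ, ⟨lt_of_le_of_ne ht.1 ?_, lt_of_le_of_ne ht.2 ?_⟩,
    ⟨hr, h0.2.1, lt_of_le_of_ne h0.2.2.1 ?_, h0.2.2.2⟩, h⟩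
  · rintro rfl; simp at h1; rcases h1 with h1 | h1 <;> linarith
  · rintro rfl; simp at h1; rcases h1 with h1 | h1 <;> linarith
  · rintro rfl; simp at h1; rcases h1 with h1 | h1 <;> linarith

/-- A point of the cone off its chord which is not on the arc lies in the interior of a
triangle. -/
lemma InCone.exists_triangle (hX : IsLocConvex X ρ) {a σ : ℝ} (ha : a < σ)
    (hconv : ConvArc X a σ) {x : Vec}
    (hx : InCone X a σ x) (hpos : 0 < det (X a) x (X σ))
    (hray : ∀ t, a < t → t < σ → ∀ c : ℝ, 0 < c → x ≠ c • X t) :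
    ∃ t, (a < t ∧ t < σ) ∧ 0 < det x (X t) (X σ) ∧ 0 < det (X a) (X t) x := by
  obtain ⟨t, r, α, β, γ, ht, ⟨hr, hα, hβ, hγ⟩, h⟩ := InCone.interior ha hconv hx hpos
  have hcoord : ∀ t', r * det x (X t') (X σ) =
      α * det (X a) (X t') (X σ) + β * det (X t) (X t') (X σ) := by
    intro t'
    have := congrArg (det (X t') (X σ)) h
    rw [det_comb, det_smul_right] at this
    rw [det_rotate x, det_rotate (X a), det_rotate (X t)]
    simpa using this
  have hcoord' : ∀ t', r * det (X a) (X t') x =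
      β * det (X a) (X t') (X t) + γ * det (X a) (X t') (X σ) := by
    intro t'
    have := congrArg (det (X a) (X t')) h
    rw [det_comb, det_smul_right] at this
    simpa using this
  have hd := hconv a t σ le_rfl ht.1 ht.2 le_rfl
  rcases hα.eq_or_lt with hα | hα
  · rcases hγ.eq_or_lt with hγ | hγ
    · exfalso
      rw [← hα, ← hγ, zero_smul, zero_smul, zero_add, add_zero] at h
      refine hray t ht.1 ht.2 (r⁻¹ * β) (by positivity) ?_
      rw [mul_smul, ← h, smul_smul, inv_mul_cancel₀ hr.ne', one_smul]
    -- `x` lies on the side `X t, X σ` of its triangle; moving `t` a little towards `σ` brings it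
    -- into the interior. The side `X a, X t` is treated symmetrically, by moving `t` towards `a`.
    · have hc : Continuous fun t' => β * det (X a) (X t') (X t) + γ * det (X a) (X t') (X σ) := by
        have := hX.continuous
        fun_prop
      have h2 : 0 < β * det (X a) (X t) (X t) + γ * det (X a) (X t) (X σ) := by
        simp only [det_self_right, mul_zero, zero_add]; positivity
      obtain ⟨η, hη, hnear⟩ := Metric.eventually_nhds_iff.1 (hc.continuousAt.eventually
        (lt_mem_nhds h2))
      obtain ⟨t', h3, h4⟩ := exists_between (lt_min ht.2 (lt_add_of_pos_right t hη))
      rw [lt_min_iff] at h4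
      have h5 := hnear (y := t') (by rw [Real.dist_eq, abs_of_pos (by linarith)]; linarith)
      have h6 := hconv t t' σ ht.1.le h3 h4.1 le_rfl
      refine ⟨t', ⟨ht.1.trans h3, h4.1⟩, ?_, ?_⟩
      · refine pos_of_mul_pos_right (a := r) ?_ hr.le
        rw [hcoord, ← hα]; simp only [zero_mul, zero_add]; positivity
      · refine pos_of_mul_pos_right (a := r) ?_ hr.le
        rw [hcoord']; exact h5
  · rcases hγ.eq_or_lt with hγ | hγ
    · have hc : Continuous fun t' => α * det (X a) (X t') (X σ) + β * det (X t) (X t') (X σ) := by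
        have := hX.continuous
        fun_prop
      have h2 : 0 < α * det (X a) (X t) (X σ) + β * det (X t) (X t) (X σ) := by
        simp only [det_self_left, mul_zero, add_zero]; positivity
      obtain ⟨η, hη, hnear⟩ := Metric.eventually_nhds_iff.1 (hc.continuousAt.eventually
        (lt_mem_nhds h2))
      obtain ⟨t', h3, h4⟩ := exists_between (max_lt ht.1 (sub_lt_self t hη))
      rw [max_lt_iff] at h3
      have h5 := hnear (y := t') (by rw [Real.dist_eq, abs_of_neg (by linarith)]; linarith)
      have h6 := hconv a t' t le_rfl h3.1 h4 ht.2.le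
      refine ⟨t', ⟨h3.1, h4.trans ht.2⟩, ?_, ?_⟩
      · refine pos_of_mul_pos_right (a := r) ?_ hr.le
        rw [hcoord]; exact h5
      · refine pos_of_mul_pos_right (a := r) ?_ hr.le
        rw [hcoord', ← hγ]; simp only [zero_mul, add_zero]; positivity
    · refine ⟨t, ht, ?_, ?_⟩
      · refine pos_of_mul_pos_right (a := r) ?_ hr.le
        rw [hcoord]; simp only [det_self_left, mul_zero, add_zero]; positivity
      · refine pos_of_mul_pos_right (a := r) ?_ hr.le
        rw [hcoord']; simp only [det_self_right, mul_zero, zero_add]; positivity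

/-- The set is the projection of a compact set of parameters and normalized coefficients. -/
lemma isClosed_inCone (hX : IsLocConvex X ρ) (a σ v : ℝ) :
    IsClosed ({w | InCone X a σ (X w)} ∩ Set.Icc σ v) := by
  have hXc := hX.continuous
  have hK : IsCompact ((Set.Icc σ v) ×ˢ (Set.Icc a σ) ×ˢ (Set.Icc (0 : ℝ) 1) ×ˢ
      (Set.Icc (0 : ℝ) 1) ×ˢ (Set.Icc (0 : ℝ) 1) ×ˢ (Set.Icc (0 : ℝ) 1)) :=
    isCompact_Icc.prod (isCompact_Icc.prod (isCompact_Icc.prod (isCompact_Icc.prod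
      (isCompact_Icc.prod isCompact_Icc))))
  have hc1 : IsClosed {p : ℝ × ℝ × ℝ × ℝ × ℝ × ℝ | p.2.2.1 + p.2.2.2.1 + p.2.2.2.2.1 +
      p.2.2.2.2.2 = 1} := isClosed_eq (by fun_prop) (by fun_prop)
  have hc2 : IsClosed {p : ℝ × ℝ × ℝ × ℝ × ℝ × ℝ | p.2.2.1 • X p.1 =
      p.2.2.2.1 • X a + p.2.2.2.2.1 • X p.2.1 + p.2.2.2.2.2 • X σ} :=
    isClosed_eq (by fun_prop) (by fun_prop)
  have := ((hK.inter_right hc1).inter_right hc2).image continuous_fst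
  convert this.isClosed using 1
  ext w
  simp only [Set.mem_inter_iff, Set.mem_ofPred_eq, Set.mem_image, Prod.exists, Set.mem_prod,
    Set.mem_Icc, InCone]
  constructor
  · rintro ⟨⟨t, r, α, β, γ, ht, h0, hs, h⟩, hw⟩
    exact ⟨w, t, r, α, β, γ, ⟨⟨⟨hw, ht, ⟨h0.1, by linarith⟩, ⟨h0.2.1, by linarith⟩,
      ⟨h0.2.2.1, by linarith⟩, ⟨h0.2.2.2, by linarith⟩⟩, hs⟩, h⟩, rfl⟩
  · rintro ⟨w', t, r, α, β, γ, ⟨⟨⟨hw, ht, h1, h2, h3, h4⟩, hs⟩, h⟩, rfl⟩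
    exact ⟨⟨t, r, α, β, γ, ht, ⟨h1.1, h2.1, h3.1, h4.1⟩, hs, h⟩, hw⟩

/-- As long as the curve does not cross the chord of the trap, it stays in the cone. -/
lemma inCone_of_trap (hX : IsLocConvex X ρ) {a σ v : ℝ} (hT : IsTrap X a σ) (hσv : σ < v)
    (hv : v ≤ a + 1) (hpos : ∀ w, σ < w → w < v → 0 < det (X a) (X w) (X σ)) :
    ∀ w ∈ Set.Icc σ v, InCone X a σ (X w) := by
  have hρ := hX.pos
  refine IsClosed.Icc_subset_of_forall_exists_gt (hX.isClosed_inCone a σ v) ?_ ?_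
  · exact ⟨σ, 1 / 2, 0, 0, 1 / 2, ⟨hT.lt.le, le_rfl⟩, by norm_num, by norm_num, by simp⟩
  · rintro w ⟨hw, hw1, hw2⟩ y hy
    rcases hw1.eq_or_lt with rfl | hw1
    -- Just after `σ` the curve is in the cone over `a, f, σ` with `f` shortly before `σ`: local
    -- convexity puts it to the left of the chord from `f` to `σ`.
    · obtain ⟨f, hf1, hf2⟩ := exists_between (max_lt hT.lt (sub_lt_self σ (half_pos hρ)))
      rw [max_lt_iff] at hf1
      have hd := hT.convArc a f σ le_rfl hf1.1 hf2 le_rfl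
      obtain ⟨η, hη, hnear⟩ := det_pos_near hX.continuous hd
      obtain ⟨z, hz1, hz2⟩ := exists_between (lt_min (lt_min hy hσv)
        (lt_min (lt_add_of_pos_right σ hη) (lt_add_of_pos_right σ (half_pos hρ))))
      simp only [lt_min_iff] at hz2
      refine ⟨z, ?_, hz1, hz2.1.1.le⟩
      refine inCone_of_det hf1.1.le hf2.le hd ?_ (hpos z hz1 hz2.1.2).le ?_
      · have := hX.det_pos f σ z hf2 hz1 (by linarith)
        rw [det_cycle] at this
        exact this.le
      · exact (hnear a f z (by simpa using hη) (by simpa using hη)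
          (by rw [abs_of_pos (by linarith)]; linarith)).le
    -- Off the chord by assumption and off the arc by embeddedness, `X w` is interior to some
    -- triangle with respect to its two sides other than the chord, so the curve remains there for a
    -- while.
    · have hp := hpos w hw1 hw2
      obtain ⟨t, ht, h1, h2⟩ := InCone.exists_triangle hX hT.lt hT.convArc hw hp
        (fun t h1 h2 c hc => hX.ray t w (by linarith) (by linarith) c hc)
      have hXc := hX.continuous
      have e1 : ∀ᶠ w' in nhds w, 0 < det (X w') (X t) (X σ) :=
        (show Continuous fun w' => det (X w') (X t) (X σ) by fun_prop).continuousAt.eventually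
          (lt_mem_nhds h1)
      have e2 : ∀ᶠ w' in nhds w, 0 < det (X a) (X t) (X w') :=
        (show Continuous fun w' => det (X a) (X t) (X w') by fun_prop).continuousAt.eventually
          (lt_mem_nhds h2)
      obtain ⟨η, hη, hnear⟩ := Metric.eventually_nhds_iff.1 (e1.and e2)
      obtain ⟨z, hz1, hz2⟩ := exists_between (lt_min (lt_min hy hw2) (lt_add_of_pos_right w hη))
      simp only [lt_min_iff] at hz2
      have hz := hnear (y := z) (by rw [Real.dist_eq, abs_of_pos (by linarith)]; linarith)
      exact ⟨z, inCone_of_det ht.1.le ht.2.le (hT.convArc a t σ le_rfl ht.1 ht.2 le_rfl) hz.1.le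
        (hpos z (hw1.trans hz1) hz2.1.2).le hz.2.le, hz1, hz2.1.1.le⟩

/-- A point of the cone on the chord. -/
lemma InCone.chord {a σ : ℝ} (ha : a < σ) (hconv : ConvArc X a σ) {x : Vec}
    (hx : InCone X a σ x) (h0 : det (X a) x (X σ) ≤ 0) :
    ∃ r α γ : ℝ, 0 < r ∧ 0 ≤ α ∧ 0 ≤ γ ∧ r • x = α • X a + γ • X σ := by
  obtain ⟨t, r, α, β, γ, ht, hnn, hsum, h⟩ := hx
  have hr := InCone.pos ha hconv ht hnn hsum h
  obtain ⟨-, hα, hβ, hγ⟩ := hnn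
  rcases ht.1.eq_or_lt with rfl | h1
  · exact ⟨r, α + β, γ, hr, by positivity, hγ, by rw [h, add_smul]⟩
  rcases ht.2.eq_or_lt with rfl | h2
  · exact ⟨r, α, β + γ, hr, hα, by positivity, by rw [h, add_smul, add_assoc]⟩
  have hd := hconv a t σ le_rfl h1 h2 le_rfl
  have h3 := congrArg (det (X σ) (X a)) h
  rw [det_comb, det_smul_right] at h3
  have q1 : det (X σ) (X a) x = det (X a) x (X σ) := by simp only [det]; ring
  have q2 : det (X σ) (X a) (X t) = det (X a) (X t) (X σ) := by simp only [det]; ring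
  simp only [det_self_outer, det_self_right, mul_zero, zero_add, add_zero, q1, q2] at h3
  have : β = 0 := by nlinarith
  exact ⟨r, α, γ, hr, hα, hγ, by rw [h, this, zero_smul, add_zero]⟩

/-- A trap contains a further trap. -/
lemma exists_trap (hX : IsLocConvex X ρ) {a σ H : ℝ} (hT : IsTrap X a σ)
    (hH : ∃ v, σ < v ∧ v ≤ H ∧ det (X a) (X v) (X σ) ≤ 0) :
    ∃ σ', σ + ρ ≤ σ' ∧ IsTrap X σ σ' ∧
      ∃ v, σ' < v ∧ v ≤ H ∧ det (X σ) (X v) (X σ') ≤ 0 := by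
  have hρ := hX.pos
  have hXc := hX.continuous
  obtain ⟨h, hh, hturn⟩ := hT.turns
  have hturn' : ∀ z, σ < z → z < σ + h → 0 < det (X a) (X z) (X σ) := fun z h1 h2 => by
    have := (hturn z h1 h2).1
    rw [det_swap'] at this
    linarith
  -- the first exit
  obtain ⟨v, hσv, hva, hvH, hv0, hv⟩ : ∃ v, σ < v ∧ v ≤ a + 1 ∧ v ≤ H ∧
      det (X a) (X v) (X σ) ≤ 0 ∧ ∀ w, σ < w → w < v → 0 < det (X a) (X w) (X σ) := by
    obtain ⟨v₀, h1, h2, h3⟩ := hH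
    have hcl : IsClosed ({w | det (X a) (X w) (X σ) ≤ 0} ∩ Set.Ici (σ + h)) :=
      (isClosed_le (by fun_prop) continuous_const).inter isClosed_Ici
    have hbdd : BddBelow ({w | det (X a) (X w) (X σ) ≤ 0} ∩ Set.Ici (σ + h)) :=
      ⟨σ + h, fun w hw => hw.2⟩
    have m1 : v₀ ∈ {w | det (X a) (X w) (X σ) ≤ 0} ∩ Set.Ici (σ + h) :=
      ⟨h3, not_lt.1 fun hlt => absurd (hturn' v₀ h1 hlt) (not_lt.2 h3)⟩
    -- The curve has to come back to `X a`, so an exit occurs at `a + 1` at the latest.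
    have h4 : det (X a) (X (a + 1)) (X σ) ≤ 0 := by rw [hX.periodic]; simp
    have m2 : a + 1 ∈ {w | det (X a) (X w) (X σ) ≤ 0} ∩ Set.Ici (σ + h) :=
      ⟨h4, not_lt.1 fun hlt => absurd (hturn' (a + 1) hT.lt_add hlt) (not_lt.2 h4)⟩
    have m3 := hcl.csInf_mem ⟨_, m1⟩ hbdd
    refine ⟨_, lt_of_lt_of_le (lt_add_of_pos_right σ hh) m3.2, csInf_le hbdd m2,
      (csInf_le hbdd m1).trans h2, m3.1, fun w hw1 hw2 => ?_⟩
    by_contra! hw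
    refine absurd (csInf_le hbdd ⟨hw, ?_⟩) (not_le.2 hw2)
    exact not_lt.1 fun hlt => absurd (hturn' w hw1 hlt) (not_lt.2 hw)
  have hin := hX.inCone_of_trap hT hσv hva hv
  have hv1 : v < σ + 1 := by linarith [hT.lt]
  obtain ⟨r, α, γ, hr, hα, hγ, hvc⟩ := InCone.chord hT.lt hT.convArc
    (hin v ⟨hσv.le, le_rfl⟩) hv0
  have hα : 0 < α := by
    refine lt_of_le_of_ne hα fun h0 => ?_
    rw [← h0, zero_smul, zero_add] at hvc
    have hγ : 0 < γ := by
      refine lt_of_le_of_ne hγ fun h0 => ?_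
      rw [← h0, zero_smul, smul_eq_zero] at hvc
      rcases hvc with h | h
      · exact hr.ne' h
      · exact hX.ne_zero v h
    refine hX.ray σ v hσv hv1 (r⁻¹ * γ) (by positivity) ?_
    rw [mul_smul, ← hvc, smul_smul, inv_mul_cancel₀ hr.ne', one_smul]
  -- At `σ` the curve turns away from `a`, whereas `X v` lies on the chord with a positive weight at
  -- `X a`; so `X σ`, an early point, `X v` is a right turn.
  have hncv : ∀ σ', v ≤ σ' → ¬ ConvArc X σ σ' := by
    intro σ' hσ' hc
    obtain ⟨z, hz1, hz2⟩ := exists_between (lt_min hσv (lt_add_of_pos_right σ hh))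
    rw [lt_min_iff] at hz2
    have h1 := hc σ z v le_rfl hz1 hz2.1 hσ'
    have h2 := congrArg (det (X σ) (X z)) hvc
    rw [det_add_right, det_smul_right, det_smul_right, det_smul_right, det_self_outer, mul_zero,
      add_zero, det_cycle (X σ) (X z) (X a)] at h2
    have h3 := (hturn z hz1 hz2.2).1
    nlinarith [mul_pos hr h1, mul_pos hα (neg_pos.2 h3)]
  obtain ⟨σ', h1, h2, hconv, hmode⟩ := hX.first_failure hv1 (hncv v le_rfl)
  have hσ'v : σ' < v := not_le.1 fun hle => hncv σ' hle hconv
  have hσσ' : σ < σ' := by linarith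
  refine ⟨σ', h1, ?_⟩
  rcases hmode with hmode | hmode
  · have hT' : IsTrap X σ σ' := ⟨hσσ', by linarith, hconv, hmode⟩
    refine ⟨hT', ?_⟩
    -- Without an exit from the new trap up to `v`, the point `X v` would lie in the cone over the
    -- new arc, off its chord. That arc, apart from `X σ`, lies strictly on one side of the old
    -- chord, but `X v` lies on the old chord.
    by_contra! hno
    have hno' : ∀ w, σ' < w → w ≤ v → 0 < det (X σ) (X w) (X σ') :=
      fun w hw hw' => hno w hw (hw'.trans hvH)
    have hin' := hX.inCone_of_trap hT' hσ'v hv1.le (fun w hw hw' => hno' w hw hw'.le) v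
      ⟨hσ'v.le, le_rfl⟩
    obtain ⟨t, r', α', β', γ', ht, ⟨hr', hα', hβ', hγ'⟩, he⟩ := InCone.interior hσσ' hconv hin'
      (hno' v hσ'v le_rfl)
    have e1 := congrArg (det (X σ) (X a)) he
    have e2 := congrArg (det (X σ) (X a)) hvc
    rw [det_comb, det_smul_right] at e1
    rw [det_add_right, det_smul_right, det_smul_right, det_smul_right] at e2
    simp only [det_self_outer, det_self_right, mul_zero, zero_add, add_zero] at e1 e2
    have e3 : det (X σ) (X a) (X v) = 0 := by
      rcases mul_eq_zero.1 e2 with h | h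
      · exact absurd h hr.ne'
      · exact h
    have e4 := hv t ht.1 (ht.2.trans hσ'v)
    have e5 := hv σ' hσσ' hσ'v
    rw [det_cycle] at e4 e5
    rw [e3, mul_zero] at e1
    nlinarith [mul_pos hβ' e4, mul_nonneg hγ' e5.le]
  · exfalso
    -- The new arc cannot fail to be convex at its beginning. Being inside the old hull, `X σ'` lies
    -- to the left of the chords ending at `σ`, and local convexity near `σ` propagates this to the
    -- chords just after `σ` by a Plücker relation.
    obtain ⟨t, r', α', β', γ', ht, ⟨hr', hα', hβ', hγ'⟩, he⟩ := InCone.interior hT.lt hT.convArc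
      (hin σ' ⟨hσσ'.le, hσ'v.le⟩) (hv σ' hσσ' hσ'v)
    obtain ⟨f, hf1, hf2⟩ := exists_between (max_lt ht.2 (sub_lt_self σ (half_pos hρ)))
    rw [max_lt_iff] at hf1
    obtain ⟨e, he1, he2⟩ := exists_between (lt_min hσσ' (lt_add_of_pos_right σ (half_pos hρ)))
    rw [lt_min_iff] at he2
    have d1 : 0 < det (X f) (X σ) (X σ') := by
      have := congrArg (det (X f) (X σ)) he
      rw [det_comb, det_smul_right, det_self_right, mul_zero, add_zero] at this
      have d2 := hT.convArc a f σ le_rfl (ht.1.trans hf1.1) hf2 le_rfl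
      have d3 := hT.convArc t f σ ht.1.le hf1.1 hf2 le_rfl
      rw [det_rotate] at d2 d3
      refine pos_of_mul_pos_right (a := r') ?_ hr'.le
      rw [this]
      positivity
    obtain ⟨η₁, hη₁, n1⟩ := det_pos_near hXc d1
    obtain ⟨η₂, hη₂, n2⟩ := det_pos_near hXc (hconv σ e σ' le_rfl he1 he2.1 le_rfl)
    obtain ⟨p, q, r, hp, hpq, hq, hr, hneg⟩ := hmode (min (min η₁ η₂) (e - σ))
      (lt_min (lt_min hη₁ hη₂) (by linarith))
    have i1 := min_le_right (min η₁ η₂) (e - σ)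
    have i2 := min_le_left (min η₁ η₂) (e - σ)
    have i3 := min_le_left η₁ η₂
    have i4 := min_le_right η₁ η₂
    have hpσ : |p - σ| < min (min η₁ η₂) (e - σ) := by
      rw [abs_of_nonneg (by linarith)]; linarith
    have d4 := n1 f p r (by simpa using hη₁) (by linarith) (by linarith)
    have d5 := n2 p e r (by linarith) (by simpa using hη₂) (by linarith)
    have d6 := hX.det_pos p q e hpq (by linarith) (by linarith)
    have d7 := hX.det_pos f p e (by linarith) (by linarith) (by linarith)
    have d8 := hX.det_pos f p q (by linarith) (by linarith) (by linarith)
    have g := grassmann_pluecker (X p) (X q) (X e) (X r) (X f)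
    rw [← det_rotate (X f) (X p) (X r), ← det_rotate (X f) (X p) (X e),
      ← det_rotate (X f) (X p) (X q)] at g
    nlinarith [mul_pos d6 d4, mul_pos d8 d5, mul_nonneg (neg_nonneg.2 hneg) d7.le]

/-- Each trap yields another one starting at the end of the former and ending at least `ρ` later.
All of them have an exit before the same bound `H = a + 1`, so there are only finitely many, and the
last one is contradictory. -/
lemma not_trap (hX : IsLocConvex X ρ) {a σ : ℝ} (hT : IsTrap X a σ) : False := by
  have key : ∀ (n : ℕ) (H a σ : ℝ), IsTrap X a σ →
      (∃ v, σ < v ∧ v ≤ H ∧ det (X a) (X v) (X σ) ≤ 0) → H - σ < n * ρ → False := by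
    intro n
    induction n with
    | zero =>
      rintro H a σ - ⟨v, h1, h2, -⟩ h3
      simp at h3
      linarith
    | succ n ih =>
      intro H a σ hT hv hn
      obtain ⟨σ', h1, h2, h3⟩ := hX.exists_trap hT hv
      refine ih H σ σ' h2 h3 ?_
      push_cast at hn
      linarith
  obtain ⟨n, hn⟩ := exists_nat_gt ((a + 1 - σ) / ρ)
  refine key n (a + 1) a σ hT ⟨a + 1, hT.lt_add, le_rfl, ?_⟩ ((div_lt_iff₀ hX.pos).1 hn)
  rw [hX.periodic]; simp

/-- Local convexity and embeddedness imply convexity. -/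
theorem convex (hX : IsLocConvex X ρ) {s t u : ℝ} (hst : s < t) (htu : t < u) (hu : u < s + 1) :
    0 < det (X s) (X t) (X u) := by
  by_contra! hneg
  have hn : ¬ ConvArc X s u := fun h => absurd (h s t u le_rfl hst htu le_rfl) (not_lt.2 hneg)
  obtain ⟨σ, h1, h2, hconv, hmode | hmode⟩ := hX.first_failure hu hn
  · exact hX.not_trap ⟨by linarith [hX.pos], by linarith, hconv, hmode⟩
  -- A failure at the beginning of the arc becomes, for the reflected and reversed curve, turning
  -- away at the end.
  · have hY := hX.mirror
    have hdet : ∀ a b c, det (CayleyKlein.mirror (X (-a))) (CayleyKlein.mirror (X (-b)))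
        (CayleyKlein.mirror (X (-c))) = det (X (-c)) (X (-b)) (X (-a)) := by
      intro a b c
      rw [det_mirror]; simp only [det]; ring
    have hconv' : ConvArc (fun t => CayleyKlein.mirror (X (-t))) (-σ) (-s) := by
      intro a b c ha hab hbc hc
      simp only [hdet]
      exact hconv _ _ _ (by linarith) (by linarith) (by linarith) (by linarith)
    refine hY.not_trap (a := -σ) (σ := -s) ⟨by linarith [hX.pos], by linarith, hconv', ?_⟩
    refine hY.turn_away (by linarith [hX.pos])
      (fun f h3 h4 => hconv' _ _ _ le_rfl h3 h4 le_rfl) ?_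
    intro η hη
    obtain ⟨p, q, r, h3, h4, h5, h6, h7⟩ := hmode η hη
    refine ⟨-r, -q, -p, ?_, ?_, by linarith, by linarith, ?_⟩
    · rw [show -r - -σ = -(r - σ) by ring, abs_neg]; exact h6
    · rw [show -q - -s = -(q - s) by ring, abs_neg, abs_of_pos (by linarith)]; linarith
    · have := hdet (-r) (-q) (-p)
      simp only [neg_neg] at this ⊢
      rw [this]; exact h7

end IsLocConvex

/-! ### Planar curves with almost monotone direction -/

/-- A minimum over the interval cannot be attained to the right of `a`, since slightly to the left
of such a point `f` is smaller. No differentiability is needed. -/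
lemma lt_of_left_increasing {f : ℝ → ℝ} (hf : Continuous f) {a b : ℝ} (hab : a < b)
    (h : ∀ y, a < y → y ≤ b → ∃ η > 0, ∀ k, 0 < k → k < η → f (y - k) < f y) : f a < f b := by
  obtain ⟨y, hy, hmin⟩ := isCompact_Icc.exists_isMinOn (Set.nonempty_Icc.2 hab.le)
    (hf.continuousOn (s := Set.Icc a b))
  have key : ∀ y, a < y → y ≤ b → ¬ IsMinOn f (Set.Icc a b) y := by
    intro y h1 h2 hmin
    obtain ⟨η, hη, h'⟩ := h y h1 h2
    obtain ⟨k, hk1, hk2⟩ := exists_between (lt_min hη (sub_pos.2 h1))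
    rw [lt_min_iff] at hk2
    have := isMinOn_iff.1 hmin (y - k) ⟨by linarith, by linarith⟩
    linarith [h' k hk1 hk2.1]
  rcases hy.1.eq_or_lt with rfl | h1
  · by_contra! hle
    exact key b hab le_rfl (isMinOn_iff.2 fun t ht => hle.trans (isMinOn_iff.1 hmin t ht))
  · exact absurd hmin (key y h1 hy.2)

lemma lt_of_right_increasing {f : ℝ → ℝ} (hf : Continuous f) {a b : ℝ} (hab : a < b)
    (h : ∀ y, a ≤ y → y < b → ∃ η > 0, ∀ k, 0 < k → k < η → f y < f (y + k)) : f a < f b := by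
  have := lt_of_left_increasing (f := fun t => -f (-t)) (a := -b) (b := -a) (by fun_prop)
    (by linarith) (fun y h1 h2 => by
      obtain ⟨η, hη, h'⟩ := h (-y) (by linarith) (by linarith)
      refine ⟨η, hη, fun k h3 h4 => ?_⟩
      have := h' k h3 h4
      rw [show -(y - k) = -y + k by ring]
      linarith)
  simp only [neg_neg] at this
  linarith

/-- Jordan's inequality together with `π < 4`; the margin `2 * e` makes an angular error of size `e`
harmless. -/
lemma lt_sin {e θ : ℝ} (he : 0 < e) (h1 : 2 * e ≤ θ) (h2 : θ ≤ Real.pi - 2 * e) :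
    e < Real.sin θ := by
  have hπ : Real.pi < 4 := Real.pi_lt_four
  have key : ∀ θ, 2 * e ≤ θ → θ ≤ Real.pi / 2 → e < Real.sin θ := by
    intro θ h1 h2
    refine lt_of_lt_of_le ?_ (Real.mul_le_sin (by linarith) h2)
    rw [div_mul_eq_mul_div, lt_div_iff₀ Real.pi_pos]
    nlinarith
  rcases le_total θ (Real.pi / 2) with h | h
  · exact key θ h1 h
  · rw [← Real.sin_pi_sub]
    exact key _ (by linarith) (by linarith)

lemma cos_le_cos_of_mem {c x : ℝ} (h0 : 0 ≤ c) (h1 : c ≤ x) (h2 : x ≤ 2 * Real.pi - c) :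
    Real.cos x ≤ Real.cos c := by
  rcases le_total x Real.pi with h | h
  · exact Real.cos_le_cos_of_nonneg_of_le_pi h0 h h1
  · rw [← Real.cos_two_pi_sub x]
    exact Real.cos_le_cos_of_nonneg_of_le_pi h0 (by linarith) (by linarith)

/-- The component of `w` normal to the direction of angle `χ`. -/
def normalPart (χ : ℝ) (w : ℂ) : ℝ := w.im * Real.cos χ - w.re * Real.sin χ

lemma normalPart_sub (χ : ℝ) (w w' : ℂ) :
    normalPart χ (w - w') = normalPart χ w - normalPart χ w' := by
  simp only [normalPart, Complex.sub_re, Complex.sub_im]; ring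

/-- A planar curve whose directions are almost increasing, and which almost has a tangent at its
initial point, stays in a narrow cone. -/
theorem planar_cone {z : ℝ → ℂ} {Θ : ℝ → ℝ → ℝ} {δ e : ℝ} (hδ : 0 < δ) (he : 0 < e)
    (he' : 100 * e ≤ 1) (hz : Continuous z) (hz0 : z 0 = 0)
    (hΘ : ∀ x y, -Real.pi < Θ x y ∧ Θ x y ≤ Real.pi)
    (hU : ∀ x y, 0 < x → x < y → y < δ → z x ≠ z y ∧ ∀ χ, |normalPart χ (z y - z x) -
      ‖z y - z x‖ * Real.sin (Θ x y - χ)| ≤ e * ‖z y - z x‖)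
    (hB : ∀ y, 0 < y → y < δ → z y ≠ 0 ∧ ∀ χ, |normalPart χ (z y) +
      ‖z y‖ * Real.sin χ| ≤ e * ‖z y‖)
    (hS : ∀ x y w, 0 < x → x < y → y < w → w < δ → Θ y w - Θ x y ≤ Real.pi + e)
    (hM : ∀ x y, 0 < x → x < y → y < δ → ∃ η > 0, ∀ h h', 0 < h → h < η → 0 < h' → h' < η →
      Θ x (x + h) < Θ (y - h') y + e)
    (hQ : ∀ x, 0 < x → x < δ → ∃ η > 0, ∀ h h', 0 < h → h < η → 0 < h' → h' < η →
      Real.cos (20 * e) < Real.cos (Θ x (x + h) - Θ x (x + h'))) :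
    ∃ δ₁ > 0, ∀ s t, 0 < s → s < t → t < δ₁ →
      normalPart (8 * e) (z t - z s) < 0 ∧ 0 < normalPart (-(33 * e)) (z t - z s) := by
  have hπ : 3 < Real.pi := Real.pi_gt_three
  have hfc : ∀ χ, Continuous fun t => normalPart χ (z t) := fun χ => by
    unfold normalPart; fun_prop
  have hf0 : ∀ χ, normalPart χ (z 0) = 0 := fun χ => by simp [normalPart, hz0]
  have hup : ∀ x y χ, 0 < x → x < y → y < δ → 2 * e ≤ Θ x y - χ →
      Θ x y - χ ≤ Real.pi - 2 * e → normalPart χ (z x) < normalPart χ (z y) := by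
    intro x y χ hx hxy hy h1 h2
    obtain ⟨hne, h⟩ := hU x y hx hxy hy
    have hn : 0 < ‖z y - z x‖ := norm_pos_iff.2 (sub_ne_zero.2 hne.symm)
    have h3 := (abs_le.1 (h χ)).1
    have h4 := mul_lt_mul_of_pos_left (lt_sin he h1 h2) hn
    rw [normalPart_sub] at h3
    linarith
  have hdown : ∀ x y χ, 0 < x → x < y → y < δ → Θ x y - χ ≤ -(2 * e) →
      -(Real.pi - 2 * e) ≤ Θ x y - χ → normalPart χ (z y) < normalPart χ (z x) := by
    intro x y χ hx hxy hy h1 h2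
    obtain ⟨hne, h⟩ := hU x y hx hxy hy
    have hn : 0 < ‖z y - z x‖ := norm_pos_iff.2 (sub_ne_zero.2 hne.symm)
    have h3 := (abs_le.1 (h χ)).2
    have h4 := mul_lt_mul_of_pos_left (lt_sin (θ := -(Θ x y - χ)) he (by linarith) (by linarith)) hn
    rw [normalPart_sub] at h3
    rw [Real.sin_neg] at h4
    linarith
  -- an upper bound for the directions to the right
  have hP : ∃ δ₁ > 0, δ₁ ≤ δ ∧ ∀ x, 0 < x → x < δ₁ → ∃ η > 0, ∀ h, 0 < h → h < η →
      Θ x (x + h) < 6 * e := by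
    -- Otherwise arbitrarily close to `0` there are short chords to the right with angle at least `6
    -- * e`. Almost monotonicity gives all later short left chords an angle above `5 * e`, so the
    -- component normal to the angle `3 * e` increases from a point close to `0`. In the limit it is
    -- nonnegative at `δ / 2`, but `z (δ / 2)` has nearly the angle `0`.
    by_contra! hcon
    have hy : 0 < δ / 2 ∧ δ / 2 < δ := ⟨by linarith, by linarith⟩
    have h1 : ∀ δ₁, 0 < δ₁ → δ₁ ≤ δ / 2 → ∃ x, 0 < x ∧ x < δ₁ ∧
        normalPart (3 * e) (z x) < normalPart (3 * e) (z (δ / 2)) := by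
      intro δ₁ hδ₁ hle
      obtain ⟨x, hx0, hx1, hx⟩ := hcon δ₁ hδ₁ (by linarith)
      refine ⟨x, hx0, hx1, lt_of_left_increasing (hfc (3 * e)) (by linarith) ?_⟩
      intro y hxy hyδ
      obtain ⟨η, hη, hM'⟩ := hM x y hx0 hxy (by linarith)
      obtain ⟨h, hh0, hh1, hh⟩ := hx η hη
      refine ⟨min η (y - x), lt_min hη (by linarith), fun k hk0 hk1 => ?_⟩
      rw [lt_min_iff] at hk1
      have := hM' h k hh0 hh1 hk0 hk1.1
      exact hup (y - k) y (3 * e) (by linarith) (by linarith) (by linarith) (by linarith)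
        (by linarith [(hΘ (y - k) y).2])
    have h2 : 0 ≤ normalPart (3 * e) (z (δ / 2)) := by
      by_contra! hneg
      rw [← hf0 (3 * e)] at hneg
      obtain ⟨η, hη, hnear⟩ := Metric.eventually_nhds_iff.1
        ((hfc (3 * e)).continuousAt.eventually (lt_mem_nhds hneg))
      obtain ⟨x, hx0, hx1, hx⟩ := h1 (min η (δ / 2)) (lt_min hη hy.1) (min_le_right _ _)
      have := hnear (y := x) (by
        rw [Real.dist_eq, sub_zero, abs_of_pos hx0]; exact hx1.trans_le (min_le_left _ _))
      linarith
    obtain ⟨hne, h3⟩ := hB (δ / 2) hy.1 hy.2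
    have h4 := (abs_le.1 (h3 (3 * e))).2
    have hn : 0 < ‖z (δ / 2)‖ := norm_pos_iff.2 hne
    have := mul_lt_mul_of_pos_left (lt_sin (θ := 3 * e) he (by linarith) (by linarith)) hn
    linarith
  -- a lower bound for the directions to the left
  have hN' : ∀ y, 0 < y → y < δ → ∃ η > 0, ∀ h, 0 < h → h < η → -(6 * e) < Θ (y - h) y := by
    -- The same argument run backwards from `y`.
    by_contra! hcon
    obtain ⟨y, hy0, hyδ, hy⟩ := hcon
    have h1 : ∀ x, 0 < x → x < y →
        normalPart (-(3 * e)) (z y) < normalPart (-(3 * e)) (z x) := by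
      intro x hx0 hxy
      have := lt_of_right_increasing (f := fun t => -normalPart (-(3 * e)) (z t))
        (hfc (-(3 * e))).neg hxy ?_
      · linarith
      intro x' hx' hxy'
      obtain ⟨η, hη, hM'⟩ := hM x' y (by linarith) hxy' hyδ
      obtain ⟨h, hh0, hh1, hh⟩ := hy η hη
      refine ⟨min η (y - x'), lt_min hη (by linarith), fun k hk0 hk1 => ?_⟩
      rw [lt_min_iff] at hk1
      have := hM' k h hk0 hk1.1 hh0 hh1
      have := hdown x' (x' + k) (-(3 * e)) (by linarith) (by linarith) (by linarith)
        (by linarith) (by linarith [(hΘ x' (x' + k)).1])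
      linarith
    have h2 : normalPart (-(3 * e)) (z y) ≤ 0 := by
      by_contra! hpos
      rw [← hf0 (-(3 * e))] at hpos
      obtain ⟨η, hη, hnear⟩ := Metric.eventually_nhds_iff.1
        ((hfc (-(3 * e))).continuousAt.eventually (gt_mem_nhds hpos))
      obtain ⟨x, hx0, hx1⟩ := exists_between (lt_min hη hy0)
      rw [lt_min_iff] at hx1
      have := hnear (y := x) (by rw [Real.dist_eq, sub_zero, abs_of_pos hx0]; exact hx1.1)
      linarith [h1 x hx0 hx1.2]
    obtain ⟨hne, h3⟩ := hB y hy0 hyδ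
    have h4 := (abs_le.1 (h3 (-(3 * e)))).1
    have hn : 0 < ‖z y‖ := norm_pos_iff.2 hne
    have := mul_lt_mul_of_pos_left (lt_sin (θ := 3 * e) he (by linarith) (by linarith)) hn
    rw [Real.sin_neg] at h4
    linarith
  obtain ⟨δ₁, hδ₁, hδ₁δ, hP⟩ := hP
  -- a lower bound for the directions to the right
  have hN : ∀ x, 0 < x → x < δ₁ → ∃ η > 0, ∀ h, 0 < h → h < η → -(31 * e) ≤ Θ x (x + h) := by
    by_contra! hcon
    obtain ⟨x, hx0, hx1, hx⟩ := hcon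
    obtain ⟨η₁, hη₁, hP'⟩ := hP x hx0 hx1
    obtain ⟨η₂, hη₂, hQ'⟩ := hQ x hx0 (by linarith)
    obtain ⟨h, hh0, hh1, hh⟩ := hx (min (min η₁ η₂) (δ - x))
      (lt_min (lt_min hη₁ hη₂) (by linarith))
    simp only [lt_min_iff] at hh1
    have hd := hdown x (x + h) (-(8 * e)) hx0 (by linarith) (by linarith) (by linarith)
      (by linarith [(hΘ x (x + h)).1])
    -- A short chord from `x` far below the axis forces the component normal to `-(8 * e)` to have a
    -- minimum at some `y > x`. The short left chords at `y` are above `-(6 * e)` but do not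
    -- increase this component, so their angle is near `π`. As a chord can turn by at most `π + e`,
    -- the chord from `x` to `y - k` has angle above `-(11 * e)`: two short chords from `x` differ
    -- by more than `20 * e`, against `hQ`.
    obtain ⟨y, hy, hmin⟩ := isCompact_Icc.exists_isMinOn
      (Set.nonempty_Icc.2 (show x ≤ x + h by linarith))
      ((hfc (-(8 * e))).continuousOn (s := Set.Icc x (x + h)))
    rw [isMinOn_iff] at hmin
    have hxy : x < y := by
      refine lt_of_le_of_ne hy.1 ?_
      rintro rfl
      have := hmin (x + h) ⟨by linarith, le_rfl⟩
      linarith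
    obtain ⟨η, hη, hN''⟩ := hN' y (by linarith) (by linarith [hy.2])
    obtain ⟨k, hk0, hk1⟩ := exists_between (lt_min hη (sub_pos.2 hxy))
    rw [lt_min_iff] at hk1
    have h1 := hN'' k hk0 hk1.1
    have h2 := hmin (y - k) ⟨by linarith, by linarith [hy.2]⟩
    have h3 : Real.pi - 10 * e < Θ (y - k) y := by
      by_contra! hle
      have := hup (y - k) y (-(8 * e)) (by linarith) (by linarith) (by linarith [hy.2])
        (by linarith) (by linarith)
      linarith
    have h4 := hS x (y - k) y hx0 (by linarith) (by linarith) (by linarith [hy.2])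
    have h5 := hP' (y - k - x) (by linarith) (by linarith [hy.2])
    have h6 := hQ' (y - k - x) h (by linarith) (by linarith [hy.2]) hh0 hh1.1.2
    rw [show x + (y - k - x) = y - k by ring] at h5 h6
    have h7 := (hΘ x (x + h)).1
    have := cos_le_cos_of_mem (c := 20 * e) (x := Θ x (y - k) - Θ x (x + h)) (by linarith)
      (by linarith) (by linarith)
    linarith
  -- Short right chords have angles in `[-(31 * e), 6 * e)`; the margin `2 * e` of `lt_sin` leads to
  -- `8 * e` and `33 * e`.
  refine ⟨δ₁, hδ₁, fun s t hs hst ht => ?_⟩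
  have hboth : ∀ y, s ≤ y → y < t → ∃ η > 0, ∀ k, 0 < k → k < η →
      normalPart (8 * e) (z (y + k)) < normalPart (8 * e) (z y) ∧
      normalPart (-(33 * e)) (z y) < normalPart (-(33 * e)) (z (y + k)) := by
    intro y hy1 hy2
    obtain ⟨η₁, hη₁, h1⟩ := hP y (by linarith) (by linarith)
    obtain ⟨η₂, hη₂, h2⟩ := hN y (by linarith) (by linarith)
    refine ⟨min (min η₁ η₂) (δ - y), lt_min (lt_min hη₁ hη₂) (by linarith), fun k hk0 hk1 => ?_⟩
    simp only [lt_min_iff] at hk1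
    have h3 := h1 k hk0 hk1.1.1
    have h4 := h2 k hk0 hk1.1.2
    exact ⟨hdown y (y + k) _ (by linarith) (by linarith) (by linarith) (by linarith)
      (by linarith), hup y (y + k) _ (by linarith) (by linarith) (by linarith) (by linarith)
      (by linarith)⟩
  rw [normalPart_sub, normalPart_sub]
  constructor
  · have := lt_of_right_increasing (f := fun t => -normalPart (8 * e) (z t)) (hfc _).neg hst
      fun y h1 h2 => by
        obtain ⟨η, hη, h⟩ := hboth y h1 h2
        exact ⟨η, hη, fun k h3 h4 => neg_lt_neg (h k h3 h4).1⟩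
    linarith
  · have := lt_of_right_increasing (f := fun t => normalPart (-(33 * e)) (z t)) (hfc _) hst
      fun y h1 h2 => by
        obtain ⟨η, hη, h⟩ := hboth y h1 h2
        exact ⟨η, hη, fun k h3 h4 => (h k h3 h4).2⟩
    linarith

/-! ### The plane chart at `e₀` -/

/-- The orthogonal projection to the tangent plane at `e₀`. -/
def planar (x : Vec) : ℂ := ⟨x 1, x 2⟩

/-- A point close to `e₀`. -/
structure IsNear (ε η : ℝ) (x : Vec) : Prop where
  isPt : IsPt ε x
  pos : 0 < x 0
  norm_le : ‖planar x‖ ≤ η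

lemma planar_sub (x y : Vec) : planar (x - y) = planar x - planar y := by
  apply Complex.ext <;> simp [planar]

lemma continuous_planar : Continuous planar := by
  have : planar = fun x : Vec => (x 1 : ℂ) + (x 2 : ℂ) * Complex.I := by
    funext x; apply Complex.ext <;> simp [planar]
  rw [this]; fun_prop

lemma sq_norm_planar (x : Vec) : ‖planar x‖ ^ 2 = x 1 ^ 2 + x 2 ^ 2 := by
  rw [← Complex.normSq_eq_norm_sq, Complex.normSq_apply]; simp only [planar]; ring

lemma abs_planar_le (x : Vec) : |x 1| ≤ ‖planar x‖ ∧ |x 2| ≤ ‖planar x‖ :=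
  ⟨Complex.abs_re_le_norm (planar x), Complex.abs_im_le_norm (planar x)⟩

lemma abs_mul_le {a b A B : ℝ} (ha : |a| ≤ A) (hb : |b| ≤ B) : |a * b| ≤ A * B := by
  rw [abs_mul]; exact mul_le_mul ha hb (abs_nonneg _) ((abs_nonneg _).trans ha)

lemma abs_sign {ε : ℝ} (hε : ε = 1 ∨ ε = -1) (x : ℝ) : |ε * x| = |x| := by
  rcases hε with rfl | rfl <;> simp

lemma abs_inner_le (x y : Vec) : |x 1 * y 1 + x 2 * y 2| ≤ ‖planar x‖ * ‖planar y‖ := by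
  have h := Complex.abs_re_le_norm ((starRingEnd ℂ) (planar x) * planar y)
  rw [norm_mul, Complex.norm_conj] at h
  simpa [planar] using h

lemma abs_cross_le (x y : Vec) : |x 1 * y 2 - x 2 * y 1| ≤ ‖planar x‖ * ‖planar y‖ := by
  have h := Complex.abs_im_le_norm ((starRingEnd ℂ) (planar x) * planar y)
  rw [norm_mul, Complex.norm_conj] at h
  simpa [planar, sub_eq_add_neg] using h

lemma IsNear.half_lt {ε η : ℝ} (hε : ε = 1 ∨ ε = -1) (hη : η ≤ 1 / 8) {x : Vec}
    (hx : IsNear ε η x) : 1 / 2 < x 0 := by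
  have h1 := hx.isPt.1
  have h2 := hx.pos
  have h3 := hx.norm_le
  have h4 := sq_norm_planar x
  have h5 : ‖planar x‖ ^ 2 ≤ 1 / 64 := by nlinarith [norm_nonneg (planar x)]
  simp only [bil] at h1
  by_contra! h
  rcases hε with rfl | rfl <;> nlinarith

/-- The surface is tangent at `e₀` to the plane of the last two coordinates: the difference of the
equations `bil ε x x = 1` factors through `y 0 + x 0 > 1`. -/
lemma IsNear.abs_sub_le {ε η : ℝ} (hε : ε = 1 ∨ ε = -1) (hη : η ≤ 1 / 8) {x y : Vec}
    (hx : IsNear ε η x) (hy : IsNear ε η y) :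
    |y 0 - x 0| ≤ 2 * η * ‖planar (y - x)‖ := by
  have h1 := hx.half_lt hε hη
  have h2 := hy.half_lt hε hη
  have e : (y 0 - x 0) * (y 0 + x 0) =
      -(ε * ((y - x) 1 * (y + x) 1 + (y - x) 2 * (y + x) 2)) := by
    have h3 := hx.isPt.1
    have h4 := hy.isPt.1
    simp only [bil] at h3 h4
    simp only [Pi.sub_apply, Pi.add_apply]
    linear_combination h4 - h3
  have h5 : |(y 0 - x 0) * (y 0 + x 0)| ≤ ‖planar (y - x)‖ * ‖planar (y + x)‖ := by
    rw [e, abs_neg, abs_sign hε]; exact abs_inner_le _ _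
  have h6 : ‖planar (y + x)‖ ≤ 2 * η := by
    have : planar (y + x) = planar y + planar x := by apply Complex.ext <;> simp [planar]
    rw [this]
    exact (norm_add_le _ _).trans (by linarith [hx.norm_le, hy.norm_le])
  rw [abs_mul, abs_of_pos (show 0 < y 0 + x 0 by linarith)] at h5
  nlinarith [abs_nonneg (y 0 - x 0), mul_le_mul_of_nonneg_left h6 (norm_nonneg (planar (y - x)))]

-- To first order at `e₀` the surface is its tangent plane. In terms of the difference vectors, the
-- errors come from the coordinate `0`, which is smaller by a factor `2 * η`, from the normal
-- components `bil ε a y` and `bil ε y b`, which are quadratic, and from the deviation of `y` from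
-- `e₀`.
set_option maxHeartbeats 1000000 in
lemma norm_turnC_sub_le {ε η : ℝ} (hε : ε = 1 ∨ ε = -1) (hη0 : 0 ≤ η) (hη : η ≤ 1 / 8) {x y w : Vec}
    (hx : IsNear ε η x) (hy : IsNear ε η y) (hw : IsNear ε η w) :
    ‖turnC ε x y w - planar (w - y) * (starRingEnd ℂ) (planar (y - x))‖ ≤
      3 * η * (‖planar (w - y)‖ * ‖planar (y - x)‖) := by
  obtain ⟨a, ha⟩ : ∃ a, a = y - x := ⟨_, rfl⟩
  obtain ⟨b, hb⟩ : ∃ b, b = w - y := ⟨_, rfl⟩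
  have ha0 : |a 0| ≤ 2 * η * ‖planar a‖ := by
    rw [ha]; exact hx.abs_sub_le hε hη hy
  have hb0 : |b 0| ≤ 2 * η * ‖planar b‖ := by
    rw [hb]; exact hy.abs_sub_le hε hη hw
  obtain ⟨ha1, ha2⟩ := abs_planar_le a
  obtain ⟨hb1, hb2⟩ := abs_planar_le b
  have hP : ‖planar a‖ ≤ 2 * η := by
    rw [ha, planar_sub]
    exact (norm_sub_le _ _).trans (by linarith [hx.norm_le, hy.norm_le])
  have hQ : ‖planar b‖ ≤ 2 * η := by
    rw [hb, planar_sub]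
    exact (norm_sub_le _ _).trans (by linarith [hw.norm_le, hy.norm_le])
  obtain ⟨P, hPd⟩ : ∃ P, P = ‖planar a‖ := ⟨_, rfl⟩
  obtain ⟨Q, hQd⟩ : ∃ Q, Q = ‖planar b‖ := ⟨_, rfl⟩
  have hsa := sq_norm_planar a
  have hsb := sq_norm_planar b
  have hcr := abs_cross_le a b
  have hP0 := norm_nonneg (planar a)
  have hQ0 := norm_nonneg (planar b)
  rw [← hPd] at ha0 ha1 ha2 hP hsa hcr hP0
  rw [← hQd] at hb0 hb1 hb2 hQ hsb hcr hQ0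
  have hy0 : |y 0 - 1| ≤ 2 * η * η := by
    have h0 : IsNear ε η e₀ := ⟨⟨by simp [bil, e₀], fun _ => by simp [e₀]⟩, by simp [e₀], by
      have : planar e₀ = 0 := by apply Complex.ext <;> simp [planar, e₀]
      rw [this, norm_zero]; exact hη0⟩
    have h1 := h0.abs_sub_le hε hη hy
    have h2 : planar (y - e₀) = planar y := by apply Complex.ext <;> simp [planar, e₀]
    rw [h2] at h1
    have h3 : e₀ 0 = 1 := by simp [e₀]
    rw [h3] at h1
    exact h1.trans (mul_le_mul_of_nonneg_left hy.norm_le (by linarith))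
  have hbil : ∀ v : Vec, ∀ V : ℝ, 0 ≤ V → |v 0| ≤ 2 * η * V → V ^ 2 = v 1 ^ 2 + v 2 ^ 2 →
      |bil ε v v| ≤ 2 * V ^ 2 := by
    intro v V hV h1 h2
    have h3 := abs_le.1 h1
    have h4 : 2 * η * V ≤ V := by nlinarith
    have h5 : v 0 ^ 2 ≤ V ^ 2 := sq_le_sq' (by linarith) (by linarith)
    simp only [bil]
    rw [abs_le]
    rcases hε with rfl | rfl <;> constructor <;> nlinarith [sq_nonneg (v 0)]
  have hay : |bil ε a y| ≤ P ^ 2 := by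
    have e1 : bil ε a y = bil ε a a / 2 := by
      have h1 := hx.isPt.1
      have h2 := hy.isPt.1
      rw [ha]
      simp only [bil_sub_left, bil_sub_right, bil_comm ε y x, h1, h2]; ring
    have := hbil a P hP0 ha0 hsa
    rw [e1, abs_div, abs_two]; linarith
  have hyb : |bil ε y b| ≤ Q ^ 2 := by
    have e1 : bil ε y b = -bil ε b b / 2 := by
      have h1 := hw.isPt.1
      have h2 := hy.isPt.1
      rw [hb]
      simp only [bil_sub_left, bil_sub_right, bil_comm ε y w, h1, h2]; ring
    have := hbil b Q hQ0 hb0 hsb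
    rw [e1, abs_div, abs_neg, abs_two]; linarith
  have hPQ : 0 ≤ P * Q := mul_nonneg hP0 hQ0
  have hηη : η * η ≤ η / 8 := by nlinarith
  -- real part
  have hre : |(turnC ε x y w - planar b * (starRingEnd ℂ) (planar a)).re| ≤ η * (P * Q) := by
    have e1 : (turnC ε x y w - planar b * (starRingEnd ℂ) (planar a)).re =
        ε * (a 0 * b 0 - bil ε a y * bil ε y b) := by
      have h2 := sq_of_sign hε
      have h3 : bil ε x y * bil ε y w - bil ε x w = bil ε a b - bil ε a y * bil ε y b := by
        rw [ha, hb]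
        simp only [bil_sub_left, bil_sub_right, hy.isPt.1]; ring
      simp only [turnC, planar, Complex.sub_re, Complex.mul_re, Complex.conj_re, Complex.conj_im]
      rw [h3]
      simp only [bil]
      linear_combination (a 1 * b 1 + a 2 * b 2) * h2
    rw [e1, abs_sign hε]
    have h1 := abs_mul_le ha0 hb0
    have h2 := abs_mul_le hay hyb
    have h3 : P ^ 2 * Q ^ 2 ≤ 4 * (η * η) * (P * Q) := by
      have := mul_le_mul hP hQ hQ0 (by linarith)
      nlinarith
    have h4 := abs_sub (a 0 * b 0) (bil ε a y * bil ε y b)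
    have h5 := mul_le_mul_of_nonneg_right hηη hPQ
    linarith
  have him : |(turnC ε x y w - planar b * (starRingEnd ℂ) (planar a)).im| ≤ 2 * η * (P * Q) := by
    have e1 : (turnC ε x y w - planar b * (starRingEnd ℂ) (planar a)).im =
        (y 0 - 1) * (a 1 * b 2 - a 2 * b 1) + (y 1 * (a 2 * b 0) - y 1 * (a 0 * b 2)) +
        (y 2 * (a 0 * b 1) - y 2 * (a 1 * b 0)) := by
      simp only [turnC, planar, Complex.sub_im, Complex.mul_im, Complex.conj_re, Complex.conj_im,
        det]
      rw [ha, hb]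
      simp only [Pi.sub_apply]
      ring
    obtain ⟨hy1, hy2⟩ := abs_planar_le y
    have hy1 := hy1.trans hy.norm_le
    have hy2 := hy2.trans hy.norm_le
    have h1 := abs_le.1 (abs_mul_le hy0 hcr)
    have h2 := abs_le.1 (abs_mul_le hy1 (abs_mul_le ha2 hb0))
    have h3 := abs_le.1 (abs_mul_le hy1 (abs_mul_le ha0 hb2))
    have h4 := abs_le.1 (abs_mul_le hy2 (abs_mul_le ha0 hb1))
    have h5 := abs_le.1 (abs_mul_le hy2 (abs_mul_le ha1 hb0))
    have h6 := mul_le_mul_of_nonneg_right hηη hPQ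
    rw [e1, abs_le]
    constructor <;> linarith
  rw [← ha, ← hb]
  refine (Complex.norm_le_abs_re_add_abs_im _).trans ?_
  rw [← hPd, ← hQd, mul_comm Q P]
  linarith

/-- Normalizing can double a relative error. -/
lemma norm_unit_sub_le {a b : ℂ} {c : ℝ} (hb : b ≠ 0) (h : ‖a - b‖ ≤ c * ‖b‖) :
    ‖Complex.exp (a.arg * Complex.I) - b / (‖b‖ : ℂ)‖ ≤ 2 * c := by
  have hb0 : 0 < ‖b‖ := norm_pos_iff.2 hb
  have hab := norm_sub_norm_le b a
  rw [norm_sub_rev] at hab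
  obtain ⟨E, hE⟩ : ∃ E, E = Complex.exp (a.arg * Complex.I) := ⟨_, rfl⟩
  have h1 : (‖a‖ : ℂ) * E = a := by rw [hE]; exact Complex.norm_mul_exp_arg_mul_I a
  have hE1 : ‖E‖ = 1 := by rw [hE]; exact Complex.norm_exp_ofReal_mul_I _
  rw [← hE]
  have hbc : (‖b‖ : ℂ) ≠ 0 := by exact_mod_cast hb0.ne'
  have h2 : (‖b‖ : ℂ) * (E - b / (‖b‖ : ℂ)) = ((‖b‖ - ‖a‖ : ℝ) : ℂ) * E + (a - b) := by
    rw [mul_sub, mul_div_cancel₀ _ hbc]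
    push_cast
    linear_combination h1
  have h3 := congrArg norm h2
  rw [norm_mul, Complex.norm_real, norm_norm] at h3
  have h4 := norm_add_le (((‖b‖ - ‖a‖ : ℝ) : ℂ) * E) (a - b)
  rw [← h3, norm_mul, hE1, mul_one, Complex.norm_real, Real.norm_eq_abs] at h4
  have h5 := abs_norm_sub_norm_le b a
  rw [norm_sub_rev] at h5
  refine le_of_mul_le_mul_left ?_ hb0
  linarith

/-- The direction of a chord in the chart. -/
def chartDir (x y : Vec) : ℂ := planar (y - x) / (‖planar (y - x)‖ : ℂ)

lemma norm_chartDir {x y : Vec} (h : planar (y - x) ≠ 0) : ‖chartDir x y‖ = 1 := by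
  rw [chartDir, norm_div, Complex.norm_real, norm_norm, div_self (norm_ne_zero_iff.2 h)]

lemma norm_smul_chartDir (x y : Vec) :
    planar (y - x) = (‖planar (y - x)‖ : ℂ) * chartDir x y := by
  by_cases h : planar (y - x) = 0
  · rw [h]; simp
  · rw [chartDir, mul_div_cancel₀]
    exact_mod_cast norm_ne_zero_iff.2 h

lemma IsNear.planar_ne {ε η : ℝ} (hε : ε = 1 ∨ ε = -1) (hη : η ≤ 1 / 8) {x y : Vec}
    (hx : IsNear ε η x) (hy : IsNear ε η y) (hxy : x ≠ y) : planar (y - x) ≠ 0 := by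
  intro h
  have h0 := hx.abs_sub_le hε hη hy
  rw [h, norm_zero, mul_zero] at h0
  have h1 := abs_planar_le (y - x)
  rw [h, norm_zero] at h1
  apply hxy
  ext i
  fin_cases i
  · have := abs_nonpos_iff.1 h0
    exact (sub_eq_zero.1 this).symm
  · have := abs_nonpos_iff.1 h1.1
    exact (sub_eq_zero.1 this).symm
  · have := abs_nonpos_iff.1 h1.2
    exact (sub_eq_zero.1 this).symm

/-- The exterior angle is close to the angle in the chart. -/
lemma norm_exp_turn_sub_le {ε η : ℝ} (hε : ε = 1 ∨ ε = -1) (hη0 : 0 ≤ η) (hη : η ≤ 1 / 8)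
    {x y w : Vec} (hx : IsNear ε η x) (hy : IsNear ε η y) (hw : IsNear ε η w) (hxy : x ≠ y)
    (hyw : y ≠ w) : ‖Complex.exp (turn ε x y w * Complex.I) -
      chartDir y w * (starRingEnd ℂ) (chartDir x y)‖ ≤ 6 * η := by
  have h1 := hx.planar_ne hε hη hy hxy
  have h2 := hy.planar_ne hε hη hw hyw
  have h3 := norm_turnC_sub_le hε hη0 hη hx hy hw
  have h4 : planar (w - y) * (starRingEnd ℂ) (planar (y - x)) ≠ 0 :=
    mul_ne_zero h2 (by simpa using h1)
  have h5 := norm_unit_sub_le (c := 3 * η) h4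
    (by rw [norm_mul, Complex.norm_conj]; exact h3)
  have h6 : planar (w - y) * (starRingEnd ℂ) (planar (y - x)) /
      (‖planar (w - y) * (starRingEnd ℂ) (planar (y - x))‖ : ℂ) =
      chartDir y w * (starRingEnd ℂ) (chartDir x y) := by
    rw [norm_mul, Complex.norm_conj, chartDir, chartDir, map_div₀, Complex.conj_ofReal]
    push_cast
    field_simp
  rw [h6] at h5
  rw [turn]
  linarith

/-! ### Consequences of the existence of the swerve -/

/-- Complete both the long broken line and the short one `m, y, w` by the same fine tail up to `m +
1 / 2`. Both sums are close to the same swerve, and the contributions of the tail cancel. -/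
lemma IsCurved.turn_last {ε k : ℝ} {X : ℝ → Vec} (hX : IsCurved ε k X) (m : ℝ) {e : ℝ}
    (he : 0 < e) : ∃ δ > 0, ∀ (l : List ℝ) (y w : ℝ), IsFine δ (m :: (l ++ [y, w])) → m < y →
      w < m + δ →
      |tripleSum (fun p q r => turn ε (X p) (X q) (X r)) (m :: (l ++ [y, w])) -
        turn ε (X m) (X y) (X w)| < e := by
  obtain ⟨τ, -, -, -, hτ, -⟩ := hX.swerve m (m + 1 / 2) (by linarith) (by linarith)
  obtain ⟨δ, hδ, h⟩ := hτ (e / 2) (by linarith)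
  refine ⟨min δ (1 / 2), lt_min hδ (by norm_num), fun l y w hf hmy hw => ?_⟩
  have hwδ : w < m + δ := by linarith [min_le_left δ (1 / 2)]
  have hwb : w < m + 1 / 2 := by linarith [min_le_right δ (1 / 2)]
  -- The common tail after `w`.
  obtain ⟨L, hL⟩ := exists_isFine hδ hwb
  have hf' : IsFine δ ((m :: l) ++ y :: w :: (L ++ [m + 1 / 2])) := by
    have h1 : IsFine δ ((m :: l) ++ y :: [w]) := hf.mono (min_le_left _ _)
    rw [isFine_append] at h1 ⊢
    exact ⟨h1.1, h1.2.1, hL⟩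
  have hyw : y < w := by
    have h1 : IsFine (min δ (1 / 2)) ((m :: l) ++ y :: [w]) := hf
    exact (isFine_append.1 h1).2.1.1
  have h1 := h (l ++ y :: w :: L) (by simpa using hf')
  have h2 := h (y :: w :: L) (by
    refine isFine_cons_cons.2 ⟨⟨hmy, by linarith⟩, isFine_cons_cons.2 ⟨⟨hyw, by linarith⟩, hL⟩⟩)
  have e1 : tripleSum (fun p q r => turn ε (X p) (X q) (X r))
      (m :: ((l ++ y :: w :: L) ++ [m + 1 / 2])) =
      tripleSum (fun p q r => turn ε (X p) (X q) (X r)) (m :: (l ++ [y, w])) +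
      tripleSum (fun p q r => turn ε (X p) (X q) (X r)) (y :: w :: (L ++ [m + 1 / 2])) := by
    have := tripleSum_append (fun p q r => turn ε (X p) (X q) (X r)) (m :: l)
      (L ++ [m + 1 / 2]) y w
    simpa using this
  rw [e1] at h1
  simp only [List.cons_append, tripleSum] at h2
  rw [abs_lt] at *
  constructor <;> linarith

lemma IsCurved.tripleSum_pos {ε k : ℝ} (hk : 0 < k) {X : ℝ → Vec} (hX : IsCurved ε k X) {a b : ℝ}
    (hab : a < b) (hb : b < a + 1) : ∃ δ > 0, ∀ l : List ℝ, IsFine δ (a :: (l ++ [b])) →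
      0 < tripleSum (fun p q r => turn ε (X p) (X q) (X r)) (a :: (l ++ [b])) := by
  obtain ⟨τ, ℓ, hℓ, hkτ, hτ, -⟩ := hX.swerve a b hab hb
  obtain ⟨δ, hδ, h⟩ := hτ τ ((mul_pos hk hℓ).trans_le hkτ)
  exact ⟨δ, hδ, fun l hl => by linarith [(abs_lt.1 (h l hl)).1]⟩

lemma IsCurved.turn_add {ε k : ℝ} {X : ℝ → Vec} (hX : IsCurved ε k X) (m : ℝ) {e : ℝ}
    (he : 0 < e) : ∃ δ > 0, ∀ x y w : ℝ, m < x → x < y → y < w → w < m + δ →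
      |turn ε (X m) (X x) (X y) + turn ε (X x) (X y) (X w) - turn ε (X m) (X y) (X w)| < e := by
  obtain ⟨δ, hδ, h⟩ := hX.turn_last m he
  refine ⟨δ, hδ, fun x y w h1 h2 h3 h4 => ?_⟩
  have := h [x] y w ?_ (h1.trans h2) h4
  · simpa [tripleSum] using this
  · refine isFine_cons_cons.2 ⟨⟨h1, by linarith⟩, isFine_cons_cons.2 ⟨⟨h2, by linarith⟩,
      isFine_cons_cons.2 ⟨⟨h3, by linarith⟩, List.isChain_singleton _⟩⟩⟩

/-! ### One-sided tangents -/

lemma norm_exp_sub_exp_le (α β : ℝ) :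
    ‖Complex.exp (α * Complex.I) - Complex.exp (β * Complex.I)‖ ≤ |α - β| := by
  have h : Complex.exp (α * Complex.I) - Complex.exp (β * Complex.I) =
      Complex.exp (β * Complex.I) * (Complex.exp (Complex.I * ((α - β : ℝ) : ℂ)) - 1) := by
    rw [mul_sub, ← Complex.exp_add, mul_one]
    congr 2
    push_cast; ring
  rw [h, norm_mul, Complex.norm_exp_ofReal_mul_I, one_mul]
  exact Real.norm_exp_I_mul_ofReal_sub_one_le

lemma normalPart_real_mul (χ r : ℝ) (w : ℂ) : normalPart χ ((r : ℂ) * w) = r * normalPart χ w := by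
  simp [normalPart]; ring

lemma normalPart_exp (χ θ : ℝ) : normalPart χ (Complex.exp (θ * Complex.I)) = Real.sin (θ - χ) := by
  rw [Real.sin_sub, normalPart, Complex.exp_ofReal_mul_I_re, Complex.exp_ofReal_mul_I_im]

lemma abs_normalPart_le (χ : ℝ) (w : ℂ) : |normalPart χ w| ≤ ‖w‖ := by
  have h := Complex.abs_im_le_norm (w * Complex.exp ((-χ : ℝ) * Complex.I))
  rw [norm_mul, Complex.norm_exp_ofReal_mul_I, mul_one, Complex.mul_im,
    Complex.exp_ofReal_mul_I_re, Complex.exp_ofReal_mul_I_im, Real.sin_neg, Real.cos_neg] at h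
  rw [normalPart]
  convert h using 2; ring

/-- Converts the two sign conditions on normal components into a bound on the slope; for angles up
to `1 / 2` the cosine is at least `1 / 2`, whence the factor `2`. -/
lemma narrow_cone {α β : ℝ} {c : ℂ} (hα : 0 ≤ α) (hβ : 0 ≤ β) (hαβ : α + β ≤ 1 / 2)
    (h1 : normalPart α c < 0) (h2 : 0 < normalPart (-β) c) :
    0 < c.re ∧ |c.im| ≤ 2 * (α + β) * c.re := by
  have cos_ge : ∀ x : ℝ, 0 ≤ x → x ≤ 1 / 2 → 1 / 2 ≤ Real.cos x := fun x h h' => by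
    have := Real.one_sub_sq_div_two_le_cos (x := x)
    nlinarith
  simp only [normalPart, Real.cos_neg, Real.sin_neg] at h1 h2
  have a1 := cos_ge α hα (by linarith)
  have a2 := cos_ge β hβ (by linarith)
  have b1 := Real.sin_le hα
  have b2 := Real.sin_le hβ
  have c1 := Real.sin_nonneg_of_nonneg_of_le_pi hα (by linarith [Real.pi_gt_three])
  have c2 := Real.sin_nonneg_of_nonneg_of_le_pi hβ (by linarith [Real.pi_gt_three])
  have hre : 0 < c.re := by
    by_contra! h
    rcases le_total 0 c.im with h' | h'
    · nlinarith [mul_nonneg h' (show 0 ≤ Real.cos α by linarith),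
        mul_nonneg (neg_nonneg.2 h) c1]
    · nlinarith [mul_nonneg (neg_nonneg.2 h') (show 0 ≤ Real.cos β by linarith),
        mul_nonneg (neg_nonneg.2 h) c2]
  refine ⟨hre, abs_le.2 ⟨?_, ?_⟩⟩
  · by_contra! h
    have : c.im < 0 := lt_of_lt_of_le h (by
      have := mul_nonneg (show 0 ≤ 2 * (α + β) by linarith) hre.le
      linarith)
    nlinarith [mul_le_mul_of_nonneg_left a2 (neg_nonneg.2 this.le), mul_nonneg hα hre.le,
      mul_le_mul_of_nonneg_left b2 hre.le]
  · by_contra! h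
    have : 0 < c.im := lt_of_le_of_lt (by positivity) h
    nlinarith [mul_le_mul_of_nonneg_left a1 this.le, mul_nonneg hβ hre.le,
      mul_le_mul_of_nonneg_left b1 hre.le]

lemma IsCurved.near {ε k : ℝ} {X : ℝ → Vec} (hX : IsCurved ε k X) (h0 : X 0 = e₀) {η : ℝ}
    (hη : 0 < η) : ∃ δ > 0, ∀ t, |t| < δ → IsNear ε η (X t) := by
  have hc := hX.continuous
  have e1 : ∀ᶠ t in nhds (0 : ℝ), 0 < X t 0 := by
    refine (show Continuous fun t => X t 0 by fun_prop).continuousAt.eventually (lt_mem_nhds ?_)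
    show 0 < X 0 0
    rw [h0]; simp [e₀]
  have e2 : ∀ᶠ t in nhds (0 : ℝ), ‖planar (X t)‖ < η := by
    refine (show Continuous fun t => ‖planar (X t)‖ from
      (continuous_planar.comp hc).norm).continuousAt.eventually (gt_mem_nhds ?_)
    have : planar e₀ = 0 := by apply Complex.ext <;> simp [planar, e₀]
    show ‖planar (X 0)‖ < η
    rw [h0, this, norm_zero]; exact hη
  obtain ⟨δ, hδ, h⟩ := Metric.eventually_nhds_iff.1 (e1.and e2)
  exact ⟨δ, hδ, fun t ht => by
    have := h (y := t) (by simpa [Real.dist_eq] using ht)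
    exact ⟨hX.isPt t, this.1, this.2.le⟩⟩

/-- In a plane the directions satisfy `(d₂ / d₁) * (d₃ / d₂) = d₃ / d₁`. If the product of the first
two rotations is nearly `d₃ / d₄`, then `d₁` is nearly `d₄`; three approximations and one product
error are incurred. -/
lemma unit_mul_bound {d₁ d₂ d₃ d₄ E₁ E₂ E₃ : ℂ} {r ρ : ℝ} (h2 : ‖d₂‖ = 1)
    (h3 : ‖d₃‖ = 1) (hE : ‖E₁‖ = 1)
    (a1 : ‖E₁ - d₂ * (starRingEnd ℂ) d₁‖ ≤ r) (a2 : ‖E₂ - d₃ * (starRingEnd ℂ) d₂‖ ≤ r)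
    (a3 : ‖E₃ - d₃ * (starRingEnd ℂ) d₄‖ ≤ r) (a4 : ‖E₁ * E₂ - E₃‖ ≤ ρ) :
    ‖d₁ - d₄‖ ≤ 3 * r + ρ := by
  have h22 : d₂ * (starRingEnd ℂ) d₂ = 1 := by
    rw [Complex.mul_conj, Complex.normSq_eq_norm_sq, h2]; simp
  have e : d₃ * (starRingEnd ℂ) (d₁ - d₄) =
      -((E₁ - d₂ * (starRingEnd ℂ) d₁) * (d₃ * (starRingEnd ℂ) d₂)) +
      -(E₁ * (E₂ - d₃ * (starRingEnd ℂ) d₂)) +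
      (E₃ - d₃ * (starRingEnd ℂ) d₄) + (E₁ * E₂ - E₃) := by
    rw [map_sub]
    linear_combination (-(d₃ * (starRingEnd ℂ) d₁)) * h22
  have h4 : ‖d₁ - d₄‖ = ‖d₃ * (starRingEnd ℂ) (d₁ - d₄)‖ := by
    rw [norm_mul, h3, Complex.norm_conj, one_mul]
  rw [h4, e]
  have n1 : ‖-((E₁ - d₂ * (starRingEnd ℂ) d₁) * (d₃ * (starRingEnd ℂ) d₂))‖ ≤ r := by
    rw [norm_neg, norm_mul, norm_mul, Complex.norm_conj, h2, h3]; linarith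
  have n2 : ‖-(E₁ * (E₂ - d₃ * (starRingEnd ℂ) d₂))‖ ≤ r := by
    rw [norm_neg, norm_mul, hE]; linarith
  refine (norm_add_le _ _).trans ?_
  refine (add_le_add (norm_add_le _ _) le_rfl).trans ?_
  have := norm_add_le (-((E₁ - d₂ * (starRingEnd ℂ) d₁) * (d₃ * (starRingEnd ℂ) d₂)))
    (-(E₁ * (E₂ - d₃ * (starRingEnd ℂ) d₂)))
  linarith

/-- The directions of the short chords from a point almost coincide. -/
lemma IsCurved.chartDir_osc {ε k η δ : ℝ} (hε : ε = 1 ∨ ε = -1) {X : ℝ → Vec} (hX : IsCurved ε k X)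
    (hη0 : 0 < η) (hη : η ≤ 1 / 8) (hδ1 : δ ≤ 1 / 2) (hnear : ∀ t, |t| < δ → IsNear ε η (X t))
    {x : ℝ} (hx0 : 0 ≤ x) (hx : x < δ) : ∃ θ > 0, ∀ h h', 0 < h → h < θ → 0 < h' → h' < θ →
      ‖chartDir (X x) (X (x + h)) - chartDir (X x) (X (x + h'))‖ ≤ 19 * η := by
  obtain ⟨θ, hθ, H⟩ := hX.turn_add x hη0
  have key : ∀ h h', 0 < h → h < h' → h' < min θ (δ - x) →
      ‖chartDir (X x) (X (x + h)) - chartDir (X x) (X (x + h'))‖ ≤ 19 * η := by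
    intro h h' h1 h2 h3
    obtain ⟨r, hr1, hr2⟩ := exists_between h3
    rw [lt_min_iff] at hr2
    have n : ∀ t, 0 ≤ t → t ≤ r → IsNear ε η (X (x + t)) := fun t ht ht' =>
      hnear _ (by rw [abs_of_nonneg (by linarith)]; linarith)
    have nx : IsNear ε η (X x) := hnear x (by rw [abs_of_nonneg hx0]; exact hx)
    have ne : ∀ s t, 0 ≤ s → s < t → t ≤ r → X (x + s) ≠ X (x + t) := fun s t _ h2 h3 =>
      hX.injective _ _ (by linarith) (by linarith)
    have nex : ∀ t, 0 < t → t ≤ r → X x ≠ X (x + t) := fun t h1 h2 =>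
      hX.injective _ _ (by linarith) (by linarith)
    have hT := H (x + h) (x + h') (x + r) (by linarith) (by linarith) (by linarith) (by linarith)
    have a1 := norm_exp_turn_sub_le hε hη0.le hη nx (n h h1.le (by linarith))
      (n h' (by linarith) hr1.le) (nex h h1 (by linarith)) (ne h h' h1.le h2 hr1.le)
    have a2 := norm_exp_turn_sub_le hε hη0.le hη (n h h1.le (by linarith))
      (n h' (by linarith) hr1.le) (n r (by linarith) le_rfl) (ne h h' h1.le h2 hr1.le)
      (ne h' r (by linarith) hr1 le_rfl)
    have a3 := norm_exp_turn_sub_le hε hη0.le hη nx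
      (n h' (by linarith) hr1.le) (n r (by linarith) le_rfl) (nex h' (by linarith) hr1.le)
      (ne h' r (by linarith) hr1 le_rfl)
    have := unit_mul_bound (ρ := η)
      (norm_chartDir ((n h h1.le (by linarith)).planar_ne hε hη (n h' (by linarith) hr1.le)
        (ne h h' h1.le h2 hr1.le)))
      (norm_chartDir ((n h' (by linarith) hr1.le).planar_ne hε hη (n r (by linarith) le_rfl)
        (ne h' r (by linarith) hr1 le_rfl)))
      (Complex.norm_exp_ofReal_mul_I _) a1 a2 a3 (by
        rw [← Complex.exp_add, ← add_mul, ← Complex.ofReal_add]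
        exact (norm_exp_sub_exp_le _ _).trans hT.le)
    linarith
  refine ⟨min θ (δ - x), lt_min hθ (by linarith), fun h h' h1 h2 h3 h4 => ?_⟩
  rcases lt_trichotomy h h' with h5 | rfl | h5
  · exact key h h' h1 h5 h4
  · rw [sub_self, norm_zero]; positivity
  · rw [norm_sub_rev]; exact key h' h h3 h5 h2

/-- The oscillation estimate at the base point for every `η` is the Cauchy criterion. -/
lemma IsCurved.exists_chartDir_lim {ε k : ℝ} (hε : ε = 1 ∨ ε = -1) {X : ℝ → Vec}
    (hX : IsCurved ε k X) (h0 : X 0 = e₀) : ∃ u : ℂ, ‖u‖ = 1 ∧ ∀ e > 0, ∃ δ > 0, ∀ t, 0 < t → t < δ →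
      ‖chartDir (X 0) (X t) - u‖ ≤ e := by
  have hosc : ∀ e > 0, ∃ δ > 0, (∀ t, 0 < t → t < δ → ‖chartDir (X 0) (X t)‖ = 1) ∧
      ∀ s t, 0 < s → s < δ → 0 < t → t < δ →
      ‖chartDir (X 0) (X s) - chartDir (X 0) (X t)‖ ≤ e := by
    intro e he
    obtain ⟨η, hη⟩ : ∃ η, η = min (1 / 8) (e / 19) := ⟨_, rfl⟩
    have hη0 : 0 < η := by rw [hη]; positivity
    have hη1 : η ≤ 1 / 8 := by rw [hη]; exact min_le_left _ _
    have hη2 : η ≤ e / 19 := by rw [hη]; exact min_le_right _ _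
    obtain ⟨δ, hδ, hnear⟩ := hX.near h0 hη0
    have hδ' : 0 < min δ (1 / 2) := by positivity
    have hnear' : ∀ t, |t| < min δ (1 / 2) → IsNear ε η (X t) :=
      fun t ht => hnear t (ht.trans_le (min_le_left _ _))
    obtain ⟨θ, hθ, h⟩ := hX.chartDir_osc hε hη0 hη1 (min_le_right _ _) hnear' le_rfl hδ'
    refine ⟨min θ (min δ (1 / 2)), lt_min hθ hδ', fun t h1 h2 => ?_, fun s t h1 h2 h3 h4 => ?_⟩
    · simp only [lt_min_iff] at h2
      exact norm_chartDir ((hnear' 0 (by simpa using hδ)).planar_ne hε hη1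
        (hnear t (by rw [abs_of_pos h1]; exact h2.2.1)) (hX.injective 0 t h1 (by linarith)))
    · have := h s t h1 (h2.trans_le (min_le_left _ _)) h3 (h4.trans_le (min_le_left _ _))
      simp only [zero_add] at this
      linarith
  have hcau : Cauchy (Filter.map (fun t => chartDir (X 0) (X t)) (nhdsWithin (0 : ℝ) (Set.Ioi 0))) := by
    rw [Metric.cauchy_iff]
    refine ⟨inferInstance, fun e he => ?_⟩
    obtain ⟨δ, hδ, -, h⟩ := hosc (e / 2) (by linarith)
    refine ⟨(fun t => chartDir (X 0) (X t)) '' Set.Ioo 0 δ,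
      Filter.image_mem_map (Ioo_mem_nhdsGT hδ), ?_⟩
    rintro _ ⟨s, hs, rfl⟩ _ ⟨t, ht, rfl⟩
    rw [dist_eq_norm]
    linarith [h s t hs.1 hs.2 ht.1 ht.2]
  obtain ⟨u, hu⟩ := cauchy_map_iff_exists_tendsto.1 hcau
  have hlim : ∀ e > 0, ∃ δ > 0, ∀ t, 0 < t → t < δ → ‖chartDir (X 0) (X t) - u‖ ≤ e := by
    intro e he
    have := (Metric.tendsto_nhds.1 hu e he)
    obtain ⟨δ, hδ, h⟩ := (mem_nhdsGT_iff_exists_Ioo_subset).1 this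
    exact ⟨δ, hδ, fun t h1 h2 => by
      have : dist (chartDir (X 0) (X t)) u < e := h ⟨h1, h2⟩
      rw [dist_eq_norm] at this; exact this.le⟩
  refine ⟨u, ?_, hlim⟩
  obtain ⟨δ, hδ, h, -⟩ := hosc 1 one_pos
  have h1 : Filter.Tendsto (fun t => ‖chartDir (X 0) (X t)‖) (nhdsWithin (0 : ℝ) (Set.Ioi 0))
      (nhds 1) := by
    refine Filter.Tendsto.congr' ?_ tendsto_const_nhds
    filter_upwards [Ioo_mem_nhdsGT hδ] with t ht using (h t ht.1 ht.2).symm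
  exact tendsto_nhds_unique hu.norm h1

/-- The tangent vector at `e₀` of given planar direction. -/
def tangent (u : ℂ) : Vec := ![0, u.re, u.im]

/-- For parameters in `I` all chords have almost the direction `v`. -/
def HasDirection (X : ℝ → Vec) (I : Set ℝ) (v : Vec) (η : ℝ) : Prop :=
  ∀ s ∈ I, ∀ t ∈ I, s < t → ∃ a > 0, ‖X t - X s - a • v‖ ≤ η * a

lemma norm_sub_tangent_le {ε η κ : ℝ} (hε : ε = 1 ∨ ε = -1) (hη0 : 0 ≤ η) (hη : η ≤ 1 / 8)
    {x y : Vec} (hx : IsNear ε η x) (hy : IsNear ε η y) {u : ℂ} (hu : ‖u‖ = 1)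
    (hκ : κ ≤ 1) (hκη : 4 * η ≤ κ)
    (hre : 0 < ((starRingEnd ℂ) u * planar (y - x)).re)
    (him : |((starRingEnd ℂ) u * planar (y - x)).im| ≤
      κ * ((starRingEnd ℂ) u * planar (y - x)).re) :
    ‖y - x - ((starRingEnd ℂ) u * planar (y - x)).re • tangent u‖ ≤
      κ * ((starRingEnd ℂ) u * planar (y - x)).re := by
  obtain ⟨c, hc⟩ : ∃ c, c = (starRingEnd ℂ) u * planar (y - x) := ⟨_, rfl⟩
  rw [← hc] at hre him ⊢
  have huu : u * (starRingEnd ℂ) u = 1 := by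
    rw [Complex.mul_conj, Complex.normSq_eq_norm_sq, hu]; simp
  have hp : planar (y - x) = u * c := by
    rw [hc, ← mul_assoc, huu, one_mul]
  have hcn : ‖planar (y - x)‖ ≤ 2 * c.re := by
    rw [hp, norm_mul, hu, one_mul]
    have := Complex.norm_le_abs_re_add_abs_im c
    rw [abs_of_pos hre] at this
    nlinarith
  have h0 := hx.abs_sub_le hε hη hy
  have hur := Complex.abs_re_le_norm u
  have hui := Complex.abs_im_le_norm u
  rw [hu] at hur hui
  have h1 : (y - x) 1 = u.re * c.re - u.im * c.im := by
    have := congrArg Complex.re hp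
    simpa [planar] using this
  have h2 : (y - x) 2 = u.re * c.im + u.im * c.re := by
    have := congrArg Complex.im hp
    simpa [planar] using this
  refine (pi_norm_le_iff_of_nonneg (mul_nonneg (by linarith) hre.le)).2 fun i => ?_
  have hcim := him
  fin_cases i
  · have : |y 0 - x 0| ≤ κ * c.re := h0.trans (by
      have := mul_le_mul_of_nonneg_left hcn (show 0 ≤ 2 * η by linarith)
      nlinarith)
    simpa [tangent] using this
  · have e : (y - x - c.re • tangent u) 1 = -(u.im * c.im) := by
      rw [Pi.sub_apply, h1]; simp [tangent]; ring
    show ‖(y - x - c.re • tangent u) 1‖ ≤ _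
    rw [e, Real.norm_eq_abs, abs_neg, abs_mul]
    nlinarith [abs_nonneg c.im, abs_nonneg u.im]
  · have e : (y - x - c.re • tangent u) 2 = u.re * c.im := by
      rw [Pi.sub_apply, h2]; simp [tangent]; ring
    show ‖(y - x - c.re • tangent u) 2‖ ≤ _
    rw [e, Real.norm_eq_abs, abs_mul]
    nlinarith [abs_nonneg c.im, abs_nonneg u.re]

/-- The squared distance of two unit vectors is `2 - 2 * cos (α - β)`, while `1 - cos (20 * e)` is
about `200 * e ^ 2`. -/
lemma cos_twenty_lt {e : ℝ} (he : 0 < e) (he' : 100 * e ≤ 1) {α β : ℝ}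
    (h : ‖Complex.exp (α * Complex.I) - Complex.exp (β * Complex.I)‖ ≤ e) :
    Real.cos (20 * e) < Real.cos (α - β) := by
  have h1 : ‖Complex.exp (α * Complex.I) - Complex.exp (β * Complex.I)‖ ^ 2 =
      2 - 2 * Real.cos (α - β) := by
    rw [← Complex.normSq_eq_norm_sq, Complex.normSq_apply, Complex.sub_re, Complex.sub_im,
      Complex.exp_ofReal_mul_I_re, Complex.exp_ofReal_mul_I_im, Complex.exp_ofReal_mul_I_re,
      Complex.exp_ofReal_mul_I_im, Real.cos_sub]
    nlinarith [Real.sin_sq_add_cos_sq α, Real.sin_sq_add_cos_sq β]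
  have h2 : ‖Complex.exp (α * Complex.I) - Complex.exp (β * Complex.I)‖ ^ 2 ≤ e ^ 2 :=
    pow_le_pow_left₀ (norm_nonneg _) h 2
  have h3 := Real.cos_bound (x := 20 * e) (by rw [abs_of_pos (by linarith)]; linarith)
  rw [abs_of_pos (show 0 < 20 * e by linarith)] at h3
  have h4 := (abs_le.1 h3).2
  have h5 : e ^ 4 ≤ e ^ 2 / 10000 := by
    have : e ^ 2 ≤ 1 / 10000 := by nlinarith
    nlinarith [sq_nonneg e]
  have h6 : 0 < e ^ 2 := by positivity
  nlinarith

/-- The curve has a tangent to the right at each point, in the strong sense. -/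
theorem IsCurved.exists_direction {ε k : ℝ} (hε : ε = 1 ∨ ε = -1) (hk : 0 < k) {X : ℝ → Vec}
    (hX : IsCurved ε k X) (h0 : X 0 = e₀) : ∃ u : ℂ, ‖u‖ = 1 ∧ ∀ κ > 0, ∃ δ > 0,
      HasDirection X (Set.Ico 0 δ) (tangent u) κ := by
  obtain ⟨u, hu, hlim⟩ := hX.exists_chartDir_lim hε h0
  refine ⟨u, hu, fun κ hκ => ?_⟩
  obtain ⟨κ', hκ'⟩ : ∃ κ', κ' = min κ 1 := ⟨_, rfl⟩
  have hκ0 : 0 < κ' := by rw [hκ']; positivity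
  have hκ1 : κ' ≤ 1 := by rw [hκ']; exact min_le_right _ _
  have hκκ : κ' ≤ κ := by rw [hκ']; exact min_le_left _ _
  -- The cone of `planar_cone` has slope at most `2 * (8 + 33) * e`, which is below `κ'`. With `η =
  -- e / 400` all errors of the chart are small compared to `e`.
  obtain ⟨e, hed⟩ : ∃ e, e = κ' / 100 := ⟨_, rfl⟩
  have he : 0 < e := by rw [hed]; positivity
  have he' : 100 * e ≤ 1 := by rw [hed]; linarith
  obtain ⟨η, hηd⟩ : ∃ η, η = e / 400 := ⟨_, rfl⟩
  have hη0 : 0 < η := by rw [hηd]; positivity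
  have hη : η ≤ 1 / 8 := by rw [hηd]; linarith
  obtain ⟨δ₁, hδ₁, hnear⟩ := hX.near h0 hη0
  obtain ⟨δ₂, hδ₂, hlast⟩ := hX.turn_last 0 he
  obtain ⟨δ₃, hδ₃, hdir⟩ := hlim (e / 4) (by linarith)
  obtain ⟨δ, hδd⟩ : ∃ δ, δ = min (min δ₁ δ₂) (min δ₃ (1 / 2)) := ⟨_, rfl⟩
  have hδ : 0 < δ := by rw [hδd]; positivity
  have hδ1 : δ ≤ δ₁ := by rw [hδd]; exact (min_le_left _ _).trans (min_le_left _ _)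
  have hδ2 : δ ≤ δ₂ := by rw [hδd]; exact (min_le_left _ _).trans (min_le_right _ _)
  have hδ3 : δ ≤ δ₃ := by rw [hδd]; exact (min_le_right _ _).trans (min_le_left _ _)
  have hδ4 : δ ≤ 1 / 2 := by rw [hδd]; exact (min_le_right _ _).trans (min_le_right _ _)
  have hn : ∀ t, 0 ≤ t → t < δ → IsNear ε η (X t) := fun t h1 h2 =>
    hnear t (by rw [abs_of_nonneg h1]; linarith)
  have hne : ∀ s t, 0 ≤ s → s < t → t < δ → X s ≠ X t := fun s t _ h2 h3 =>
    hX.injective s t h2 (by linarith)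
  have hpl : ∀ s t, 0 ≤ s → s < t → t < δ → planar (X t - X s) ≠ 0 := fun s t h1 h2 h3 =>
    (hn s h1 (h2.trans h3)).planar_ne hε hη (hn t (h1.trans h2.le) h3) (hne s t h1 h2 h3)
  have hpl0 : planar (X 0) = 0 := by rw [h0]; apply Complex.ext <;> simp [planar, e₀]
  have huc : ‖(starRingEnd ℂ) u‖ = 1 := by rw [Complex.norm_conj, hu]
  have huu : (starRingEnd ℂ) u * u = 1 := by
    rw [mul_comm, Complex.mul_conj, Complex.normSq_eq_norm_sq, hu]; simp
  -- the angle seen from the base point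
  have hΘ : ∀ x y, 0 < x → x < y → y < δ →
      ‖Complex.exp (turn ε (X 0) (X x) (X y) * Complex.I) -
        (starRingEnd ℂ) u * chartDir (X x) (X y)‖ ≤ e / 4 + 6 * η := by
    intro x y hx hxy hy
    have h1 := norm_exp_turn_sub_le hε hη0.le hη (hn 0 le_rfl hδ) (hn x hx.le (by linarith))
      (hn y (by linarith) hy) (hne 0 x le_rfl hx (by linarith)) (hne x y hx.le hxy hy)
    have h2 : ‖chartDir (X x) (X y) * (starRingEnd ℂ) (chartDir (X 0) (X x)) -
        (starRingEnd ℂ) u * chartDir (X x) (X y)‖ ≤ e / 4 := by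
      have : chartDir (X x) (X y) * (starRingEnd ℂ) (chartDir (X 0) (X x)) -
          (starRingEnd ℂ) u * chartDir (X x) (X y) =
          chartDir (X x) (X y) * (starRingEnd ℂ) (chartDir (X 0) (X x) - u) := by
        rw [map_sub]; ring
      rw [this, norm_mul, norm_chartDir (hpl x y hx.le hxy hy), Complex.norm_conj, one_mul]
      exact hdir x hx (by linarith)
    have h3 := norm_sub_le_norm_sub_add_norm_sub
      (Complex.exp (turn ε (X 0) (X x) (X y) * Complex.I))
      (chartDir (X x) (X y) * (starRingEnd ℂ) (chartDir (X 0) (X x)))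
      ((starRingEnd ℂ) u * chartDir (X x) (X y))
    linarith
  have hB : ∀ y, 0 < y → y < δ → (starRingEnd ℂ) u * planar (X y) ≠ 0 ∧ ∀ χ,
      |normalPart χ ((starRingEnd ℂ) u * planar (X y)) +
      ‖(starRingEnd ℂ) u * planar (X y)‖ * Real.sin χ| ≤
        e * ‖(starRingEnd ℂ) u * planar (X y)‖ := by
    intro y hy hyδ
    have h1 := hpl 0 y le_rfl hy hyδ
    have h2 : planar (X y) = planar (X y - X 0) := by rw [planar_sub, hpl0, sub_zero]
    rw [h2]
    refine ⟨mul_ne_zero (norm_ne_zero_iff.1 (by rw [huc]; norm_num)) h1, fun χ => ?_⟩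
    rw [norm_mul, huc, one_mul]
    have h3 : (starRingEnd ℂ) u * planar (X y - X 0) = (‖planar (X y - X 0)‖ : ℂ) *
        ((starRingEnd ℂ) u * chartDir (X 0) (X y)) := by
      conv_lhs => rw [norm_smul_chartDir]
      ring
    have h4 : normalPart χ 1 = -Real.sin χ := by simp [normalPart]
    have h5 : ‖(starRingEnd ℂ) u * chartDir (X 0) (X y) - 1‖ ≤ e := by
      rw [← huu, ← mul_sub, norm_mul, huc, one_mul]
      linarith [hdir y hy (by linarith)]
    have h6 := (abs_normalPart_le χ _).trans h5
    rw [normalPart_sub, h4] at h6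
    rw [h3, normalPart_real_mul, ← mul_add, abs_mul, abs_of_nonneg (norm_nonneg _), mul_comm]
    refine mul_le_mul_of_nonneg_right ?_ (norm_nonneg _)
    simpa using h6
  -- The chart is rotated so that the initial direction is `1`. The angle assigned to a chord is the
  -- exterior angle at its first point of the broken line coming from the base point.
  have H : ∃ δ' > 0, ∀ s t, 0 < s → s < t → t < δ' →
      normalPart (8 * e) ((starRingEnd ℂ) u * planar (X t) - (starRingEnd ℂ) u * planar (X s)) < 0 ∧
      0 < normalPart (-(33 * e))
        ((starRingEnd ℂ) u * planar (X t) - (starRingEnd ℂ) u * planar (X s)) := by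
    refine planar_cone (z := fun t => (starRingEnd ℂ) u * planar (X t))
      (Θ := fun x y => turn ε (X 0) (X x) (X y)) hδ he he'
      (continuous_const.mul (continuous_planar.comp hX.continuous)) (by simp [hpl0])
      (fun x y => ⟨Complex.neg_pi_lt_arg _, Complex.arg_le_pi _⟩) ?_ hB ?_ ?_ ?_
    · intro x y hx hxy hy
      have h1 := hpl x y hx.le hxy hy
      rw [← mul_sub, ← planar_sub]
      have hu0 : (starRingEnd ℂ) u ≠ 0 := norm_ne_zero_iff.1 (by rw [huc]; norm_num)
      refine ⟨fun h => h1 ?_, fun χ => ?_⟩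
      · have := mul_left_cancel₀ hu0 h
        rw [planar_sub, this, sub_self]
      rw [norm_mul, huc, one_mul]
      have h3 : (starRingEnd ℂ) u * planar (X y - X x) = (‖planar (X y - X x)‖ : ℂ) *
          ((starRingEnd ℂ) u * chartDir (X x) (X y)) := by
        conv_lhs => rw [norm_smul_chartDir]
        ring
      have h5 := hΘ x y hx hxy hy
      rw [norm_sub_rev] at h5
      have h6 := (abs_normalPart_le χ _).trans h5
      rw [normalPart_sub, normalPart_exp] at h6
      rw [h3, normalPart_real_mul, ← mul_sub, abs_mul, abs_of_nonneg (norm_nonneg _), mul_comm]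
      refine mul_le_mul_of_nonneg_right (h6.trans ?_) (norm_nonneg _)
      rw [hηd]; linarith
    -- The angle changes by about one exterior angle, which is at most `π`.
    · intro x y w hx hxy hyw hw
      have h1 := hlast [x] y w (isFine_cons_cons.2 ⟨⟨hx, by linarith⟩,
        isFine_cons_cons.2 ⟨⟨hxy, by linarith⟩, isFine_cons_cons.2 ⟨⟨hyw, by linarith⟩,
        List.isChain_singleton _⟩⟩⟩) (by linarith) (by linarith)
      simp only [List.cons_append, List.nil_append, tripleSum, add_zero] at h1
      have h2 : turn ε (X x) (X y) (X w) ≤ Real.pi := Complex.arg_le_pi _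
      linarith [(abs_lt.1 h1).1]
    -- Almost monotonicity. Along a fine broken line from `0` over `x` and `x + h` to `y - h'` and
    -- `y`, the sum of exterior angles is close to the last angle; dropping the first angle leaves
    -- the sum for the subarc from `x` to `y`, which is positive because the swerve is.
    · intro x y hx hxy hy
      obtain ⟨δM, hδM, hM⟩ := hX.tripleSum_pos hk hxy (by linarith)
      refine ⟨min (min δM δ₂) ((y - x) / 2), lt_min (lt_min hδM hδ₂) (by linarith),
        fun h h' h1 h2 h3 h4 => ?_⟩
      simp only [lt_min_iff] at h2 h4
      obtain ⟨l, hl⟩ := exists_isFine (lt_min hδM hδ₂) (show x + h < y - h' by linarith)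
      have hf : ∀ d, h < d → h' < d → min δM δ₂ ≤ d →
          IsFine d (x :: (x + h) :: (l ++ [y - h', y])) := by
        intro d hd1 hd2 hd
        refine isFine_cons_cons.2 ⟨⟨by linarith, by linarith⟩, ?_⟩
        have : IsFine d (((x + h) :: l) ++ (y - h') :: [y]) :=
          isFine_append.2 ⟨hl.mono hd, ⟨by linarith, by linarith⟩, List.isChain_singleton _⟩
        exact this
      have p1 := hM ((x + h) :: (l ++ [y - h'])) (by
        simpa using hf δM h2.1.1 h4.1.1 (min_le_left _ _))
      have p2 := hlast (x :: (x + h) :: l) (y - h') y (by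
        refine isFine_cons_cons.2 ⟨⟨hx, by linarith⟩, ?_⟩
        exact hf δ₂ h2.1.2 h4.1.2 (min_le_right _ _)) (by linarith) (by linarith)
      simp only [List.cons_append, List.append_assoc, List.nil_append, tripleSum] at p1 p2
      linarith [(abs_lt.1 p2).2]
    · intro x hx hxδ
      obtain ⟨θ, hθ, h⟩ := hX.chartDir_osc hε hη0 hη hδ4
        (fun t ht => hnear t (ht.trans_le hδ1)) hx.le hxδ
      refine ⟨min θ (δ - x), lt_min hθ (by linarith), fun r r' h1 h2 h3 h4 => ?_⟩
      rw [lt_min_iff] at h2 h4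
      refine cos_twenty_lt he he' ?_
      have a1 := hΘ x (x + r) hx (by linarith) (by linarith)
      have a2 := hΘ x (x + r') hx (by linarith) (by linarith)
      have a3 := h r r' h1 h2.1 h3 h4.1
      have a4 : ‖(starRingEnd ℂ) u * chartDir (X x) (X (x + r)) -
          (starRingEnd ℂ) u * chartDir (X x) (X (x + r'))‖ ≤ 19 * η := by
        rw [← mul_sub, norm_mul, huc, one_mul]; exact a3
      have a5 := norm_sub_le_norm_sub_add_norm_sub
        (Complex.exp (turn ε (X 0) (X x) (X (x + r)) * Complex.I))
        ((starRingEnd ℂ) u * chartDir (X x) (X (x + r)))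
        (Complex.exp (turn ε (X 0) (X x) (X (x + r')) * Complex.I))
      have a6 := norm_sub_le_norm_sub_add_norm_sub
        ((starRingEnd ℂ) u * chartDir (X x) (X (x + r)))
        ((starRingEnd ℂ) u * chartDir (X x) (X (x + r')))
        (Complex.exp (turn ε (X 0) (X x) (X (x + r')) * Complex.I))
      rw [norm_sub_rev] at a2
      linarith
  obtain ⟨δ', hδ', hcone⟩ := H
  refine ⟨min δ δ', lt_min hδ hδ', fun s hs t ht hst => ?_⟩
  have htδ := lt_min_iff.1 ht.2
  have hboth : normalPart (8 * e) ((starRingEnd ℂ) u * planar (X t - X s)) < 0 ∧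
      0 < normalPart (-(33 * e)) ((starRingEnd ℂ) u * planar (X t - X s)) := by
    rcases hs.1.eq_or_lt with rfl | hs0
    · obtain ⟨h1, h2⟩ := hB t hst htδ.1
      have hn := norm_pos_iff.2 h1
      rw [planar_sub, hpl0, sub_zero]
      have h3 := abs_le.1 (h2 (8 * e))
      have h4 := abs_le.1 (h2 (-(33 * e)))
      rw [Real.sin_neg] at h4
      have hπ := Real.pi_gt_three
      have h5 := mul_lt_mul_of_pos_left (lt_sin (θ := 8 * e) he (by linarith) (by linarith)) hn
      have h6 := mul_lt_mul_of_pos_left (lt_sin (θ := 33 * e) he (by linarith) (by linarith)) hn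
      constructor <;> linarith
    · have := hcone s t hs0 hst htδ.2
      rwa [← mul_sub, ← planar_sub] at this
  obtain ⟨h1, h2⟩ := narrow_cone (by linarith) (by linarith) (by linarith) hboth.1 hboth.2
  refine ⟨_, h1, ?_⟩
  have h3 := norm_sub_tangent_le hε hη0.le hη (hn s hs.1 (hst.trans htδ.1)) (hn t ht.1 htδ.1) hu
    (κ := κ') hκ1 (by rw [hηd, hed]; linarith) h1 (h2.trans (by
      refine mul_le_mul_of_nonneg_right ?_ h1.le
      rw [hed]; linarith))
  exact h3.trans (mul_le_mul_of_nonneg_right hκκ h1.le)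

/-! ### Arcs seen from a centre equidistant from their end points -/

/-- Take the nearest points to `t` on either side with value at most `v`; by continuity the value
there is exactly `v`. -/
lemma exists_dip {f : ℝ → ℝ} (hf : Continuous f) {s t u v : ℝ} (hst : s < t) (htu : t < u)
    (hs : f s ≤ v) (hu : f u ≤ v) (ht : v < f t) :
    ∃ s' u', s ≤ s' ∧ s' < t ∧ t < u' ∧ u' ≤ u ∧ f s' = v ∧ f u' = v ∧
      ∀ x ∈ Set.Icc s' u', v ≤ f x := by
  have hA : IsClosed (Set.Icc s t ∩ {x | f x ≤ v}) :=
    isClosed_Icc.inter (isClosed_le hf continuous_const)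
  have hB : IsClosed (Set.Icc t u ∩ {x | f x ≤ v}) :=
    isClosed_Icc.inter (isClosed_le hf continuous_const)
  have bA : BddAbove (Set.Icc s t ∩ {x | f x ≤ v}) := ⟨t, fun x hx => hx.1.2⟩
  have bB : BddBelow (Set.Icc t u ∩ {x | f x ≤ v}) := ⟨t, fun x hx => hx.1.1⟩
  have mA := hA.csSup_mem ⟨s, ⟨le_rfl, hst.le⟩, hs⟩ bA
  have mB := hB.csInf_mem ⟨u, ⟨htu.le, le_rfl⟩, hu⟩ bB
  obtain ⟨s', hs'⟩ : ∃ s', s' = sSup (Set.Icc s t ∩ {x | f x ≤ v}) := ⟨_, rfl⟩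
  obtain ⟨u', hu'⟩ : ∃ u', u' = sInf (Set.Icc t u ∩ {x | f x ≤ v}) := ⟨_, rfl⟩
  rw [← hs'] at mA
  rw [← hu'] at mB
  have hs't : s' < t := lt_of_le_of_ne mA.1.2 (by rintro rfl; exact absurd mA.2 (not_le.2 ht))
  have htu' : t < u' := lt_of_le_of_ne mB.1.1 (by rintro rfl; exact absurd mB.2 (not_le.2 ht))
  have h1 : ∀ x, s' < x → x ≤ t → v < f x := fun x h1 h2 => by
    by_contra! h
    have := le_csSup bA ⟨⟨mA.1.1.trans h1.le, h2⟩, h⟩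
    rw [← hs'] at this; linarith
  have h2 : ∀ x, t ≤ x → x < u' → v < f x := fun x h1 h2 => by
    by_contra! h
    have := csInf_le bB ⟨⟨h1, h2.le.trans mB.1.2⟩, h⟩
    rw [← hu'] at this; linarith
  have e1 : f s' = v := by
    refine le_antisymm mA.2 ?_
    have hlim : Filter.Tendsto f (nhdsWithin s' (Set.Ioi s')) (nhds (f s')) :=
      (hf.tendsto s').mono_left nhdsWithin_le_nhds
    refine ge_of_tendsto hlim ?_
    filter_upwards [Ioo_mem_nhdsGT hs't] with x hx using (h1 x hx.1 hx.2.le).le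
  have e2 : f u' = v := by
    refine le_antisymm mB.2 ?_
    have hlim : Filter.Tendsto f (nhdsWithin u' (Set.Iio u')) (nhds (f u')) :=
      (hf.tendsto u').mono_left nhdsWithin_le_nhds
    refine ge_of_tendsto hlim ?_
    filter_upwards [Ioo_mem_nhdsLT htu'] with x hx using (h2 x hx.1.le hx.2).le
  refine ⟨s', u', mA.1.1, hs't, htu', mB.1.2, e1, e2, fun x hx => ?_⟩
  rcases hx.1.eq_or_lt with rfl | h3
  · exact e1.ge
  rcases hx.2.eq_or_lt with rfl | h4
  · exact e2.ge
  rcases le_total x t with h5 | h5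
  · exact (h1 x h3 h5).le
  · exact (h2 x h5 h4).le

/-- An arc outside a circle of radius larger than the radius of the given curvature does not enter
a concentric circle through its end points. -/
theorem IsCurved.no_dip {ε C₀ S₀ : ℝ} (hε : ε = 1 ∨ ε = -1) {X : ℝ → Vec}
    (hX : IsCurved ε (C₀ / S₀) X) (hC₀ : 0 < C₀) (hS₀ : 0 < S₀)
    (hCS : S₀ ^ 2 = ε * (1 - C₀ ^ 2)) {c : Vec} (hc : IsPt ε c) {s u v : ℝ}
    (hu : u < s + 1) {h₀ : ℝ} (hh₀ : 0 < h₀) (hlt : ε * h₀ < ε * C₀)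
    (hpos : ∀ t ∈ Set.Icc s u, 0 < bil ε c (X t))
    (hle : ∀ t ∈ Set.Icc s u, ε * bil ε c (X t) ≤ ε * h₀)
    (hs : ε * bil ε c (X s) ≤ v) (hu' : ε * bil ε c (X u) ≤ v)
    (hdet : ∀ t t', s ≤ t → t < t' → t' ≤ u → 0 < det c (X t) (X t')) {t : ℝ} (hst : s < t)
    (htu : t < u) : ε * bil ε c (X t) ≤ v := by
  by_contra! h
  have hXc := hX.continuous
  obtain ⟨s', u', h1, h2, h3, h4, h5, h6, h7⟩ := exists_dip
    (f := fun t => ε * bil ε c (X t)) (by fun_prop) hst htu hs hu' h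
  have hsub : Set.Icc s' u' ⊆ Set.Icc s u := Set.Icc_subset_Icc h1 h4
  exact hX.no_touch hε hC₀ hS₀ hCS hc (h2.trans h3) (by linarith) hh₀ hlt
    (fun t ht => hpos t (hsub ht)) (fun t ht => hle t (hsub ht))
    (fun t ht => h5.le.trans (h7 t ht)) (fun t ht => h6.le.trans (h7 t ht))
    (fun t t' ht htt' ht' => hdet t t' (h1.trans ht) htt' (ht'.trans h4))

/-- Discs are strictly convex. -/
lemma lt_bil_of_mem_cone {ε : ℝ} (hε : ε = 1 ∨ ε = -1) {c x y z : Vec} (hc : IsPt ε c)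
    (hx : IsPt ε x) (hy : IsPt ε y) (hz : IsPt ε z) (hxy : x ≠ y) {h : ℝ} (hh : 0 < h)
    (hcx : bil ε c x = h) (hcy : bil ε c y = h) {D α β γ : ℝ} (hD : 0 < D) (hα : 0 < α)
    (hβ : 0 < β) (hγ : 0 ≤ γ) (he : D • z = α • x + β • y + γ • c) :
    ε * h < ε * bil ε c z := by
  have h1 : D * bil ε c z = α * h + β * h + γ := by
    have := congrArg (bil ε c) he
    simp only [bil_add_right, bil_smul_right, hcx, hcy, hc.1] at this
    linarith
  have h2 : D ^ 2 = α ^ 2 + β ^ 2 + γ ^ 2 + 2 * α * β * bil ε x y + 2 * γ * (α + β) * h := by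
    have h3 : bil ε (D • z) (D • z) = D ^ 2 := by
      rw [bil_smul_left, bil_smul_right, hz.1]; ring
    rw [← h3, he]
    simp only [bil_add_left, bil_add_right, bil_smul_left, bil_smul_right, hx.1, hy.1, hc.1, hcx, hcy,
      bil_comm ε x c, bil_comm ε y c, bil_comm ε y x]
    ring
  have h3 := bil_lt hε hx hy hxy
  have h4 := bil_le hε hc hx
  rw [hcx] at h4
  have h5 := mul_pos (mul_pos hα hβ) h3
  have h6 := mul_nonneg (mul_nonneg hγ (add_pos hα hβ).le) h4
  -- The squares differ by `2 * α * β * (1 - bil ε x y) + 2 * γ * (α + β) * (1 - h)`, whose sign is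
  -- that of `ε`.
  have h7 : ε * D < ε * (α + β + γ) := by
    have h8 : ε * D ^ 2 < ε * (α + β + γ) ^ 2 := by rw [h2]; linarith
    rcases hε with rfl | rfl
    · have := abs_lt_of_sq_lt_sq (show D ^ 2 < (α + β + γ) ^ 2 by linarith) (by positivity)
      rw [abs_of_pos hD] at this; linarith
    · have := abs_lt_of_sq_lt_sq (show (α + β + γ) ^ 2 < D ^ 2 by linarith) hD.le
      rw [abs_of_pos (by positivity)] at this; linarith
  have h8 : D * (ε * h) < D * (ε * bil ε c z) := by
    have e1 : D * (ε * bil ε c z) = ε * (α * h + β * h + γ) := by rw [← h1]; ring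
    rw [e1]
    have := mul_lt_mul_of_pos_right h7 hh
    have := mul_nonneg hγ h4
    linarith
  exact lt_of_mul_lt_mul_left h8 hD.le

/-- An arc seen from a centre to its left turns to the left of its chord. -/
theorem IsCurved.det_pos_of_center {ε C₀ S₀ : ℝ} (hε : ε = 1 ∨ ε = -1) {X : ℝ → Vec}
    (hX : IsCurved ε (C₀ / S₀) X) (hC₀ : 0 < C₀) (hS₀ : 0 < S₀)
    (hCS : S₀ ^ 2 = ε * (1 - C₀ ^ 2)) {c : Vec} (hc : IsPt ε c) {s u : ℝ}
    (hu : u < s + 1) {h₀ : ℝ} (hh₀ : 0 < h₀) (hlt : ε * h₀ < ε * C₀)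
    (hpos : ∀ t ∈ Set.Icc s u, 0 < bil ε c (X t))
    (hle : ∀ t ∈ Set.Icc s u, ε * bil ε c (X t) ≤ ε * h₀)
    (heq : bil ε c (X u) = bil ε c (X s))
    (hdet : ∀ t t', s ≤ t → t < t' → t' ≤ u → 0 < det c (X t) (X t')) {t : ℝ} (hst : s < t)
    (htu : t < u) : 0 < det (X s) (X t) (X u) := by
  by_contra! hneg
  have h1 := hX.no_dip hε hC₀ hS₀ hCS hc hu hh₀ hlt hpos hle le_rfl (by rw [heq]) hdet hst htu
  -- If `X t` were on the chord or to its left, it would lie in the triangle of `X s`, `X u` and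
  -- `c`, hence be strictly closer to `c` than the ends, which `no_dip` forbids.
  have hd := cramer (X s) (X u) c (X t)
  have d1 := hdet s u le_rfl (hst.trans htu) le_rfl
  have d2 := hdet s t le_rfl hst htu.le
  have d3 := hdet t u hst.le htu le_rfl
  rw [det_rotate] at d1 d2 d3
  have := lt_bil_of_mem_cone hε hc (hX.isPt s) (hX.isPt u) (hX.isPt t)
    (hX.injective s u (hst.trans htu) hu) (hpos s ⟨le_rfl, (hst.trans htu).le⟩) rfl heq d1 d3 d2
    (by rw [det_swap']; linarith) hd
  linarith

/-! ### Local convexity of arcs with nearly constant direction -/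

lemma HasDirection.exists_eq {X : ℝ → Vec} {I : Set ℝ} {v : Vec} {η : ℝ}
    (h : HasDirection X I v η) {s t : ℝ} (hs : s ∈ I) (ht : t ∈ I) (hst : s < t) :
    ∃ a : ℝ, 0 < a ∧ ∃ q, X t - X s = a • q ∧ ‖q - v‖ ≤ η := by
  obtain ⟨a, ha, hq⟩ := h s hs t ht hst
  refine ⟨a, ha, a⁻¹ • (X t - X s), by rw [smul_smul, mul_inv_cancel₀ ha.ne', one_smul], ?_⟩
  have : a⁻¹ • (X t - X s) - v = a⁻¹ • (X t - X s - a • v) := by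
    rw [smul_sub a⁻¹ (X t - X s), smul_smul, inv_mul_cancel₀ ha.ne', one_smul]
  rw [this, norm_smul, norm_inv, Real.norm_eq_abs, abs_of_pos ha, inv_mul_le_iff₀ ha, mul_comm]
  exact hq

lemma HasDirection.mono {X : ℝ → Vec} {I J : Set ℝ} {v : Vec} {η η' : ℝ}
    (h : HasDirection X I v η) (hJ : J ⊆ I) (hη : η ≤ η') : HasDirection X J v η' :=
  fun s hs t ht hst => by
    obtain ⟨a, ha, hq⟩ := h s (hJ hs) t (hJ ht) hst
    exact ⟨a, ha, hq.trans (mul_le_mul_of_nonneg_right hη ha.le)⟩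

/-- The chords of an arc close to `e₀` have directions close to that of `v`. -/
structure IsStraight (X : ℝ → Vec) (I : Set ℝ) (v : Vec) (η : ℝ) : Prop where
  direction : HasDirection X I v η
  near : ∀ t ∈ I, ‖X t - e₀‖ ≤ η

/-- Two radii larger than `R₀`: the one of `h` for the centre, the one of `h₀` as a lower bound for
the distances of nearby points. -/
lemma exists_radius {ε C₀ : ℝ} (hε : ε = 1 ∨ ε = -1) (hC₀ : 0 < C₀) (hC : 0 < ε * (1 - C₀ ^ 2)) :
    ∃ h h₀ s, 0 < h ∧ 0 < h₀ ∧ 0 < s ∧ ε * h < ε * h₀ ∧ ε * h₀ < ε * C₀ ∧ h ^ 2 + ε * s ^ 2 = 1 := by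
  rcases hε with rfl | rfl
  · have h1 : 0 < 1 - (C₀ / 4) ^ 2 := by nlinarith
    refine ⟨C₀ / 4, C₀ / 2, √(1 - (C₀ / 4) ^ 2), by linarith, by linarith, Real.sqrt_pos.2 h1,
      by linarith, by linarith, ?_⟩
    rw [Real.sq_sqrt h1.le]; ring
  · have h1 : 0 < (C₀ + 2) ^ 2 - 1 := by nlinarith
    refine ⟨C₀ + 2, C₀ + 1, √((C₀ + 2) ^ 2 - 1), by linarith, by linarith, Real.sqrt_pos.2 h1,
      by linarith, by linarith, ?_⟩
    rw [Real.sq_sqrt h1.le]; ring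

/-- Centres of circles through the end points of short chords. -/
lemma exists_center {ε h h₀ s : ℝ} (hε : ε = 1 ∨ ε = -1) (hh : 0 < h) (hs : 0 < s)
    (hlt : ε * h < ε * h₀) (hhs : h ^ 2 + ε * s ^ 2 = 1) {u : ℂ} (hu : ‖u‖ = 1) :
    ∃ κ > 0, ∀ q, ‖q - tangent u‖ ≤ κ → ∃ c, IsPt ε c ∧ bil ε c q = 0 ∧
      (∀ x, ‖x - e₀‖ ≤ κ → 0 < bil ε c x ∧ ε * bil ε c x ≤ ε * h₀ ∧
        ∀ q', ‖q' - tangent u‖ ≤ κ → 0 < det c x q') := by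
  have hu2 : u.re ^ 2 + u.im ^ 2 = 1 := by
    have := Complex.normSq_eq_norm_sq u
    rw [hu, Complex.normSq_apply] at this
    linarith
  obtain ⟨v, hv⟩ : ∃ v, v = tangent u := ⟨_, rfl⟩
  -- The point at the prescribed distance from `e₀` on the left normal of the direction `u`.
  obtain ⟨c₀, hc₀⟩ : ∃ c₀ : Vec, c₀ = ![h, -(s * u.im), s * u.re] := ⟨_, rfl⟩
  have h2 := sq_of_sign hε
  have hcc : bil ε c₀ c₀ = 1 := by
    rw [hc₀]; simp [bil]; linear_combination hhs + ε * s ^ 2 * hu2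
  have hvv : bil ε v v = ε := by
    rw [hv]; simp [bil, tangent]; linear_combination ε * hu2
  have hcv : bil ε c₀ v = 0 := by
    rw [hv, hc₀]; simp [bil, tangent]; right; ring
  have hε0 : ε ≠ 0 := by rcases hε with rfl | rfl <;> norm_num
  -- Projects `c₀` to the orthogonal complement of `q`; orthogonality to a chord vector means equal
  -- distances from its ends. After normalization this is continuous at `q = v`, and all required
  -- inequalities are open and hold there.
  obtain ⟨F, hF⟩ : ∃ F : Vec → Vec, F = fun q => c₀ - (bil ε c₀ q / bil ε q q) • q := ⟨_, rfl⟩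
  have hFlim : Filter.Tendsto F (nhds v) (nhds c₀) := by
    have hFc : ContinuousAt F v := by
      rw [hF]
      have h1 : Continuous fun q : Vec => bil ε c₀ q := by fun_prop
      have h3 : Continuous fun q : Vec => bil ε q q := by fun_prop
      exact continuousAt_const.sub ((h1.continuousAt.div h3.continuousAt
        (by rw [hvv]; exact hε0)).smul continuousAt_id)
    have := hFc.tendsto
    have e : F v = c₀ := by rw [hF]; simp [hcv]
    rwa [e] at this
  obtain ⟨Φ, hΦ⟩ : ∃ Φ : Vec → Vec, Φ = fun q => (√(bil ε (F q) (F q)))⁻¹ • F q := ⟨_, rfl⟩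
  have hΦlim : Filter.Tendsto Φ (nhds v) (nhds c₀) := by
    rw [hΦ]
    have h1 := (hFlim.ckBil ε hFlim).sqrt
    rw [hcc, Real.sqrt_one] at h1
    simpa using (h1.inv₀ one_ne_zero).smul hFlim
  have E1 : ∀ᶠ q in nhds v, 0 < bil ε (F q) (F q) := by
    have := hFlim.ckBil ε hFlim
    rw [hcc] at this
    exact this.eventually (lt_mem_nhds one_pos)
  have E0 : ∀ᶠ q in nhds v, bil ε q q ≠ 0 := by
    have h3 : Continuous fun q : Vec => bil ε q q := by fun_prop
    exact h3.continuousAt.eventually_ne (by rw [hvv]; exact hε0)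
  have E2 : ∀ᶠ q in nhds v, 0 < Φ q 0 := by
    have := ((continuous_apply (0 : Fin 3)).tendsto c₀).comp hΦlim
    refine this.eventually (lt_mem_nhds ?_)
    rw [hc₀]; simpa using hh
  have E3 : ∀ᶠ p : Vec × Vec × Vec in nhds (v, e₀, v), 0 < bil ε (Φ p.1) p.2.1 ∧
      ε * bil ε (Φ p.1) p.2.1 < ε * h₀ ∧ 0 < det (Φ p.1) p.2.1 p.2.2 := by
    have t1 : Filter.Tendsto (fun p : Vec × Vec × Vec => Φ p.1) (nhds (v, e₀, v)) (nhds c₀) :=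
      hΦlim.comp (continuous_fst.tendsto _)
    have t2 : Filter.Tendsto (fun p : Vec × Vec × Vec => p.2.1) (nhds (v, e₀, v)) (nhds e₀) :=
      (continuous_fst.comp continuous_snd).tendsto _
    have t3 : Filter.Tendsto (fun p : Vec × Vec × Vec => p.2.2) (nhds (v, e₀, v)) (nhds v) :=
      (continuous_snd.comp continuous_snd).tendsto _
    have b := t1.ckBil ε t2
    have be : bil ε c₀ e₀ = h := by rw [hc₀]; simp [bil, e₀]
    have d := t1.ckDet t2 t3
    have de : det c₀ e₀ v = s := by
      rw [hc₀, hv]; simp [det, e₀, tangent]; linear_combination s * hu2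
    rw [be] at b
    rw [de] at d
    exact (b.eventually (lt_mem_nhds hh)).and (((b.const_mul ε).eventually (gt_mem_nhds hlt)).and
      (d.eventually (lt_mem_nhds hs)))
  obtain ⟨κ₁, hκ₁, H1⟩ := Metric.eventually_nhds_iff.1 ((E1.and E0).and E2)
  obtain ⟨κ₂, hκ₂, H2⟩ := Metric.eventually_nhds_iff.1 E3
  rw [← hv]
  refine ⟨min κ₁ κ₂ / 2, by positivity, fun q hq => ?_⟩
  have hκ : min κ₁ κ₂ / 2 < κ₁ ∧ min κ₁ κ₂ / 2 < κ₂ := by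
    have := lt_min hκ₁ hκ₂
    constructor <;> linarith [min_le_left κ₁ κ₂, min_le_right κ₁ κ₂]
  obtain ⟨⟨hq1, hqq⟩, hq2⟩ := H1 (y := q) (by rw [dist_eq_norm]; linarith)
  refine ⟨Φ q, ⟨?_, fun _ => hq2⟩, ?_, fun x hx => ?_⟩
  · rw [hΦ]
    simp only [bil_smul_left, bil_smul_right]
    have h3 := Real.sqrt_pos.2 hq1
    have h4 := Real.mul_self_sqrt hq1.le
    field_simp
    linarith
  · have h3 : bil ε (F q) q = 0 := by
      rw [hF]
      simp only [bil_sub_left, bil_smul_left]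
      field_simp; ring
    rw [hΦ]
    simp only [bil_smul_left, h3, mul_zero]
  · have key : ∀ q', ‖q' - v‖ ≤ min κ₁ κ₂ / 2 → 0 < bil ε (Φ q) x ∧
        ε * bil ε (Φ q) x < ε * h₀ ∧ 0 < det (Φ q) x q' := fun q' hq' => by
      refine H2 (y := (q, x, q')) ?_
      rw [Prod.dist_eq, max_lt_iff, Prod.dist_eq, max_lt_iff]
      simp only [dist_eq_norm]
      exact ⟨by linarith, by linarith, by linarith⟩
    obtain ⟨k1, k2, -⟩ := key q hq
    exact ⟨k1, k2.le, fun q' hq' => (key q' hq').2.2⟩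

/-- An arc with nearly constant direction is convex. -/
theorem IsCurved.det_pos_of_isStraight {ε C₀ S₀ : ℝ} (hε : ε = 1 ∨ ε = -1) (hC₀ : 0 < C₀)
    (hS₀ : 0 < S₀) (hCS : S₀ ^ 2 = ε * (1 - C₀ ^ 2)) {u : ℂ} (hu : ‖u‖ = 1) :
    ∃ κ > 0, ∀ (X : ℝ → Vec) (I : Set ℝ), IsCurved ε (C₀ / S₀) X → I.OrdConnected →
      (∀ s ∈ I, ∀ t ∈ I, t < s + 1) → IsStraight X I (tangent u) κ →
      ∀ s ∈ I, ∀ t, ∀ w ∈ I, s < t → t < w → 0 < det (X s) (X t) (X w) := by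
  obtain ⟨h, h₀, s, hh, hh₀, hs, hlt, hlt', hhs⟩ := exists_radius hε hC₀
    (hCS ▸ (by positivity : 0 < S₀ ^ 2))
  obtain ⟨κ, hκ, H⟩ := exists_center hε hh hs hlt hhs hu
  refine ⟨κ, hκ, fun X I hX hI hdiam hstr s hs t w hw hst htw => ?_⟩
  have hsub : ∀ x, s ≤ x → x ≤ w → x ∈ I := fun x h1 h2 => hI.out hs hw ⟨h1, h2⟩
  obtain ⟨a, ha, q, hq, hqv⟩ := hstr.direction.exists_eq hs hw (hst.trans htw)
  obtain ⟨c, hc, hcq, hx⟩ := H q hqv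
  refine hX.det_pos_of_center hε hC₀ hS₀ hCS hc (hdiam s hs w hw) hh₀ hlt'
    (fun x hx' => (hx (X x) (hstr.near x (hsub x hx'.1 hx'.2))).1)
    (fun x hx' => (hx (X x) (hstr.near x (hsub x hx'.1 hx'.2))).2.1) ?_ ?_ hst htw
  · have := congrArg (bil ε c) hq
    rw [bil_sub_right, bil_smul_right, hcq, mul_zero] at this
    linarith
  · intro x y h1 h2 h3
    obtain ⟨b, hb, q', hq', hqv'⟩ := hstr.direction.exists_eq (hsub x h1 (by linarith))
      (hsub y (by linarith) h3) h2
    have h4 := (hx (X x) (hstr.near x (hsub x h1 (by linarith)))).2.2 q' hqv'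
    have h5 := congrArg (det c (X x)) hq'
    rw [det_sub_right, det_smul_right, det_self_right, sub_zero] at h5
    rw [h5]; positivity

/-! ### Two-sided local convexity -/

/-- The complex number whose argument is the exterior angle at `y` between the vectors
`q` and `q'`. -/
def turnG (ε : ℝ) (y q q' : Vec) : ℂ := ⟨ε * (bil ε q q' - bil ε q y * bil ε y q'), det y q q'⟩

lemma turn_eq_arg {ε : ℝ} {x y w q q' : Vec} {a b : ℝ} (hy : IsPt ε y) (ha : 0 < a) (hb : 0 < b)
    (hxy : y - x = a • q) (hyw : w - y = b • q') : turn ε x y w = (turnG ε y q q').arg := by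
  have hx : x = y - a • q := by rw [← hxy]; abel
  have hw : w = y + b • q' := by rw [← hyw]; abel
  have e : turnC ε x y w = ((a * b : ℝ) : ℂ) * turnG ε y q q' := by
    apply Complex.ext
    · rw [hx, hw]
      simp only [turnC, turnG, Complex.mul_re, Complex.ofReal_re, Complex.ofReal_im, bil_sub_left,
        bil_add_right, bil_smul_left, bil_smul_right, hy.1]
      ring
    · rw [hx, hw]
      simp only [turnC, turnG, Complex.mul_im, Complex.ofReal_re, Complex.ofReal_im, det,
        Pi.add_apply, Pi.sub_apply, Pi.smul_apply, smul_eq_mul]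
      ring
  rw [turn, e, Complex.arg_real_mul _ (mul_pos ha hb)]

/-- By continuity, since at `e₀` with tangent vectors the expression is the quotient of the two
planar directions. -/
lemma exists_turnG_near {ε : ℝ} (hε : ε = 1 ∨ ε = -1) {u u' : ℂ} {P : ℂ → Prop}
    (h : ∀ᶠ z in nhds ((starRingEnd ℂ) u * u'), P z) : ∃ κ > 0, ∀ y q q', ‖y - e₀‖ ≤ κ →
      ‖q - tangent u‖ ≤ κ → ‖q' - tangent u'‖ ≤ κ → P (turnG ε y q q') := by
  have hG : Continuous fun p : Vec × Vec × Vec => turnG ε p.1 p.2.1 p.2.2 := by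
    have : (fun p : Vec × Vec × Vec => turnG ε p.1 p.2.1 p.2.2) = fun p =>
        ((ε * (bil ε p.2.1 p.2.2 - bil ε p.2.1 p.1 * bil ε p.1 p.2.2) : ℝ) : ℂ) +
        ((det p.1 p.2.1 p.2.2 : ℝ) : ℂ) * Complex.I := by
      funext p; apply Complex.ext <;> simp [turnG]
    rw [this]
    refine (Complex.continuous_ofReal.comp ?_).add
      ((Complex.continuous_ofReal.comp ?_).mul continuous_const) <;> fun_prop
  have h2 := sq_of_sign hε
  have e : turnG ε e₀ (tangent u) (tangent u') = (starRingEnd ℂ) u * u' := by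
    apply Complex.ext
    · simp [turnG, tangent, e₀, bil]
      linear_combination (u.re * u'.re + u.im * u'.im) * h2
    · simp [turnG, tangent, e₀, det]; ring
  have h3 := hG.continuousAt (x := (e₀, tangent u, tangent u'))
  rw [ContinuousAt] at h3
  simp only [e] at h3
  obtain ⟨κ, hκ, H⟩ := Metric.eventually_nhds_iff.1 (h3.eventually h)
  refine ⟨κ / 2, by linarith, fun y q q' h1 h2 h3 => H (y := (y, q, q')) ?_⟩
  rw [Prod.dist_eq, max_lt_iff, Prod.dist_eq, max_lt_iff]
  simp only [dist_eq_norm]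
  exact ⟨by linarith, by linarith, by linarith⟩

lemma exists_abs_turn_lt {ε : ℝ} (hε : ε = 1 ∨ ε = -1) {u : ℂ} (hu : ‖u‖ = 1) {e : ℝ}
    (he : 0 < e) : ∃ κ > 0, ∀ (X : ℝ → Vec) (I : Set ℝ), (∀ t, IsPt ε (X t)) →
      IsStraight X I (tangent u) κ → ∀ s ∈ I, ∀ t ∈ I, ∀ w ∈ I, s < t → t < w →
      |turn ε (X s) (X t) (X w)| < e := by
  have huu : (starRingEnd ℂ) u * u = 1 := by
    rw [mul_comm, Complex.mul_conj, Complex.normSq_eq_norm_sq, hu]; simp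
  have h : ∀ᶠ z in nhds ((starRingEnd ℂ) u * u), |z.arg| < e := by
    have h1 : ContinuousAt (fun z : ℂ => |z.arg|) 1 :=
      (Complex.continuousAt_arg Complex.one_mem_slitPlane).abs
    rw [huu]
    exact h1.eventually (gt_mem_nhds (by simpa using he))
  obtain ⟨κ, hκ, H⟩ := exists_turnG_near hε h
  refine ⟨κ, hκ, fun X I hpt hI s hs t ht w hw hst htw => ?_⟩
  obtain ⟨a, ha, q, hq, hqv⟩ := hI.direction.exists_eq hs ht hst
  obtain ⟨b, hb, q', hq', hqv'⟩ := hI.direction.exists_eq ht hw htw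
  rw [turn_eq_arg (hpt t) ha hb hq hq']
  exact H _ _ _ (hI.near t ht) hqv hqv'

lemma IsCurved.exists_isStraight {ε k : ℝ} (hε : ε = 1 ∨ ε = -1) (hk : 0 < k) {X : ℝ → Vec}
    (hX : IsCurved ε k X) (h0 : X 0 = e₀) : ∃ u : ℂ, ‖u‖ = 1 ∧ ∀ κ > 0, ∃ δ > 0,
      δ ≤ 1 / 2 ∧ IsStraight X (Set.Ico 0 δ) (tangent u) κ := by
  obtain ⟨u, hu, H⟩ := hX.exists_direction hε hk h0
  refine ⟨u, hu, fun κ hκ => ?_⟩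
  obtain ⟨δ, hδ, h⟩ := H κ hκ
  obtain ⟨δ', hδ', h'⟩ := Metric.continuousAt_iff.1 (hX.continuous.continuousAt (x := 0)) κ hκ
  refine ⟨min (min δ δ') (1 / 2), by positivity, min_le_right _ _, ?_, fun t ht => ?_⟩
  · exact h.mono (Set.Ico_subset_Ico_right ((min_le_left _ _).trans (min_le_left _ _))) le_rfl
  · have := h' (x := t) (by
      rw [Real.dist_eq, sub_zero, abs_of_nonneg ht.1]
      exact ht.2.trans_le ((min_le_left _ _).trans (min_le_right _ _)))
    rw [dist_eq_norm, h0] at this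
    exact this.le

lemma mirror_e₀ : mirror e₀ = e₀ := by ext i; fin_cases i <;> simp [mirror, e₀]

/-- At no point the curve turns to the right. -/
lemma IsCurved.exists_turn_gt {ε k : ℝ} (hε : ε = 1 ∨ ε = -1) (hk : 0 < k) {X : ℝ → Vec}
    (hX : IsCurved ε k X) (h0 : X 0 = e₀) {e δ : ℝ} (he : 0 < e) (hδ : 0 < δ) :
    ∃ r, 0 < r ∧ r < δ ∧ -e < turn ε (X (-r)) (X 0) (X r) := by
  have one : ∀ Y : ℝ → Vec, IsCurved ε k Y → Y 0 = e₀ → ∃ ρ > 0, ρ ≤ 1 / 4 ∧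
      ∀ (l : List ℝ) (y w : ℝ), IsFine ρ (0 :: (l ++ [y, w])) → 0 < y → y < w → w < ρ →
      tripleSum (fun p q r => turn ε (Y p) (Y q) (Y r)) (0 :: (l ++ [y, w])) < e / 2 := by
    intro Y hY hY0
    obtain ⟨u, hu, hs⟩ := hY.exists_isStraight hε hk hY0
    obtain ⟨κ, hκ, hsmall⟩ := exists_abs_turn_lt hε hu (show 0 < e / 4 by linarith)
    obtain ⟨δ₁, hδ₁, -, hs⟩ := hs κ hκ
    obtain ⟨δ₂, hδ₂, hl⟩ := hY.turn_last 0 (show 0 < e / 4 by linarith)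
    refine ⟨min (min δ₁ δ₂) (1 / 4), by positivity, min_le_right _ _,
      fun l y w hf hy hyw hw => ?_⟩
    have h1 : min (min δ₁ δ₂) (1 / 4) ≤ δ₁ := (min_le_left _ _).trans (min_le_left _ _)
    have h2 : min (min δ₁ δ₂) (1 / 4) ≤ δ₂ := (min_le_left _ _).trans (min_le_right _ _)
    have h3 := hsmall Y _ hY.isPt hs 0 ⟨le_rfl, hδ₁⟩ y ⟨hy.le, by linarith⟩ w
      ⟨by linarith, by linarith⟩ hy hyw
    have h4 := hl l y w (hf.mono h2) hy (by linarith)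
    linarith [(abs_lt.1 h3).2, (abs_lt.1 h4).2]
  obtain ⟨ρ₁, hρ₁, hq₁, H1⟩ := one X hX h0
  obtain ⟨ρ₂, hρ₂, hq₂, H2⟩ := one _ hX.mirror (by
    show CayleyKlein.mirror (X (-0)) = e₀
    rw [neg_zero, h0, mirror_e₀])
  obtain ⟨r₀, hr₀, hr₀'⟩ := exists_between (lt_min hρ₁ hρ₂)
  rw [lt_min_iff] at hr₀'
  obtain ⟨δp, hδp, hpos⟩ := hX.tripleSum_pos hk (show -r₀ < r₀ by linarith) (by linarith)
  obtain ⟨r₁, hr₁, hr₁'⟩ := exists_between (lt_min hδ (lt_min (lt_min hδp (half_pos hr₀))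
    (lt_min hρ₁ hρ₂)))
  simp only [lt_min_iff] at hr₁'
  -- The first and last gaps of the line on `[0, r₀]` are both `r₁`. Together with its mirror image
  -- it forms a fine symmetric line on `[-r₀, r₀]`, whose total turning is positive. Each half
  -- contributes less than `e / 2`, so the angle at `0` is above `-e`.
  obtain ⟨r₂, hr₂⟩ : ∃ r₂, r₂ = r₀ - r₁ := ⟨_, rfl⟩
  obtain ⟨d, hd, hd'⟩ : ∃ d, r₁ < d ∧ d ≤ min δp (min ρ₁ ρ₂) :=
    ⟨_, by simp only [lt_min_iff]; exact ⟨hr₁'.2.1.1, hr₁'.2.2⟩, le_rfl⟩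
  simp only [le_min_iff] at hd'
  obtain ⟨l, hl⟩ := exists_isFine (show 0 < d by linarith) (show r₁ < r₂ by linarith)
  have hN : IsFine d (0 :: r₁ :: (l ++ [r₂, r₀])) := by
    refine isFine_cons_cons.2 ⟨⟨hr₁, by linarith⟩, ?_⟩
    have : IsFine d ((r₁ :: l) ++ r₂ :: [r₀]) :=
      isFine_append.2 ⟨hl, ⟨by linarith, by linarith⟩, List.isChain_singleton _⟩
    exact this
  have s1 := H1 (r₁ :: l) r₂ r₀ (hN.mono hd'.2.1) (by linarith) (by linarith) hr₀'.1
  have s2 := H2 (r₁ :: l) r₂ r₀ (hN.mono hd'.2.2) (by linarith) (by linarith) hr₀'.2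
  obtain ⟨M, hM⟩ : ∃ M, M = l ++ [r₂, r₀] := ⟨_, rfl⟩
  simp only [List.cons_append] at s1 s2
  rw [← hM] at s1 s2 hN
  have hneg := (isFine_cons_cons.1 hN).2.reverse_neg
  have hF : IsFine d ((M.reverse.map fun x => -x) ++ (-r₁) :: 0 :: r₁ :: M) := by
    refine isFine_append.2 ⟨?_, ⟨by linarith, by linarith⟩, hN⟩
    simpa using hneg
  have hF' : (M.reverse.map fun x => -x) ++ (-r₁) :: 0 :: r₁ :: M =
      -r₀ :: ((((l ++ [r₂]).reverse.map fun x => -x) ++ (-r₁) :: 0 :: r₁ :: (l ++ [r₂])) ++ [r₀]) := by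
    rw [hM]; simp
  have hp := hpos _ (hF' ▸ hF.mono hd'.1)
  rw [← hF', tripleSum_append] at hp
  have e2 : tripleSum (fun p q r => turn ε (X p) (X q) (X r)) ((M.reverse.map fun x => -x) ++ [-r₁, 0]) =
      tripleSum (fun p q r => turn ε (CayleyKlein.mirror (X (-p))) (CayleyKlein.mirror (X (-q)))
        (CayleyKlein.mirror (X (-r)))) (0 :: r₁ :: M) := by
    have : (M.reverse.map fun x => -x) ++ [-r₁, 0] =
        ((0 :: r₁ :: M).reverse.map fun x => -x) := by simp
    rw [this, tripleSum_map, tripleSum_reverse]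
    exact tripleSum_congr (fun a b c => (turn_mirror ε _ _ _).symm) _
  rw [e2] at hp
  rw [show tripleSum (fun p q r => turn ε (X p) (X q) (X r)) (-r₁ :: 0 :: r₁ :: M) =
    turn ε (X (-r₁)) (X 0) (X r₁) +
      tripleSum (fun p q r => turn ε (X p) (X q) (X r)) (0 :: r₁ :: M) from rfl] at hp
  exact ⟨r₁, hr₁, hr₁'.1, by linarith⟩

/-- The right tangent of the reflected and reversed curve; undoing both operations sends the
direction `u` to minus its conjugate. -/
lemma IsCurved.exists_isStraight_left {ε k : ℝ} (hε : ε = 1 ∨ ε = -1) (hk : 0 < k) {X : ℝ → Vec}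
    (hX : IsCurved ε k X) (h0 : X 0 = e₀) : ∃ u : ℂ, ‖u‖ = 1 ∧ ∀ κ > 0, ∃ δ > 0,
      δ ≤ 1 / 2 ∧ IsStraight X (Set.Ioc (-δ) 0) (tangent u) κ := by
  obtain ⟨u, hu, H⟩ := hX.mirror.exists_isStraight hε hk (by
    show CayleyKlein.mirror (X (-0)) = e₀
    rw [neg_zero, h0, mirror_e₀])
  have hn : ∀ x : Vec, ‖CayleyKlein.mirror x‖ ≤ ‖x‖ := fun x => by
    refine (pi_norm_le_iff_of_nonneg (norm_nonneg _)).2 fun i => ?_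
    fin_cases i
    · simpa [CayleyKlein.mirror] using norm_le_pi_norm x 0
    · simpa [CayleyKlein.mirror] using norm_le_pi_norm x 1
    · simpa [CayleyKlein.mirror] using norm_le_pi_norm x 2
  refine ⟨-(starRingEnd ℂ) u, by rw [norm_neg, Complex.norm_conj, hu], fun κ hκ => ?_⟩
  obtain ⟨δ, hδ, hδ', h⟩ := H κ hκ
  refine ⟨δ, hδ, hδ', fun s hs t ht hst => ?_, fun t ht => ?_⟩
  · obtain ⟨a, ha, hq⟩ := h.direction (-t) ⟨by linarith [ht.2], by linarith [ht.1]⟩ (-s)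
      ⟨by linarith [hs.2], by linarith [hs.1]⟩ (by linarith)
    refine ⟨a, ha, ?_⟩
    have e : X t - X s - a • tangent (-(starRingEnd ℂ) u) =
        -CayleyKlein.mirror (CayleyKlein.mirror (X (- -s)) - CayleyKlein.mirror (X (- -t)) - a • tangent u) := by
      rw [neg_neg, neg_neg]
      ext i; fin_cases i <;> simp [CayleyKlein.mirror, tangent] <;> ring
    rw [e, norm_neg]
    exact (hn _).trans hq
  · have h1 := h.near (-t) ⟨by linarith [ht.2], by linarith [ht.1]⟩
    have e : X t - e₀ = CayleyKlein.mirror (CayleyKlein.mirror (X (- -t)) - e₀) := by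
      rw [neg_neg]
      ext i; fin_cases i <;> simp [CayleyKlein.mirror, e₀]
    rw [e]
    exact (hn _).trans h1

/-- Coordinates of points of a straight arc starting at `e₀`. -/
lemma planar_of_near {u : ℂ} (hu : ‖u‖ = 1) {x q : Vec} {a κ : ℝ} (ha : 0 < a) (hκ : κ ≤ 1 / 4)
    (hx : x - e₀ = a • q) (hq : ‖q - tangent u‖ ≤ κ) :
    0 < ((starRingEnd ℂ) u * planar x).re ∧ |((starRingEnd ℂ) u * planar x).im| ≤
      4 * κ * ((starRingEnd ℂ) u * planar x).re := by
  have huu : (starRingEnd ℂ) u * u = 1 := by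
    rw [mul_comm, Complex.mul_conj, Complex.normSq_eq_norm_sq, hu]; simp
  have h1 : planar x = (a : ℂ) * (u + planar (q - tangent u)) := by
    have e1 := congrFun hx 1
    have e2 := congrFun hx 2
    apply Complex.ext
    · simp [e₀] at e1; simp [planar, tangent, e1]
    · simp [e₀] at e2; simp [planar, tangent, e2]
  obtain ⟨d, hd⟩ : ∃ d, d = (starRingEnd ℂ) u * planar (q - tangent u) := ⟨_, rfl⟩
  have h2 : (starRingEnd ℂ) u * planar x = (a : ℂ) * (1 + d) := by
    rw [h1, hd, ← huu]; ring
  have h3 : ‖d‖ ≤ 2 * κ := by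
    rw [hd, norm_mul, Complex.norm_conj, hu, one_mul]
    have h4 := Complex.norm_le_abs_re_add_abs_im (planar (q - tangent u))
    have h5 := (norm_le_pi_norm (q - tangent u) 1).trans hq
    have h6 := (norm_le_pi_norm (q - tangent u) 2).trans hq
    rw [Real.norm_eq_abs] at h5 h6
    simp only [planar] at h4 ⊢
    linarith
  have h4 := abs_le.1 ((Complex.abs_re_le_norm d).trans h3)
  have h5 := (Complex.abs_im_le_norm d).trans h3
  have hκ0 : 0 ≤ κ := (norm_nonneg _).trans hq
  rw [h2]
  simp only [Complex.mul_re, Complex.mul_im, Complex.ofReal_re, Complex.ofReal_im, Complex.add_re,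
    Complex.add_im, Complex.one_re, Complex.one_im, zero_mul, sub_zero, zero_add, add_zero]
  have h6 : 1 / 2 ≤ 1 + d.re := by linarith
  refine ⟨by positivity, ?_⟩
  rw [abs_mul, abs_of_pos ha]
  have : |d.im| ≤ 4 * κ * (1 + d.re) := by nlinarith
  calc a * |d.im| ≤ a * (4 * κ * (1 + d.re)) := mul_le_mul_of_nonneg_left this ha.le
    _ = _ := by ring

lemma det_e₀ {u : ℂ} (hu : ‖u‖ = 1) (x y : Vec) : det e₀ x y =
    ((starRingEnd ℂ) u * planar x).re * ((starRingEnd ℂ) u * planar y).im -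
    ((starRingEnd ℂ) u * planar x).im * ((starRingEnd ℂ) u * planar y).re := by
  have hu2 : u.re ^ 2 + u.im ^ 2 = 1 := by
    have := Complex.normSq_eq_norm_sq u
    rw [hu, Complex.normSq_apply] at this
    linarith
  simp only [det, e₀, planar, Complex.mul_re, Complex.mul_im, Complex.conj_re, Complex.conj_im,
    Matrix.cons_val]
  linear_combination (-(x 1 * y 2 - x 2 * y 1)) * hu2

/-- If the two tangents at `e₀` are opposite, the curve turns to the right there. -/
lemma det_neg_of_cusp {X : ℝ → Vec} {u : ℂ} (hu : ‖u‖ = 1) (h0 : X 0 = e₀) {δ : ℝ}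
    (hR : ∀ κ > 0, ∃ δ > 0, IsStraight X (Set.Ico 0 δ) (tangent u) κ)
    (hL : ∀ κ > 0, ∃ δ > 0, IsStraight X (Set.Ioc (-δ) 0) (tangent (-u)) κ)
    (hcR : ∀ s ∈ Set.Ico 0 δ, ∀ t, ∀ w ∈ Set.Ico 0 δ, s < t → t < w → 0 < det (X s) (X t) (X w))
    (hcL : ∀ s ∈ Set.Ioc (-δ) 0, ∀ t, ∀ w ∈ Set.Ioc (-δ) 0, s < t → t < w →
      0 < det (X s) (X t) (X w)) :
    ∃ δ' > 0, ∀ r, 0 < r → r < δ' → r < δ → det (X (-r)) (X 0) (X r) < 0 := by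
  obtain ⟨P, hP⟩ : ∃ P : ℝ → ℂ, P = fun t => (starRingEnd ℂ) u * planar (X t) := ⟨_, rfl⟩
  have hdet : ∀ s t, det e₀ (X s) (X t) = (P s).re * (P t).im - (P s).im * (P t).re := fun s t => by
    rw [hP]; exact det_e₀ hu _ _
  have hr : ∀ κ, 0 < κ → κ ≤ 1 / 4 → ∃ δ' > 0, ∀ t, 0 < t → t < δ' →
      0 < (P t).re ∧ |(P t).im| ≤ 4 * κ * (P t).re := by
    intro κ h1 h2
    obtain ⟨δ', hδ', h⟩ := hR κ h1
    refine ⟨δ', hδ', fun t ht ht' => ?_⟩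
    obtain ⟨a, ha, q, hq, hq'⟩ := h.direction.exists_eq ⟨le_rfl, hδ'⟩ ⟨ht.le, ht'⟩ ht
    rw [h0] at hq
    rw [hP]; exact planar_of_near hu ha h2 hq hq'
  have hl : ∀ κ, 0 < κ → κ ≤ 1 / 4 → ∃ δ' > 0, ∀ t, 0 < t → t < δ' →
      0 < (P (-t)).re ∧ |(P (-t)).im| ≤ 4 * κ * (P (-t)).re := by
    intro κ h1 h2
    obtain ⟨δ', hδ', h⟩ := hL κ h1
    refine ⟨δ', hδ', fun t ht ht' => ?_⟩
    obtain ⟨a, ha, q, hq, hq'⟩ := h.direction.exists_eq (s := -t) (t := 0)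
      ⟨by linarith, by linarith⟩ ⟨by linarith, le_rfl⟩ (by linarith)
    rw [h0] at hq
    rw [hP]
    refine planar_of_near hu ha (q := -q) h2 ?_ ?_
    · rw [smul_neg, ← hq, neg_sub]
    · have h3 : tangent (-u) = -tangent u := by
        ext i; fin_cases i <;> simp [tangent]
      have : -q - tangent u = -(q - tangent (-u)) := by rw [h3]; abel
      rw [this, norm_neg]; exact hq'
  obtain ⟨δ₁, hδ₁, hr1⟩ := hr (1 / 4) (by norm_num) le_rfl
  obtain ⟨δ₂, hδ₂, hl1⟩ := hl (1 / 4) (by norm_num) le_rfl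
  refine ⟨min δ₁ δ₂, lt_min hδ₁ hδ₂, fun r hr0 hrm hrδ => ?_⟩
  rw [lt_min_iff] at hrm
  -- The curve leaves `e₀` tangentially to the positive axis and is convex to the left, so it runs
  -- above the axis: first weakly by letting an intermediate point tend to `e₀`, then strictly by
  -- one more convex triple. The incoming branch is treated in the same way and runs below.
  have hRpos : 0 < (P r).im := by
    have key : 0 ≤ (P (r / 2)).im := by
      by_contra! hneg
      have hρ := (hr1 (r / 2) (by linarith) (by linarith)).1
      obtain ⟨κ, hκ⟩ : ∃ κ, κ = min (1 / 4) (-(P (r / 2)).im / (4 * (P (r / 2)).re)) := ⟨_, rfl⟩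
      have hκ0 : 0 < κ := by
        rw [hκ]; exact lt_min (by norm_num) (div_pos (by linarith) (by linarith))
      have hκ1 : κ * (4 * (P (r / 2)).re) ≤ -(P (r / 2)).im := by
        rw [← le_div_iff₀ (by linarith), hκ]; exact min_le_right _ _
      obtain ⟨δ', hδ', h⟩ := hr κ hκ0 (by rw [hκ]; exact min_le_left _ _)
      obtain ⟨t, ht, ht'⟩ := exists_between (lt_min hδ' (half_pos hr0))
      rw [lt_min_iff] at ht'
      obtain ⟨h1, h2⟩ := h t ht ht'.1
      have h3 := hcR 0 ⟨le_rfl, by linarith⟩ t (r / 2) ⟨by linarith, by linarith⟩ ht ht'.2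
      rw [h0, hdet] at h3
      have h4 := (abs_le.1 h2).1
      nlinarith [mul_le_mul_of_nonneg_right h4 hρ.le, mul_le_mul_of_nonneg_right hκ1 h1.le]
    have h3 := hcR 0 ⟨le_rfl, by linarith⟩ (r / 2) r ⟨by linarith, by linarith⟩ (by linarith)
      (by linarith)
    rw [h0, hdet] at h3
    have h1 := (hr1 (r / 2) (by linarith) (by linarith)).1
    have h2 := (hr1 r (by linarith) (by linarith)).1
    by_contra! h
    nlinarith [mul_nonneg key h2.le]
  have hLneg : (P (-r)).im < 0 := by
    have key : (P (-(r / 2))).im ≤ 0 := by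
      by_contra! hneg
      have hρ := (hl1 (r / 2) (by linarith) (by linarith)).1
      obtain ⟨κ, hκ⟩ : ∃ κ, κ = min (1 / 4) ((P (-(r / 2))).im / (4 * (P (-(r / 2))).re)) :=
        ⟨_, rfl⟩
      have hκ0 : 0 < κ := by
        rw [hκ]; exact lt_min (by norm_num) (div_pos (by linarith) (by linarith))
      have hκ1 : κ * (4 * (P (-(r / 2))).re) ≤ (P (-(r / 2))).im := by
        rw [← le_div_iff₀ (by linarith), hκ]; exact min_le_right _ _
      obtain ⟨δ', hδ', h⟩ := hl κ hκ0 (by rw [hκ]; exact min_le_left _ _)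
      obtain ⟨t, ht, ht'⟩ := exists_between (lt_min hδ' (half_pos hr0))
      rw [lt_min_iff] at ht'
      obtain ⟨h1, h2⟩ := h t ht ht'.1
      have h3 := hcL (-(r / 2)) ⟨by linarith, by linarith⟩ (-t) 0 ⟨by linarith, by linarith⟩
        (by linarith) (by linarith)
      rw [h0, det_cycle, hdet] at h3
      have h4 := (abs_le.1 h2).2
      nlinarith [mul_le_mul_of_nonneg_right h4 hρ.le, mul_le_mul_of_nonneg_right hκ1 h1.le]
    have h3 := hcL (-r) ⟨by linarith, by linarith⟩ (-(r / 2)) 0 ⟨by linarith, by linarith⟩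
      (by linarith) (by linarith)
    rw [h0, det_cycle, hdet] at h3
    have h1 := (hl1 (r / 2) (by linarith) (by linarith)).1
    have h2 := (hl1 r (by linarith) (by linarith)).1
    by_contra! h
    nlinarith [mul_nonneg h h1.le]
  have h1 := (hr1 r hr0 hrm.1).1
  have h2 := (hl1 r hr0 hrm.2).1
  rw [h0, det_swap, hdet]
  nlinarith [mul_pos h2 hRpos, mul_pos h1 (neg_pos.2 hLneg)]

/-- A curved curve is locally convex. -/
theorem IsCurved.det_pos_near_zero {ε C₀ S₀ : ℝ} (hε : ε = 1 ∨ ε = -1) (hC₀ : 0 < C₀)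
    (hS₀ : 0 < S₀) (hCS : S₀ ^ 2 = ε * (1 - C₀ ^ 2)) {X : ℝ → Vec} (hX : IsCurved ε (C₀ / S₀) X)
    (h0 : X 0 = e₀) : ∃ ρ > 0, ∀ s t w, -ρ < s → s < t → t < w → w < ρ →
      0 < det (X s) (X t) (X w) := by
  have hk : 0 < C₀ / S₀ := by positivity
  obtain ⟨u, hu, hR⟩ := hX.exists_isStraight hε hk h0
  obtain ⟨v, hv, hL⟩ := hX.exists_isStraight_left hε hk h0
  obtain ⟨κR, hκR, HR⟩ := IsCurved.det_pos_of_isStraight hε hC₀ hS₀ hCS hu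
  obtain ⟨κL, hκL, HL⟩ := IsCurved.det_pos_of_isStraight hε hC₀ hS₀ hCS hv
  obtain ⟨δR, hδR, hδR1, sR⟩ := hR κR hκR
  obtain ⟨δL, hδL, hδL1, sL⟩ := hL κL hκL
  have cR := HR X _ hX Set.ordConnected_Ico
    (fun s hs t ht => by linarith [hs.1, ht.2]) sR
  have cL := HL X _ hX Set.ordConnected_Ioc
    (fun s hs t ht => by linarith [hs.1, ht.2]) sL
  have hturn : ∀ P : ℂ → Prop, (∀ᶠ z in nhds ((starRingEnd ℂ) v * u), P z) →
      ∃ δ > 0, ∀ r, 0 < r → r < δ → ∃ z, P z ∧ turn ε (X (-r)) (X 0) (X r) = z.arg ∧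
        ∃ b > 0, det (X (-r)) (X 0) (X r) = b * z.im := by
    intro P hP
    obtain ⟨κ, hκ, H⟩ := exists_turnG_near hε hP
    obtain ⟨δ₁, hδ₁, -, h1⟩ := hR κ hκ
    obtain ⟨δ₂, hδ₂, -, h2⟩ := hL κ hκ
    refine ⟨min δ₁ δ₂, lt_min hδ₁ hδ₂, fun r hr hr' => ?_⟩
    rw [lt_min_iff] at hr'
    obtain ⟨a, ha, q, hq, hqv⟩ := h2.direction.exists_eq (s := -r) (t := 0)
      ⟨by linarith, by linarith⟩ ⟨by linarith, le_rfl⟩ (by linarith)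
    obtain ⟨b, hb, q', hq', hqv'⟩ := h1.direction.exists_eq (s := 0) (t := r)
      ⟨le_rfl, hδ₁⟩ ⟨hr.le, hr'.1⟩ hr
    refine ⟨_, H _ _ _ (h1.near 0 ⟨le_rfl, hδ₁⟩) hqv hqv',
      turn_eq_arg (hX.isPt 0) ha hb hq hq', a * b, mul_pos ha hb, ?_⟩
    have e1 : X (-r) = X 0 - a • q := by rw [← hq]; abel
    have e2 : X r = X 0 + b • q' := by rw [← hq']; abel
    rw [e1, e2]
    simp only [turnG, det, Pi.add_apply, Pi.sub_apply, Pi.smul_apply, smul_eq_mul]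
    ring
  -- The rotation from the left tangent to the right tangent; its position on the unit circle
  -- distinguishes the cases.
  obtain ⟨z, hz⟩ : ∃ z, z = (starRingEnd ℂ) v * u := ⟨_, rfl⟩
  have hz1 : z.re ^ 2 + z.im ^ 2 = 1 := by
    have h1 : ‖z‖ = 1 := by rw [hz, norm_mul, Complex.norm_conj, hu, hv, one_mul]
    have := Complex.normSq_eq_norm_sq z
    rw [h1, Complex.normSq_apply] at this
    linarith
  have huz : u = v * z := by
    rw [hz, ← mul_assoc, Complex.mul_conj, Complex.normSq_eq_norm_sq, hv]; simp
  rcases lt_trichotomy z.im 0 with him | him | him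
  · -- a right turn
    exfalso
    have harg : z.arg < 0 := Complex.arg_neg_iff.2 him
    have hP : ∀ᶠ z' in nhds z, z'.arg < z.arg / 2 :=
      (Complex.continuousAt_arg (Or.inr him.ne)).eventually (gt_mem_nhds (by linarith))
    obtain ⟨δ, hδ, h⟩ := hturn _ (hz ▸ hP)
    obtain ⟨r, hr, hr', hT⟩ := hX.exists_turn_gt hε hk h0 (e := -(z.arg / 2)) (by linarith) hδ
    obtain ⟨z', h1, h2, -⟩ := h r hr hr'
    rw [h2] at hT
    rw [← hz] at h1
    linarith
  · have hre : z.re = 1 ∨ z.re = -1 := by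
      rw [him] at hz1
      refine sq_eq_sq_iff_eq_or_eq_neg.1 ?_
      linarith
    rcases hre with hre | hre
    · -- a common tangent
      have huv : v = u := by
        have : z = 1 := Complex.ext (by simpa using hre) (by simpa using him)
        rw [huz, this, mul_one]
      rw [huv] at hL
      obtain ⟨δ₁, hδ₁, hd1, h1⟩ := hR κR hκR
      obtain ⟨δ₂, hδ₂, hd2, h2⟩ := hL κR hκR
      have h3 : IsStraight X (Set.Ioo (-δ₂) δ₁) (tangent u) κR := by
        refine ⟨fun s hs t ht hst => ?_, fun t ht => ?_⟩
        · rcases le_or_gt 0 s with hs0 | hs0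
          · exact h1.direction s ⟨hs0, hs.2⟩ t ⟨hs0.trans hst.le, ht.2⟩ hst
          · rcases le_or_gt t 0 with ht0 | ht0
            · exact h2.direction s ⟨hs.1, hs0.le⟩ t ⟨ht.1, ht0⟩ hst
            · obtain ⟨a, ha, ha'⟩ := h2.direction s ⟨hs.1, hs0.le⟩ 0 ⟨by linarith, le_rfl⟩ hs0
              obtain ⟨b, hb, hb'⟩ := h1.direction 0 ⟨le_rfl, hδ₁⟩ t ⟨ht0.le, ht.2⟩ ht0
              refine ⟨a + b, by linarith, ?_⟩
              have : X t - X s - (a + b) • tangent u =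
                  (X 0 - X s - a • tangent u) + (X t - X 0 - b • tangent u) := by
                rw [add_smul]; abel
              rw [this]
              exact (norm_add_le _ _).trans (by linarith)
        · rcases le_total 0 t with ht0 | ht0
          · exact h1.near t ⟨ht0, ht.2⟩
          · exact h2.near t ⟨ht.1, ht0⟩
      have h4 := HR X _ hX Set.ordConnected_Ioo (fun s hs t ht => by linarith [hs.1, ht.2]) h3
      refine ⟨min δ₁ δ₂, lt_min hδ₁ hδ₂, fun s t w hs hst htw hw => ?_⟩
      have m1 := min_le_left δ₁ δ₂
      have m2 := min_le_right δ₁ δ₂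
      exact h4 s ⟨by linarith, by linarith⟩ t w ⟨by linarith, by linarith⟩ hst htw
    · -- a cusp
      exfalso
      have huv : v = -u := by
        have : z = -1 := Complex.ext (by simpa using hre) (by simpa using him)
        rw [huz, this]; ring
      rw [huv] at hL
      obtain ⟨δ₁, hδ₁, h1⟩ := det_neg_of_cusp hu h0 (δ := min δR δL)
        (fun κ hκ => by obtain ⟨δ, h, -, h'⟩ := hR κ hκ; exact ⟨δ, h, h'⟩)
        (fun κ hκ => by obtain ⟨δ, h, -, h'⟩ := hL κ hκ; exact ⟨δ, h, h'⟩)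
        (fun s hs t w hw hst htw => cR s ⟨hs.1, hs.2.trans_le (min_le_left _ _)⟩ t w
          ⟨hw.1, hw.2.trans_le (min_le_left _ _)⟩ hst htw)
        (fun s hs t w hw hst htw => cL s ⟨(neg_le_neg (min_le_right _ _)).trans_lt hs.1, hs.2⟩ t w
          ⟨(neg_le_neg (min_le_right _ _)).trans_lt hw.1, hw.2⟩ hst htw)
      have hP : ∀ᶠ z' in nhds z, z'.re < 0 :=
        Complex.continuous_re.continuousAt.eventually (gt_mem_nhds (by
          show z.re < 0
          rw [hre]; norm_num))
      obtain ⟨δ₂, hδ₂, h2⟩ := hturn _ (hz ▸ hP)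
      -- Near a cusp `z'` has negative real part, so an argument above `-π / 2` forces a nonnegative
      -- imaginary part, while the cusp makes the determinant negative.
      obtain ⟨r, hr, hr', hT⟩ := hX.exists_turn_gt hε hk h0 (e := Real.pi / 2) (by positivity)
        (show 0 < min (min δ₁ δ₂) (min δR δL) by positivity)
      simp only [lt_min_iff] at hr'
      obtain ⟨z', h3, h4, b, hb, h5⟩ := h2 r hr hr'.1.2
      have h6 := h1 r hr hr'.1.1 (lt_min hr'.2.1 hr'.2.2)
      rw [h4] at hT
      rcases Complex.neg_pi_div_two_le_arg_iff.1 hT.le with h7 | h7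
      · linarith
      · rw [h5] at h6
        nlinarith
  · -- a left turn
    have hP : ∀ᶠ z' in nhds z, 0 < z'.im :=
      Complex.continuous_im.continuousAt.eventually (lt_mem_nhds him)
    obtain ⟨κ, hκ, H⟩ := exists_turnG_near hε (hz ▸ hP)
    obtain ⟨δ₁, hδ₁, -, h1⟩ := hR κ hκ
    obtain ⟨δ₂, hδ₂, -, h2⟩ := hL κ hκ
    refine ⟨min (min δ₁ δ₂) (min δR δL), by positivity, fun s t w hs hst htw hw => ?_⟩
    have m1 : min (min δ₁ δ₂) (min δR δL) ≤ δ₁ := (min_le_left _ _).trans (min_le_left _ _)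
    have m2 : min (min δ₁ δ₂) (min δR δL) ≤ δ₂ := (min_le_left _ _).trans (min_le_right _ _)
    have m3 : min (min δ₁ δ₂) (min δR δL) ≤ δR := (min_le_right _ _).trans (min_le_left _ _)
    have m4 : min (min δ₁ δ₂) (min δR δL) ≤ δL := (min_le_right _ _).trans (min_le_right _ _)
    rcases le_or_gt 0 s with hs0 | hs0
    · exact cR s ⟨hs0, by linarith⟩ t w ⟨by linarith, by linarith⟩ hst htw
    rcases le_or_gt w 0 with hw0 | hw0
    · exact cL s ⟨by linarith, hs0.le⟩ t w ⟨by linarith, hw0⟩ hst htw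
    rcases le_or_gt t 0 with ht0 | ht0
    · obtain ⟨a, ha, q, hq, hqv⟩ := h2.direction.exists_eq (s := s) (t := t)
        ⟨by linarith, hs0.le⟩ ⟨by linarith, ht0⟩ hst
      obtain ⟨b, hb, q', hq', hqv'⟩ := h1.direction.exists_eq (s := 0) (t := w)
        ⟨le_rfl, hδ₁⟩ ⟨hw0.le, by linarith⟩ hw0
      have h3 : 0 < det (X s) q q' := H _ _ _ (h2.near s ⟨by linarith, hs0.le⟩) hqv hqv'
      have h4 : 0 ≤ det (X s) (X t) (X 0) := by
        rcases ht0.eq_or_lt with rfl | ht0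
        · simp
        · exact (cL s ⟨by linarith, hs0.le⟩ t 0 ⟨by linarith, le_rfl⟩ hst ht0).le
      have e1 : X t = X s + a • q := by rw [← hq]; abel
      have e2 : X w = X 0 + b • q' := by rw [← hq']; abel
      -- Extending the last edge beyond `X 0` adds a positive multiple of the determinant of an
      -- incoming and an outgoing direction, which is positive near a left turn.
      have e3 : det (X s) (X t) (X w) = det (X s) (X t) (X 0) + a * b * det (X s) q q' := by
        rw [e2, e1]
        simp only [det, Pi.add_apply, Pi.smul_apply, smul_eq_mul]
        ring
      rw [e3]; positivity
    · obtain ⟨a, ha, q, hq, hqv⟩ := h2.direction.exists_eq (s := s) (t := 0)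
        ⟨by linarith, hs0.le⟩ ⟨by linarith, le_rfl⟩ hs0
      obtain ⟨b, hb, q', hq', hqv'⟩ := h1.direction.exists_eq (s := t) (t := w)
        ⟨ht0.le, by linarith⟩ ⟨hw0.le, by linarith⟩ htw
      have h3 : 0 < det (X t) q q' := H _ _ _ (h1.near t ⟨ht0.le, by linarith⟩) hqv hqv'
      have h4 := cR 0 ⟨le_rfl, hδR⟩ t w ⟨hw0.le, by linarith⟩ ht0 htw
      have e1 : X s = X 0 - a • q := by rw [← hq]; abel
      have e2 : X w = X t + b • q' := by rw [← hq']; abel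
      have e3 : det (X s) (X t) (X w) = det (X 0) (X t) (X w) + a * b * det (X t) q q' := by
        rw [e2, e1]
        simp only [det, Pi.add_apply, Pi.sub_apply, Pi.smul_apply, smul_eq_mul]
        ring
      rw [e3]; positivity

/-! ### From local convexity at `e₀` to convexity of the curve -/

lemma sq_bil_lt {ε : ℝ} (hε : ε = 1 ∨ ε = -1) {x y : Vec} (hx : IsPt ε x) (hy : IsPt ε y)
    (hxy : x ≠ y) (hxy' : x ≠ -y) : 0 < ε * (1 - bil ε x y ^ 2) := by
  have h1 := bil_lt hε hx hy hxy
  rcases hε with rfl | rfl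
  · have hy' : IsPt 1 (-y) := ⟨by
      have := hy.1
      simp only [bil, Pi.neg_apply] at *; linarith, fun h => by norm_num at h⟩
    have h2 := bil_lt (Or.inl rfl) hx hy' hxy'
    have e : bil 1 x (-y) = -bil 1 x y := by simp only [bil, Pi.neg_apply]; ring
    rw [e] at h2
    nlinarith
  · nlinarith

/-- Each point of the curve can be moved to `e₀`. -/
lemma IsCurved.exists_iso {ε k : ℝ} (hε : ε = 1 ∨ ε = -1) {X : ℝ → Vec} (hX : IsCurved ε k X)
    (m : ℝ) : ∃ g : Vec →ₗ[ℝ] Vec, IsIso ε g ∧ g (X m) = e₀ := by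
  have : ∃ y, IsPt ε y ∧ X m ≠ y ∧ X m ≠ -y := by
    -- On the sphere the opposite parameter may give the antipode, which does not determine a frame;
    -- then by injectivity `m + 1 / 3` does not.
    by_cases h : X m = -X (m + 1 / 2)
    · refine ⟨X (m + 1 / 3), hX.isPt _, hX.injective _ _ (by linarith) (by linarith), fun h' => ?_⟩
      rw [h] at h'
      exact hX.injective (m + 1 / 3) (m + 1 / 2) (by linarith) (by linarith) (neg_injective h').symm
    · exact ⟨X (m + 1 / 2), hX.isPt _, hX.injective _ _ (by linarith) (by linarith), h⟩
  obtain ⟨y, hy, h1, h2⟩ := this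
  obtain ⟨g, hg, hgm, -⟩ := exists_frame hε (hX.isPt m) hy (sq_bil_lt hε (hX.isPt m) hy h1 h2)
  exact ⟨g, hg, hgm⟩

/-- Each point is moved to `e₀`; a Lebesgue number over one period makes the radius uniform. Two
points of the surface on the same ray coincide, so embeddedness holds for rays. -/
theorem IsCurved.exists_isLocConvex {ε C₀ S₀ : ℝ} (hε : ε = 1 ∨ ε = -1) (hC₀ : 0 < C₀)
    (hS₀ : 0 < S₀) (hCS : S₀ ^ 2 = ε * (1 - C₀ ^ 2)) {X : ℝ → Vec}
    (hX : IsCurved ε (C₀ / S₀) X) : ∃ ρ, IsLocConvex X ρ := by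
  have hloc : ∀ m, ∃ ρ > 0, ∀ s t w, m - ρ < s → s < t → t < w → w < m + ρ →
      0 < det (X s) (X t) (X w) := by
    intro m
    obtain ⟨g, hg, hgm⟩ := hX.exists_iso hε m
    obtain ⟨ρ, hρ, h⟩ := ((hX.shift m).map hε hg).det_pos_near_zero hε hC₀ hS₀ hCS
      (by rw [zero_add]; exact hgm)
    refine ⟨ρ, hρ, fun s t w hs hst htw hw => ?_⟩
    have := h (s - m) (t - m) (w - m) (by linarith) (by linarith) (by linarith) (by linarith)
    simpa only [sub_add_cancel, hg.det] using this
  choose ρ hρ hloc using hloc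
  obtain ⟨δ, hδ, hδ'⟩ := lebesgue_number_lemma_of_metric (s := Set.Icc (0 : ℝ) 1)
    (c := fun m : ℝ => Metric.ball m (ρ m)) isCompact_Icc (fun _ => Metric.isOpen_ball)
    (fun x _ => Set.mem_iUnion.2 ⟨x, Metric.mem_ball_self (hρ x)⟩)
  refine ⟨δ, hX.continuous, hX.periodic, fun s t hst ht a ha h => ?_, hδ,
    fun s t w hst htw hw => ?_⟩
  · have h1 := (hX.isPt t).1
    rw [h, bil_smul_left, bil_smul_right, (hX.isPt s).1] at h1
    have : a = 1 := by nlinarith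
    rw [this, one_smul] at h
    exact hX.injective s t hst ht h.symm
  · have hper : ∀ x, X (Int.fract s + (x - s)) = X x := by
      intro x
      have h1 : Function.Periodic X 1 := hX.periodic
      have := h1.sub_zsmul_eq (x := x) ⌊s⌋
      rw [← this]
      congr 1
      rw [zsmul_one]
      linarith [Int.self_sub_floor s]
    obtain ⟨m, hm⟩ := hδ' (Int.fract s) ⟨Int.fract_nonneg s, (Int.fract_lt_one s).le⟩
    have hball : ∀ x, s ≤ x → x < s + δ → m - ρ m < Int.fract s + (x - s) ∧
        Int.fract s + (x - s) < m + ρ m := by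
      intro x h1 h2
      have := hm (show Int.fract s + (x - s) ∈ Metric.ball (Int.fract s) δ by
        rw [Metric.mem_ball, Real.dist_eq, add_sub_cancel_left, abs_of_nonneg (by linarith)]
        linarith)
      rw [Metric.mem_ball, Real.dist_eq, abs_lt] at this
      constructor <;> linarith
    have := hloc m (Int.fract s + (s - s)) (Int.fract s + (t - s)) (Int.fract s + (w - s))
      (hball s le_rfl (by linarith)).1 (by linarith) (by linarith) (hball w (by linarith) hw).2
    rwa [hper, hper, hper] at this

/-- A curved curve is convex. -/
theorem IsCurved.convex {ε C₀ S₀ : ℝ} (hε : ε = 1 ∨ ε = -1) (hC₀ : 0 < C₀)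
    (hS₀ : 0 < S₀) (hCS : S₀ ^ 2 = ε * (1 - C₀ ^ 2)) {X : ℝ → Vec}
    (hX : IsCurved ε (C₀ / S₀) X) {s t w : ℝ} (hst : s < t) (htw : t < w) (hw : w < s + 1) :
    0 < det (X s) (X t) (X w) := by
  obtain ⟨ρ, h⟩ := hX.exists_isLocConvex hε hC₀ hS₀ hCS
  exact h.convex hst htw hw

/-! ### Arcs and circles through their end points -/

lemma one_le_bil {x y : Vec} (hx : IsPt (-1) x) (hy : IsPt (-1) y) : 1 ≤ bil (-1) x y := by
  linarith [bil_le (Or.inr rfl) hx hy]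

lemma bil_pos_of_le {ε : ℝ} (hε : ε = 1 ∨ ε = -1) {x y : Vec} (hx : IsPt ε x) (hy : IsPt ε y)
    {h : ℝ} (hh : 0 < h) (hle : ε * h ≤ ε * bil ε x y) : 0 < bil ε x y := by
  rcases hε with rfl | rfl
  · linarith
  · linarith [one_le_bil hx hy]

/-- A point of a disc and to the right of a chord lies in the sector of the chord. -/
lemma sector {ε : ℝ} (hε : ε = 1 ∨ ε = -1) {c x y z : Vec} (hc : IsPt ε c) (hx : IsPt ε x)
    (hy : IsPt ε y) (hz : IsPt ε z) {h : ℝ} (hh : 0 < h) (hlt : 0 < ε * (1 - h))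
    (hcx : bil ε c x = h) (hcy : bil ε c y = h) (hz' : ε * h ≤ ε * bil ε c z)
    (hp : 0 < det c x y) (hF : 0 < det x z y) : 0 < det c x z ∧ 0 < det c z y := by
  obtain ⟨w, hw⟩ : ∃ w, w = bil ε c z := ⟨_, rfl⟩
  have hw0 : 0 < w := hw ▸ bil_pos_of_le hε hc hz hh hz'
  rw [← hw] at hz'
  have e := cramer c x y z
  rw [show det z x y = -det x z y by simp only [det]; ring] at e
  obtain ⟨p, hpd⟩ : ∃ p, p = det c x y := ⟨_, rfl⟩
  obtain ⟨F, hFd⟩ : ∃ F, F = det x z y := ⟨_, rfl⟩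
  obtain ⟨X, hXd⟩ : ∃ X, X = det c x z := ⟨_, rfl⟩
  obtain ⟨Y, hYd⟩ : ∃ Y, Y = det c z y := ⟨_, rfl⟩
  rw [← hpd, ← hFd, ← hXd, ← hYd] at e
  rw [← hpd] at hp
  rw [← hFd] at hF
  rw [← hXd, ← hYd]
  -- With `p • z + F • c = Y • x + X • y`, the product with `c` shows that the sum of the weights is
  -- positive, and comparing it with the square norm excludes weights of opposite signs.
  have h1 : p * w + F = (X + Y) * h := by
    have := congrArg (bil ε c) e
    simp only [bil_add_right, bil_smul_right, hcx, hcy, hc.1, ← hw] at this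
    linarith
  have h2 : p ^ 2 + F ^ 2 + 2 * p * F * w = (X + Y) ^ 2 - 2 * X * Y * (1 - bil ε x y) := by
    have e' : p • z + F • c = Y • x + X • y := by rw [e, neg_smul]; abel
    have h3 := congrArg (fun v => bil ε v v) e'
    simp only [bil_add_left, bil_add_right, bil_smul_left, bil_smul_right, hx.1, hy.1, hz.1, hc.1,
      bil_comm ε z c, ← hw, bil_comm ε y x] at h3
    linarith
  have hxy := bil_le hε hx hy
  have hsum : 0 < X + Y := by
    by_contra! hn
    have := mul_nonneg (neg_nonneg.2 hn) hh.le
    nlinarith [mul_pos hp hw0]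
  have hXY : 0 < X * Y := by
    by_contra! hn
    have h3 := mul_nonneg (neg_nonneg.2 hn) hxy
    have h4 : (X + Y) ^ 2 * h ^ 2 = (p * w + F) ^ 2 := by rw [h1]; ring
    have hpF := mul_pos hp hF
    have hpw := mul_pos hp hw0
    have hFw := mul_pos (mul_pos hp hF) hw0
    rcases hε with rfl | rfl
    · have h5 : (X + Y) ^ 2 ≤ p ^ 2 + F ^ 2 + 2 * p * F * w := by linarith
      have h6 : h ^ 2 < 1 := by nlinarith
      have h7 : (p * h) ^ 2 ≤ (p * w) ^ 2 :=
        pow_le_pow_left₀ (by positivity) (mul_le_mul_of_nonneg_left (by linarith) hp.le) 2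
      have h8 := mul_le_mul_of_nonneg_right h5 (sq_nonneg h)
      nlinarith [mul_pos (show 0 < 1 - h ^ 2 by linarith) (show 0 < F ^ 2 by positivity),
        mul_pos (show 0 < 1 - h ^ 2 by linarith) hFw]
    · have h5 : p ^ 2 + F ^ 2 + 2 * p * F * w ≤ (X + Y) ^ 2 := by linarith
      have h6 : 1 < h ^ 2 := by nlinarith
      have h7 : (p * w) ^ 2 ≤ (p * h) ^ 2 :=
        pow_le_pow_left₀ (by positivity) (mul_le_mul_of_nonneg_left (by linarith) hp.le) 2
      have h8 := mul_le_mul_of_nonneg_right h5 (sq_nonneg h)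
      nlinarith [mul_pos (show 0 < h ^ 2 - 1 by linarith) (show 0 < F ^ 2 by positivity),
        mul_pos (show 0 < h ^ 2 - 1 by linarith) hFw]
  rcases pos_and_pos_or_neg_and_neg_of_mul_pos hXY with h3 | h3
  · exact h3
  · linarith

/-- Centres of the circles of a given radius through `e₀`. -/
def center (h S k : ℝ) : Vec := ![h, S * k, S * √(1 - k ^ 2)]

lemma bil_center (ε h S k : ℝ) (x : Vec) :
    bil ε (center h S k) x = h * x 0 + ε * (S * (k * x 1 + √(1 - k ^ 2) * x 2)) := by
  simp only [bil, center, Matrix.cons_val]; ring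

lemma isPt_center {ε h S k : ℝ} (hh : 0 < h) (hhS : h ^ 2 + ε * S ^ 2 = 1) (hk : k ^ 2 ≤ 1) :
    IsPt ε (center h S k) := by
  refine ⟨?_, fun _ => by simpa [center] using hh⟩
  have := Real.sq_sqrt (show 0 ≤ 1 - k ^ 2 by linarith)
  rw [bil_center]
  simp only [center, Matrix.cons_val]
  linear_combination hhS + ε * S ^ 2 * this

lemma det_center (h S k : ℝ) (x : Vec) :
    det (center h S k) e₀ x = S * (√(1 - k ^ 2) * x 1 - k * x 2) := by
  simp [det, center, e₀]; ring

set_option maxHeartbeats 1000000 in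
/-- A convex curved arc does not enter the circle of larger radius through its end points whose
centre is on the other side of the chord. -/
theorem IsCurved.bil_le_of_chord {ε C₀ S₀ : ℝ} (hε : ε = 1 ∨ ε = -1) (hC₀ : 0 < C₀)
    (hS₀ : 0 < S₀) (hCS : S₀ ^ 2 = ε * (1 - C₀ ^ 2)) {X : ℝ → Vec} (hX : IsCurved ε (C₀ / S₀) X)
    {s u : ℝ} (hsu : s < u) (hu : u < s + 1) (hs : X s = e₀) {B r : ℝ} (hXu : X u = ![B, r, 0])
    (hr : 0 < r) {h S K : ℝ} (hh : 0 < h) (hS : 0 < S) (hlt : ε * h < ε * C₀)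
    (hhS : h ^ 2 + ε * S ^ 2 = 1) (hK0 : 0 < K) (hK1 : K < 1) (hK : S * K * r = ε * h * (1 - B))
    {t : ℝ} (hst : s < t) (htu : t < u) : ε * bil ε (center h S K) (X t) ≤ ε * h := by
  have hXc := hX.continuous
  have h2 := sq_of_sign hε
  have hh1 : 0 < ε * (1 - h) := by
    have : 0 < S ^ 2 := by positivity
    rcases hε with rfl | rfl <;> nlinarith
  obtain ⟨g, hg⟩ : ∃ g : ℝ → ℝ → ℝ, g = fun k t => ε * bil ε (center h S k) (X t) - ε * h :=
    ⟨_, rfl⟩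
  have hgc : Continuous fun p : ℝ × ℝ => g p.1 p.2 := by
    rw [hg]; simp only [bil_center]; fun_prop
  have hge : ∀ k t, g k t = ε * h * (X t 0 - 1) + S * (k * X t 1 + √(1 - k ^ 2) * X t 2) := by
    intro k t
    rw [hg]; simp only [bil_center]
    linear_combination (S * (k * X t 1 + √(1 - k ^ 2) * X t 2)) * h2
  -- By convexity the arc is to the right of its chord, whereas the centres `center h S k` are to
  -- the left.
  have hx2 : ∀ t, s < t → t < u → X t 2 < 0 := by
    intro t h1 h3
    have := hX.convex hε hC₀ hS₀ hCS h1 h3 hu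
    rw [hs, hXu] at this
    simp [det, e₀] at this
    nlinarith
  have hx0 : ∀ t, ε * h * (X t 0 - 1) ≤ 0 := by
    intro t
    have h1 := bil_le hε (⟨by simp [bil, e₀], fun _ => by simp [e₀]⟩ : IsPt ε e₀) (hX.isPt t)
    have h3 : bil ε e₀ (X t) = X t 0 := by simp [bil, e₀]
    rw [h3] at h1
    nlinarith
  have hx0' : ∀ t, s < t → t ≤ u → ε * h * (X t 0 - 1) < 0 := by
    intro t ht1 ht2
    have h1 := bil_lt hε (hX.isPt s) (hX.isPt t) (hX.injective s t ht1 (by linarith))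
    have h3 : bil ε e₀ (X t) = X t 0 := by simp [bil, e₀]
    rw [hs, h3] at h1
    nlinarith
  by_contra! hcon
  -- the last position of the circle without intersection
  obtain ⟨A, hA⟩ : ∃ A, A = {k | k ∈ Set.Icc 0 K ∧ ∀ t ∈ Set.Icc s u, g k t ≤ 0} := ⟨_, rfl⟩
  have hAc : IsClosed A := by
    have : A = Set.Icc 0 K ∩ ⋂ t ∈ Set.Icc s u, {k | g k t ≤ 0} := by
      rw [hA]; ext k; simp only [Set.mem_ofPred_eq, Set.mem_inter_iff, Set.mem_iInter]
    rw [this]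
    refine isClosed_Icc.inter (isClosed_biInter fun t _ => isClosed_le ?_ continuous_const)
    exact hgc.comp (continuous_id.prodMk continuous_const)
  have h0A : (0 : ℝ) ∈ A := by
    rw [hA]
    refine ⟨⟨le_rfl, hK0.le⟩, fun t ht => ?_⟩
    rw [hge]
    have h1 := hx0 t
    have h3 : X t 2 ≤ 0 := by
      rcases ht.1.eq_or_lt with rfl | h3
      · rw [hs]; simp [e₀]
      rcases ht.2.eq_or_lt with rfl | h4
      · rw [hXu]; simp
      · exact (hx2 t h3 h4).le
    simp
    nlinarith
  have hbdd : BddAbove A := ⟨K, fun k hk => by rw [hA] at hk; exact hk.1.2⟩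
  obtain ⟨k₀, hk₀⟩ : ∃ k₀, k₀ = sSup A := ⟨_, rfl⟩
  have hk₀A : k₀ ∈ A := hk₀ ▸ hAc.csSup_mem ⟨0, h0A⟩ hbdd
  have hKA : K ∉ A := by
    intro h
    rw [hA] at h
    have := h.2 t ⟨hst.le, htu.le⟩
    rw [hg] at this
    simp only at this
    linarith
  have hk₀' := hk₀A
  rw [hA] at hk₀'
  have hk₀K : k₀ < K := lt_of_le_of_ne hk₀'.1.2 (by rintro h; exact hKA (h ▸ hk₀A))
  -- Just after the last admissible position the arc enters the disc so little that it remains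
  -- outside a concentric circle whose radius still exceeds that of the curvature bound, as `no_dip`
  -- requires.
  obtain ⟨δ, hδ, hunif⟩ := Metric.uniformContinuousOn_iff.1
    ((isCompact_Icc (a := 0) (b := K)).prod
      (isCompact_Icc (a := s) (b := u)) |>.uniformContinuousOn_of_continuous hgc.continuousOn)
    ((ε * C₀ - ε * h) / 2) (by linarith)
  obtain ⟨k, hk1, hk2⟩ := exists_between (lt_min hk₀K (lt_add_of_pos_right k₀ hδ))
  rw [lt_min_iff] at hk2
  have hk0 : 0 < k := lt_of_le_of_lt hk₀'.1.1 hk1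
  have hk1' : k ^ 2 < 1 := by nlinarith
  have hkA : k ∉ A := fun h => absurd (le_csSup hbdd h) (by rw [← hk₀]; exact not_le.2 hk1)
  have hsmall : ∀ t ∈ Set.Icc s u, g k t ≤ (ε * C₀ - ε * h) / 2 := by
    intro t ht
    have := hunif (k, t) ⟨⟨hk0.le, hk2.1.le⟩, ht⟩ (k₀, t) ⟨hk₀'.1, ht⟩ (by
      rw [Prod.dist_eq, max_lt_iff, dist_self, Real.dist_eq, abs_of_pos (by linarith)]
      exact ⟨by simp only; linarith, hδ⟩)
    rw [Real.dist_eq] at this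
    have h3 := hk₀'.2 t ht
    linarith [(abs_lt.1 this).2]
  have hex : ∃ t ∈ Set.Icc s u, 0 < g k t := by
    by_contra! hno
    exact hkA (hA ▸ ⟨⟨hk0.le, hk2.1.le⟩, hno⟩)
  obtain ⟨t₀, ht₀, hgt⟩ := hex
  obtain ⟨c, hc⟩ : ∃ c, c = center h S k := ⟨_, rfl⟩
  have hcpt : IsPt ε c := hc ▸ isPt_center hh hhS hk1'.le
  have hsq : 0 < √(1 - k ^ 2) := Real.sqrt_pos.2 (by linarith)
  have hgs : g k s = 0 := by rw [hge, hs]; simp [e₀]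
  have hgu : g k u ≤ 0 := by
    have h1 : g k u = -(S * K * r) + S * k * r := by
      rw [hge, hXu, hK]; simp; ring
    have h3 := mul_lt_mul_of_pos_left hk2.1 (mul_pos hS hr)
    linarith
  have hst₀ : s < t₀ := lt_of_le_of_ne ht₀.1 (by rintro rfl; linarith)
  have ht₀u : t₀ < u := lt_of_le_of_ne ht₀.2 (by rintro rfl; linarith)
  obtain ⟨s', u', h1, h3, h4, h5, h6, h7, h8⟩ := exists_dip (f := g k)
    (hgc.comp (continuous_const.prodMk continuous_id)) hst₀ ht₀u hgs.le hgu hgt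
  have hgB : ∀ t, ε * bil ε c (X t) = g k t + ε * h := fun t => by rw [hg, hc]; ring
  -- points of the dip lie to the left of the radius through `e₀`
  have hleft : ∀ t, s < t → t ≤ u → 0 ≤ g k t → 0 < det c (X s) (X t) := by
    intro t ht1 ht2 ht3
    rw [hge] at ht3
    have h9 := hx0' t ht1 ht2
    have h10 : X t 2 ≤ 0 := by
      rcases ht2.eq_or_lt with rfl | h4
      · rw [hXu]; simp
      · exact (hx2 t ht1 h4).le
    rw [hc, hs, det_center]
    obtain ⟨σ, hσ⟩ : ∃ σ, σ = √(1 - k ^ 2) := ⟨_, rfl⟩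
    rw [← hσ] at ht3 hsq ⊢
    have h11 : 0 < S * (k * X t 1 + σ * X t 2) := by linarith
    have h12 := pos_of_mul_pos_right h11 hS.le
    have h13 := mul_nonneg hsq.le (neg_nonneg.2 h10)
    have h14 := mul_pos hsq (pos_of_mul_pos_right (show 0 < k * X t 1 by linarith) hk0.le)
    have h15 := mul_nonneg hk0.le (neg_nonneg.2 h10)
    exact mul_pos hS (by linarith)
  have hbs : bil ε c (X s) = h := by
    have := hgB s
    rw [hgs, zero_add] at this
    exact mul_left_cancel₀ (by rcases hε with rfl | rfl <;> norm_num) this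
  have hbu : bil ε c (X u') = h := by
    have := hgB u'
    rw [h7, zero_add] at this
    exact mul_left_cancel₀ (by rcases hε with rfl | rfl <;> norm_num) this
  have hsu' : s < u' := by linarith
  have hpu := hleft u' hsu' h5 h7.ge
  have hsec : ∀ t, s' ≤ t → s < t → t < u' → 0 < det c (X s) (X t) ∧ 0 < det c (X t) (X u') := by
    intro t ht1 ht2 ht3
    refine sector hε hcpt (hX.isPt s) (hX.isPt u') (hX.isPt t) hh hh1 hbs hbu ?_ hpu
      (hX.convex hε hC₀ hS₀ hCS ht2 ht3 (by linarith))
    have := h8 t ⟨ht1, ht3.le⟩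
    linarith [hgB t]
  have hdet : ∀ t t', s' ≤ t → t < t' → t' ≤ u' → 0 < det c (X t) (X t') := by
    intro t t' ht htt' ht'
    rcases (h1.trans ht).eq_or_lt with rfl | hst
    · exact hleft t' htt' (by linarith) (h8 t' ⟨by linarith, ht'⟩)
    have hy := hsec t ht hst (by linarith)
    rcases ht'.eq_or_lt with rfl | ht'
    · exact hy.2
    have d1 := hX.convex hε hC₀ hS₀ hCS hst htt' (by linarith)
    have d2 := hX.convex hε hC₀ hS₀ hCS htt' ht' (by linarith)
    have d3 := hX.convex hε hC₀ hS₀ hCS hst (htt'.trans ht') (by linarith)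
    -- A Plücker relation at `X t`: convex triples and the sector positions give the orientation of
    -- all chords as seen from `c`.
    have e : det (X s) (X t) (X u') * det c (X t) (X t') =
        det (X s) (X t) (X t') * det c (X t) (X u') + det (X t) (X t') (X u') * det c (X s) (X t) := by
      simp only [det]; ring
    refine pos_of_mul_pos_right (a := det (X s) (X t) (X u')) ?_ d3.le
    rw [e]
    have := mul_pos d1 hy.2
    have := mul_pos d2 hy.1
    linarith
  have hh₀ : 0 < (C₀ + h) / 2 := by linarith
  have := hX.no_dip hε hC₀ hS₀ hCS hcpt (s := s') (u := u') (v := ε * h) (by linarith) hh₀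
    (by linarith) (fun t ht => bil_pos_of_le hε hcpt (hX.isPt t) hh (by linarith [hgB t, h8 t ht]))
    (fun t ht => by linarith [hgB t, hsmall t ⟨h1.trans ht.1, ht.2.trans h5⟩])
    (by linarith [hgB s']) (by linarith [hgB u']) hdet h3 h4
  linarith [hgB t₀]

/-- A point outside the circle with inward normal `(K, k)` at `e₀` but on the positive side of the
line with normal `(n₁, n₂)`. If the line is tilted inwards, `c₀` is positive as the sine of the
angle between the normals, and near `e₀` no such point exists: its first tangential coordinate `a`
is bounded below. -/
lemma normal_estimate {ε h S K k n₁ n₂ x a b c₀ : ℝ} (hε : ε = 1 ∨ ε = -1) (hh : 0 < h)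
    (hS : 0 < S) (hk0 : 0 < k) (hn : n₁ ^ 2 + n₂ ^ 2 = 1) (hn₁ : 0 ≤ n₁) (hn₂ : 0 < n₂) (hx : 0 < x)
    (hb : 0 < b) (hc₀ : c₀ = n₂ * K - k * n₁) (hpt : x ^ 2 + ε * (a ^ 2 + b ^ 2) = 1)
    (hR : S * (K * a - k * b) ≤ h * (ε * (1 - x))) (e3 : n₂ * b ≤ n₁ * a) :
    S * c₀ * n₂ ≤ h * a := by
  have ha0 : 0 < a := by
    by_contra! h
    have := mul_nonneg hn₁ (neg_nonneg.2 h)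
    have := mul_pos hn₂ hb
    linarith
  have h2 := sq_of_sign hε
  have e2 : ε * (1 - x) ≤ a ^ 2 + b ^ 2 := by
    have h3 : ε * (1 - x) * (1 + x) = a ^ 2 + b ^ 2 := by
      linear_combination (-ε) * hpt + (a ^ 2 + b ^ 2) * h2
    have h4 : 0 ≤ ε * (1 - x) := by
      refine nonneg_of_mul_nonneg_left (b := 1 + x) ?_ (by linarith)
      rw [h3]; positivity
    have := mul_nonneg h4 hx.le
    linarith
  have e4 : S * (K * a - k * b) ≤ h * (a ^ 2 + b ^ 2) :=
    hR.trans (mul_le_mul_of_nonneg_left e2 hh.le)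
  have e5 : c₀ * a ≤ n₂ * (K * a - k * b) := by
    have := mul_le_mul_of_nonneg_left e3 hk0.le
    rw [hc₀]; linarith
  have e6 : n₂ ^ 2 * (a ^ 2 + b ^ 2) ≤ a ^ 2 := by
    have h3 : (n₂ * b) ^ 2 ≤ (n₁ * a) ^ 2 := pow_le_pow_left₀ (by positivity) e3 2
    have h4 : (n₁ ^ 2 + n₂ ^ 2) * a ^ 2 = a ^ 2 := by rw [hn, one_mul]
    linarith
  have h3 := mul_le_mul_of_nonneg_left e5 (mul_pos hS hn₂).le
  have h4 := mul_le_mul_of_nonneg_left e4 (show 0 ≤ n₂ ^ 2 by positivity)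
  have h5 := mul_le_mul_of_nonneg_left e6 hh.le
  have e7 : S * c₀ * n₂ * a ≤ h * a * a := by linarith
  exact le_of_mul_le_mul_right e7 ha0

set_option maxHeartbeats 1000000 in
/-- The estimate of the normal on the side of the first arc. -/
lemma IsCurved.normal_bound {ε C₀ S₀ : ℝ} (hε : ε = 1 ∨ ε = -1) (hC₀ : 0 < C₀)
    (hS₀ : 0 < S₀) (hCS : S₀ ^ 2 = ε * (1 - C₀ ^ 2)) {X : ℝ → Vec} (hX : IsCurved ε (C₀ / S₀) X)
    {s u : ℝ} (hsu : s < u) (hu : u < s + 1) (hs : X s = e₀) {B r : ℝ} (hXu : X u = ![B, r, 0])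
    (hr : 0 < r) {h S : ℝ} (hh : 0 < h) (hS : 0 < S) (hlt : ε * h < ε * C₀)
    (hhS : h ^ 2 + ε * S ^ 2 = 1) (hK1 : ε * h * (1 - B) < S * r) {n₁ n₂ : ℝ}
    (hn : n₁ ^ 2 + n₂ ^ 2 = 1) (hn₂ : 0 ≤ n₂) (hsupp : ∀ t, 0 ≤ n₁ * X t 1 + n₂ * X t 2) :
    ε * h * (1 - B) ≤ S * n₁ * r := by
  have hXc := hX.continuous
  by_contra! hcon
  obtain ⟨K, hKd⟩ : ∃ K, K = ε * h * (1 - B) / (S * r) := ⟨_, rfl⟩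
  have hSr : 0 < S * r := mul_pos hS hr
  have hK : S * K * r = ε * h * (1 - B) := by rw [hKd]; field_simp
  have hB : 0 < ε * (1 - B) := by
    have h1 := bil_lt hε (hX.isPt s) (hX.isPt u) (hX.injective s u hsu hu)
    have h3 : bil ε e₀ (X u) = B := by rw [hXu]; simp [bil, e₀]
    rwa [hs, h3] at h1
  have hK0 : 0 < K := by
    rw [hKd]; refine div_pos ?_ hSr
    have := mul_pos hh hB
    linarith
  have hK1' : K < 1 := by rw [hKd, div_lt_one hSr]; exact hK1
  have hnK : n₁ < K := by
    rw [← hK] at hcon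
    by_contra! hle
    have := mul_le_mul_of_nonneg_left hle hSr.le
    linarith
  have hn₁ : 0 ≤ n₁ := by
    have := hsupp u
    rw [hXu] at this
    simp at this
    by_contra! hneg
    nlinarith
  obtain ⟨k, hkd⟩ : ∃ k, k = √(1 - K ^ 2) := ⟨_, rfl⟩
  have hk2 : k ^ 2 = 1 - K ^ 2 := by rw [hkd]; exact Real.sq_sqrt (by nlinarith)
  have hk0 : 0 < k := by rw [hkd]; exact Real.sqrt_pos.2 (by nlinarith)
  have hkn : k < n₂ := by
    have : k ^ 2 < n₂ ^ 2 := by nlinarith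
    exact lt_of_pow_lt_pow_left₀ 2 hn₂ this
  have hn₂' : 0 < n₂ := hk0.trans hkn
  -- If the claim failed, the support line would cut into the disc, and points of the arc tending to
  -- `X s` would contradict `normal_estimate`.
  obtain ⟨c₀, hc₀⟩ : ∃ c₀, c₀ = n₂ * K - k * n₁ := ⟨_, rfl⟩
  have hc0 : 0 < c₀ := by
    rw [hc₀]
    have := mul_pos hk0 (sub_pos.2 hnK)
    have := mul_pos (sub_pos.2 hkn) hK0
    linarith
  -- a short part of the arc
  have ev1 : ∀ᶠ t in nhds s, 0 < X t 0 :=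
    (show Continuous fun t => X t 0 by fun_prop).continuousAt.eventually
      (lt_mem_nhds (by show 0 < X s 0; rw [hs]; simp [e₀]))
  have ev2 : ∀ᶠ t in nhds s, h * X t 1 < S * c₀ * n₂ :=
    (show Continuous fun t => h * X t 1 by fun_prop).continuousAt.eventually
      (gt_mem_nhds (by show h * X s 1 < _; rw [hs]; simp [e₀]; positivity))
  obtain ⟨δ, hδ, hev⟩ := Metric.eventually_nhds_iff.1 (ev1.and ev2)
  obtain ⟨t, ht1, ht2⟩ := exists_between (lt_min hsu (lt_add_of_pos_right s hδ))
  rw [lt_min_iff] at ht2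
  obtain ⟨hx0, hxa⟩ := hev (y := t) (by rw [Real.dist_eq, abs_of_pos (by linarith)]; linarith)
  have hR := hX.bil_le_of_chord hε hC₀ hS₀ hCS hsu hu hs hXu hr hh hS hlt hhS hK0 hK1' hK ht1 ht2.1
  rw [bil_center, ← hkd] at hR
  have hb : X t 2 < 0 := by
    have := hX.convex hε hC₀ hS₀ hCS ht1 ht2.1 hu
    rw [hs, hXu] at this
    simp [det, e₀] at this
    nlinarith
  have hpt := (hX.isPt t).1
  have hsup := hsupp t
  obtain ⟨x, hx⟩ : ∃ x, x = X t 0 := ⟨_, rfl⟩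
  obtain ⟨a, ha⟩ : ∃ a, a = X t 1 := ⟨_, rfl⟩
  obtain ⟨b, hbd⟩ : ∃ b, b = -X t 2 := ⟨_, rfl⟩
  have hb' : X t 2 = -b := by rw [hbd]; ring
  simp only [bil] at hpt
  rw [hb', ← ha] at hsup
  rw [hb', ← ha, ← hx] at hR hpt
  rw [← hx] at hx0
  rw [← ha] at hxa
  have hb0 : 0 < b := by linarith
  have h2 := sq_of_sign hε
  refine absurd (normal_estimate (x := x) hε hh hS hk0 hn hn₁ hn₂' hx0 hb0 hc₀ ?_ ?_ ?_) (not_le.2 hxa)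
  · rw [← hpt]; ring
  · have : ε * (h * x + ε * (S * (K * a + k * -b))) = ε * h * x + S * (K * a - k * b) := by
      linear_combination (S * (K * a + k * -b)) * h2
    rw [this] at hR
    linarith
  · linarith

/-! ### Support lines and tangent discs -/

/-- `{bil ε n = 0}` is a support line of `X` at `p`, with unit normal vector `n`. -/
structure IsSupport (ε : ℝ) (X : ℝ → Vec) (p n : Vec) : Prop where
  bil_eq_zero : bil ε p n = 0
  bil_self : bil ε n n = ε
  nonneg : ∀ t, 0 ≤ ε * bil ε n (X t)

lemma bil_e₀ (ε : ℝ) (x : Vec) : bil ε e₀ x = x 0 := by simp [bil, e₀]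

/-- Support lines in a frame at the point of support. -/
lemma IsSupport.coords {ε : ℝ} (hε : ε = 1 ∨ ε = -1) {X : ℝ → Vec} {p n : Vec}
    (h : IsSupport ε X p n) {g : Vec →ₗ[ℝ] Vec} (hg : IsIso ε g) (hp : g p = e₀) :
    g n 1 ^ 2 + g n 2 ^ 2 = 1 ∧ ∀ x, ε * bil ε n x = g n 1 * g x 1 + g n 2 * g x 2 := by
  have h2 := sq_of_sign hε
  have h0 : g n 0 = 0 := by rw [← bil_e₀ ε (g n), ← hp, hg.bil, h.bil_eq_zero]
  have h1 := h.bil_self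
  rw [← hg.bil] at h1
  simp only [bil, h0] at h1
  refine ⟨?_, fun x => ?_⟩
  · linear_combination ε * h1 + (1 - g n 1 ^ 2 - g n 2 ^ 2) * h2
  · rw [← hg.bil]
    simp only [bil, h0]
    linear_combination (g n 1 * g x 1 + g n 2 * g x 2) * h2

/-- `2 * h ^ 2 - 1` belongs to the doubled radius: a chord shorter than the diameter puts the centre
off the chord, which is `K < 1`. -/
lemma edge_lt {ε h S B r : ℝ} (hε : ε = 1 ∨ ε = -1) (hS : 0 < S) (hr : 0 < r)
    (hhS : h ^ 2 + ε * S ^ 2 = 1) (hrB : r ^ 2 = ε * (1 - B ^ 2)) (hB : 0 < ε * (1 - B))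
    (hfar : ε * (2 * h ^ 2 - 1) < ε * B) : ε * h * (1 - B) < S * r := by
  have h2 := sq_of_sign hε
  refine lt_of_pow_lt_pow_left₀ 2 (by positivity) ?_
  have e1 : (S * r) ^ 2 - (ε * h * (1 - B)) ^ 2 =
      ε * (1 - B) * (ε * B - ε * (2 * h ^ 2 - 1)) := by
    have hS2 : S ^ 2 = ε * (1 - h ^ 2) := by linear_combination ε * hhS - S ^ 2 * h2
    rw [mul_pow, hS2, hrB]
    ring
  have := mul_pos hB (sub_pos.2 hfar)
  linarith

/-- In a frame with `X m = e₀` and `X q` on the first axis, containment of `X q` in the tangent disc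
is exactly the bound of `normal_bound` on the first component of the normal. -/
lemma IsCurved.bil_center_le_of_lt {ε C₀ S₀ : ℝ} (hε : ε = 1 ∨ ε = -1) (hC₀ : 0 < C₀)
    (hS₀ : 0 < S₀) (hCS : S₀ ^ 2 = ε * (1 - C₀ ^ 2)) {X : ℝ → Vec} (hX : IsCurved ε (C₀ / S₀) X)
    {m q : ℝ} (hmq : m < q) (hq : q < m + 1) {h S : ℝ} (hh : 0 < h) (hS : 0 < S)
    (hlt : ε * h < ε * C₀) (hhS : h ^ 2 + ε * S ^ 2 = 1) {n : Vec} (hn : IsSupport ε X (X m) n)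
    (hfar : ε * (2 * h ^ 2 - 1) < ε * bil ε (X m) (X q)) :
    ε * h ≤ ε * bil ε (h • X m + S • n) (X q) := by
  have h2 := sq_of_sign hε
  obtain ⟨B, hB⟩ : ∃ B, B = bil ε (X m) (X q) := ⟨_, rfl⟩
  have hB1 := bil_lt hε (hX.isPt m) (hX.isPt q) (hX.injective m q hmq hq)
  rw [← hB] at hB1 hfar
  have hB2 : 0 < 1 + B := by
    rcases hε with rfl | rfl
    · have := pow_pos hh 2
      linarith
    · linarith
  have hB3 : 0 < ε * (1 - B ^ 2) := by
    have := mul_pos hB1 hB2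
    linarith
  obtain ⟨g, hg, hgm, hgq⟩ := exists_frame hε (hX.isPt m) (hX.isPt q) (by rwa [← hB])
  rw [← hB] at hgq
  obtain ⟨r, hr⟩ : ∃ r, r = √(ε * (1 - B ^ 2)) := ⟨_, rfl⟩
  have hr0 : 0 < r := hr ▸ Real.sqrt_pos.2 hB3
  have hr2 : r ^ 2 = ε * (1 - B ^ 2) := hr ▸ Real.sq_sqrt hB3.le
  rw [← hr] at hgq
  obtain ⟨hn1, hnx⟩ := hn.coords hε hg hgm
  have hsupp : ∀ t, 0 ≤ g n 1 * g (X t) 1 + g n 2 * g (X t) 2 := fun t => hnx (X t) ▸ hn.nonneg t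
  have hK := edge_lt hε hS hr0 hhS hr2 hB1 hfar
  have hY := hX.map hε hg
  have key : ε * h * (1 - B) ≤ S * g n 1 * r := by
    rcases le_or_gt 0 (g n 2) with h0 | h0
    · exact hY.normal_bound hε hC₀ hS₀ hCS hmq hq hgm hgq hr0 hh hS hlt hhS hK hn1 h0 hsupp
    -- If the normal points to the other side of the chord, the arc that arrives at `X m` takes the
    -- role of the one that leaves it, after reflection and reversal.
    · have hq' : g (X (-(1 - q))) = ![B, r, 0] := by
        rw [← hgq, ← hX.periodic (-(1 - q))]; congr 2; ring
      refine hY.mirror.normal_bound hε hC₀ hS₀ hCS (s := -m) (u := 1 - q) (by linarith)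
        (by linarith) (by rw [neg_neg, hgm, mirror_e₀]) (B := B) (r := r) ?_ hr0 hh hS hlt hhS hK
        (n₁ := g n 1) (n₂ := -g n 2) (by linarith) (by linarith) fun t => ?_
      · rw [hq']; ext i; fin_cases i <;> simp [CayleyKlein.mirror]
      · have := hsupp (-t)
        simpa [CayleyKlein.mirror] using this
  have h3 := hnx (X q)
  rw [hgq] at h3
  simp at h3
  rw [bil_add_left, bil_smul_left, bil_smul_left, ← hB]
  have h4 : ε * (h * B + S * bil ε n (X q)) = ε * h * B + S * (ε * bil ε n (X q)) := by ring
  rw [h4, h3]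
  linarith

/-- A limit over radii slightly larger than that of `h`, for which both strict inequalities hold. -/
lemma IsCurved.bil_center_le {ε C₀ S₀ : ℝ} (hε : ε = 1 ∨ ε = -1) (hC₀ : 0 < C₀)
    (hS₀ : 0 < S₀) (hCS : S₀ ^ 2 = ε * (1 - C₀ ^ 2)) {X : ℝ → Vec} (hX : IsCurved ε (C₀ / S₀) X)
    {m q : ℝ} (hmq : m < q) (hq : q < m + 1) {h S : ℝ} (hh : 0 < h) (hS : 0 < S)
    (hle : ε * h ≤ ε * C₀) (hhS : h ^ 2 + ε * S ^ 2 = 1) {n : Vec} (hn : IsSupport ε X (X m) n)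
    (hfar : ε * (2 * h ^ 2 - 1) ≤ ε * bil ε (X m) (X q)) :
    ε * h ≤ ε * bil ε (h • X m + S • n) (X q) := by
  have h2 := sq_of_sign hε
  have hS2 : S ^ 2 = ε * (1 - h ^ 2) := by linear_combination ε * hhS - S ^ 2 * h2
  have hSS : S = √(ε * (1 - h ^ 2)) := by
    rw [← hS2, Real.sqrt_sq hS.le]
  obtain ⟨F, hF⟩ : ∃ F : ℝ → ℝ, F = fun θ => ε * ((h - ε * θ) * bil ε (X m) (X q) +
    √(ε * (1 - (h - ε * θ) ^ 2)) * bil ε n (X q)) - ε * (h - ε * θ) := ⟨_, rfl⟩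
  have hFc : Continuous F := by rw [hF]; fun_prop
  have hev : ∀ᶠ θ in nhdsWithin (0 : ℝ) (Set.Ioi 0), 0 ≤ F θ := by
    have h3 : ∀ᶠ θ in nhdsWithin (0 : ℝ) (Set.Ioi 0), 0 < h - ε * θ :=
      nhdsWithin_le_nhds ((show Continuous fun θ => h - ε * θ by fun_prop).continuousAt.eventually
        (lt_mem_nhds (by simpa using hh)))
    filter_upwards [h3, self_mem_nhdsWithin] with θ h4 h5
    have h5 : 0 < θ := h5
    have h6 : 0 < ε * (1 - (h - ε * θ) ^ 2) := by
      have : 0 < S ^ 2 := by positivity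
      rcases hε with rfl | rfl <;> nlinarith
    have h7 := hX.bil_center_le_of_lt hε hC₀ hS₀ hCS hmq hq h4 (Real.sqrt_pos.2 h6) (by nlinarith)
      (by rw [Real.sq_sqrt h6.le]; linear_combination (1 - (h - ε * θ) ^ 2) * h2) hn
      (lt_of_lt_of_le (by rcases hε with rfl | rfl <;> nlinarith) hfar)
    rw [bil_add_left, bil_smul_left, bil_smul_left] at h7
    rw [hF]
    linarith
  have := ge_of_tendsto (hFc.continuousAt.tendsto.mono_left nhdsWithin_le_nhds) hev
  rw [hF] at this
  simp only [mul_zero, sub_zero] at this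
  rw [← hSS] at this
  rw [bil_add_left, bil_smul_left, bil_smul_left]
  linarith

/-- The diameter of the curve is bounded. -/
lemma IsCurved.lt_bil {ε C₀ S₀ : ℝ} (hε : ε = 1 ∨ ε = -1) (hC₀ : 0 < C₀)
    (hS₀ : 0 < S₀) (hCS : S₀ ^ 2 = ε * (1 - C₀ ^ 2)) {X : ℝ → Vec} (hX : IsCurved ε (C₀ / S₀) X)
    {m q : ℝ} (hmq : m < q) (hq : q < m + 1) {h : ℝ} (hh : 0 < h)
    (hlt : ε * h < ε * C₀) {n : Vec} (hn : IsSupport ε X (X m) n) :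
    ε * (2 * h ^ 2 - 1) < ε * bil ε (X m) (X q) := by
  have hXc := hX.continuous
  have h2 := sq_of_sign hε
  by_contra! hcon
  -- An intermediate radius, whose diameter is still smaller than the distance to `X q`. On both
  -- sides of `m` the curve then crosses the circle about `X m` whose radius is that diameter.
  obtain ⟨k, hk⟩ : ∃ k, k = (h + C₀) / 2 := ⟨_, rfl⟩
  have hk0 : 0 < k := by linarith
  have hk1 : ε * h < ε * k := by rw [hk]; linarith
  have hk2 : ε * k < ε * C₀ := by rw [hk]; linarith
  have hkh : ε * h ^ 2 < ε * k ^ 2 := by rcases hε with rfl | rfl <;> nlinarith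
  have hkC : ε * k ^ 2 < ε * C₀ ^ 2 := by rcases hε with rfl | rfl <;> nlinarith
  have hk3 : 0 < ε * (1 - k ^ 2) := by
    have := pow_pos hS₀ 2
    linarith
  obtain ⟨S, hSd⟩ : ∃ S, S = √(ε * (1 - k ^ 2)) := ⟨_, rfl⟩
  have hS : 0 < S := hSd ▸ Real.sqrt_pos.2 hk3
  have hS2 : S ^ 2 = ε * (1 - k ^ 2) := hSd ▸ Real.sq_sqrt hk3.le
  have hkS : k ^ 2 + ε * S ^ 2 = 1 := by rw [hS2]; linear_combination (1 - k ^ 2) * h2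
  have hper : X (q - 1) = X q := by rw [← hX.periodic (q - 1), sub_add_cancel]
  obtain ⟨s, u, h1, h3, h4, h5, h6, h7, -⟩ := exists_dip
    (f := fun t => ε * bil ε (X m) (X t)) (by fun_prop) (s := q - 1) (t := m) (u := q)
    (v := ε * (2 * k ^ 2 - 1)) (by linarith) hmq (by simp only [hper]; linarith) (by linarith)
    (by rw [(hX.isPt m).1]; linarith)
  have hs : q - 1 < s := lt_of_le_of_ne h1 (by rintro rfl; rw [hper] at h6; linarith)
  obtain ⟨g, hg, hgm⟩ := hX.exists_iso hε m
  obtain ⟨hn1, hnx⟩ := hn.coords hε hg hgm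
  -- The tangent disc at `X m` has only one point at the distance of its diameter from `X m`, the
  -- opposite one. So both crossings are this point, against injectivity.
  have key : ∀ t, m < t → t < m + 1 → ε * bil ε (X m) (X t) = ε * (2 * k ^ 2 - 1) →
      g (X t) = ![2 * k ^ 2 - 1, 2 * k * S * g n 1, 2 * k * S * g n 2] := by
    intro t ht1 ht2 ht3
    have h8 := hX.bil_center_le hε hC₀ hS₀ hCS ht1 ht2 hk0 hS hk2.le hkS hn ht3.ge
    have h9 := (hg.pos _ (hX.isPt t)).1
    rw [bil_add_left, bil_smul_left, bil_smul_left] at h8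
    have ht4 : bil ε (X m) (X t) = 2 * k ^ 2 - 1 :=
      mul_left_cancel₀ (by rcases hε with rfl | rfl <;> norm_num) ht3
    have ht5 : g (X t) 0 = 2 * k ^ 2 - 1 := by rw [← bil_e₀ ε (g (X t)), ← hgm, hg.bil, ht4]
    have h10 := hnx (X t)
    obtain ⟨a, ha⟩ : ∃ a, a = 2 * k * S := ⟨_, rfl⟩
    have ha0 : 0 < a := by rw [ha]; positivity
    have h11 : a ≤ g n 1 * g (X t) 1 + g n 2 * g (X t) 2 := by
      rw [← h10, ha]
      have e : S * (2 * k * S) ≤ S * (ε * bil ε n (X t)) := by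
        rw [ht4] at h8
        have : S * (2 * k * S) = ε * k * (2 - 2 * k ^ 2) := by
          linear_combination 2 * k * hS2
        linarith
      exact le_of_mul_le_mul_left e hS
    have h12 : g (X t) 1 ^ 2 + g (X t) 2 ^ 2 = a ^ 2 := by
      simp only [bil, ht5] at h9
      rw [ha]
      linear_combination ε * h9 - (g (X t) 1 ^ 2 + g (X t) 2 ^ 2) * h2 - 4 * k ^ 2 * hS2
    have h13 : (g (X t) 1 - a * g n 1) ^ 2 + (g (X t) 2 - a * g n 2) ^ 2 ≤ 0 := by
      have e : (g (X t) 1 - a * g n 1) ^ 2 + (g (X t) 2 - a * g n 2) ^ 2 =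
        2 * a * (a - (g n 1 * g (X t) 1 + g n 2 * g (X t) 2)) := by
        linear_combination h12 + a ^ 2 * hn1
      rw [e]
      exact mul_nonpos_of_nonneg_of_nonpos (by positivity) (by linarith)
    have h14 : g (X t) 1 = a * g n 1 := by
      have := sq_nonneg (g (X t) 2 - a * g n 2)
      have := pow_eq_zero_iff (two_ne_zero) |>.1 (le_antisymm (by linarith) (sq_nonneg
        (g (X t) 1 - a * g n 1)))
      linarith
    have h15 : g (X t) 2 = a * g n 2 := by
      have := sq_nonneg (g (X t) 1 - a * g n 1)
      have := pow_eq_zero_iff (two_ne_zero) |>.1 (le_antisymm (by linarith) (sq_nonneg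
        (g (X t) 2 - a * g n 2)))
      linarith
    rw [ha] at h14 h15
    ext i
    fin_cases i
    · exact ht5
    · exact h14
    · exact h15
  have hs' := key (s + 1) (by linarith) (by linarith) (by rw [hX.periodic]; exact h6)
  have hu' := key u h4 (by linarith) h7
  rw [hX.periodic, ← hu'] at hs'
  exact (hX.map hε hg).injective s u (by linarith) (by linarith) hs'

/-- The curve lies in the tangent disc. -/
theorem IsCurved.le_bil_center {ε C₀ S₀ : ℝ} (hε : ε = 1 ∨ ε = -1) (hC₀ : 0 < C₀)
    (hS₀ : 0 < S₀) (hCS : S₀ ^ 2 = ε * (1 - C₀ ^ 2)) {X : ℝ → Vec} (hX : IsCurved ε (C₀ / S₀) X)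
    {m : ℝ} {n : Vec} (hn : IsSupport ε X (X m) n) (t : ℝ) :
    ε * C₀ ≤ ε * bil ε (C₀ • X m + S₀ • n) (X t) := by
  have h2 := sq_of_sign hε
  have hper : X t = X (m + Int.fract (t - m)) := by
    have h : Function.Periodic X 1 := hX.periodic
    rw [← h.sub_int_mul_eq (x := t) ⌊t - m⌋]
    congr 1
    rw [Int.fract]; ring
  rw [hper]
  rcases (Int.fract_nonneg (t - m)).eq_or_lt with h0 | h0
  · rw [← h0, add_zero, bil_add_left, bil_smul_left, bil_smul_left, (hX.isPt m).1,
      bil_comm ε n, hn.bil_eq_zero]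
    linarith
  · have h1 := Int.fract_lt_one (t - m)
    refine hX.bil_center_le hε hC₀ hS₀ hCS (by linarith) (by linarith) hC₀ hS₀ le_rfl
      (by rw [hCS]; linear_combination (1 - C₀ ^ 2) * h2) hn ?_
    -- Radii decreasing to `R₀`: the sign in `C₀ - ε * θ` makes them larger in both geometries.
    have hev : ∀ᶠ θ in nhdsWithin (0 : ℝ) (Set.Ioi 0), ε * (2 * (C₀ - ε * θ) ^ 2 - 1) ≤
        ε * bil ε (X m) (X (m + Int.fract (t - m))) := by
      have h3 : ∀ᶠ θ in nhdsWithin (0 : ℝ) (Set.Ioi 0), 0 < C₀ - ε * θ :=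
        nhdsWithin_le_nhds ((show Continuous fun θ => C₀ - ε * θ by
          fun_prop).continuousAt.eventually (lt_mem_nhds (by simpa using hC₀)))
      filter_upwards [h3, self_mem_nhdsWithin] with θ h4 h5
      have h5 : 0 < θ := h5
      exact (hX.lt_bil hε hC₀ hS₀ hCS (by linarith) (by linarith) h4 (by nlinarith) hn).le
    have h6 : Continuous fun θ => ε * (2 * (C₀ - ε * θ) ^ 2 - 1) := by fun_prop
    have := le_of_tendsto (h6.continuousAt.tendsto.mono_left nhdsWithin_le_nhds) hev
    simpa using this

/-- The form is nondegenerate, so the map is injective, and the dimension is finite. -/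
lemma IsIso.surjective {ε : ℝ} (hε : ε = 1 ∨ ε = -1) {g : Vec →ₗ[ℝ] Vec} (hg : IsIso ε g) :
    Function.Surjective g := by
  rw [← LinearMap.injective_iff_surjective, injective_iff_map_eq_zero]
  intro x hx
  have h : ∀ y, CayleyKlein.bil ε x y = 0 := fun y => by
    rw [← hg.bil, hx]; simp [CayleyKlein.bil]
  have hε0 : ε ≠ 0 := by rcases hε with rfl | rfl <;> norm_num
  ext i
  fin_cases i
  · simpa [CayleyKlein.bil] using h ![1, 0, 0]
  · simpa [CayleyKlein.bil, hε0] using h ![0, 1, 0]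
  · simpa [CayleyKlein.bil, hε0] using h ![0, 0, 1]

/-- Existence of support lines. -/
theorem IsCurved.exists_isSupport {ε C₀ S₀ : ℝ} (hε : ε = 1 ∨ ε = -1) (hC₀ : 0 < C₀)
    (hS₀ : 0 < S₀) (hCS : S₀ ^ 2 = ε * (1 - C₀ ^ 2)) {X : ℝ → Vec} (hX : IsCurved ε (C₀ / S₀) X)
    (m : ℝ) : ∃ n, IsSupport ε X (X m) n := by
  have h2 := sq_of_sign hε
  obtain ⟨g, hg, hgm⟩ := hX.exists_iso hε m
  have hZ := (hX.map hε hg).shift m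
  have hZ0 : g (X (0 + m)) = e₀ := by rw [zero_add, hgm]
  obtain ⟨u, hu, hstr⟩ := hZ.exists_isStraight hε (div_pos hC₀ hS₀) hZ0
  obtain ⟨n, hn⟩ := hg.surjective hε (tangent (Complex.I * u))
  have hdet : ∀ x, ε * bil ε n x = det e₀ (tangent u) (g x) := fun x => by
    rw [← hg.bil, hn]
    simp [bil, tangent, det, e₀]
    linear_combination (u.re * g x 2 - u.im * g x 1) * h2
  -- A point strictly to the right of the right tangent would also be to the right of all short
  -- chords from the base point, against convexity.
  have hpos : ∀ w, 0 < w → w < 1 → 0 ≤ det e₀ (tangent u) (g (X (w + m))) := by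
    intro w hw0 hw1
    by_contra! hneg
    have hc : Continuous fun q => det e₀ q (g (X (w + m))) := by fun_prop
    obtain ⟨κ, hκ, hev⟩ := Metric.eventually_nhds_iff.1
      (hc.continuousAt.eventually (gt_mem_nhds hneg))
    obtain ⟨δ, hδ, -, hs⟩ := hstr (κ / 2) (by linarith)
    obtain ⟨t, ht0, ht1⟩ := exists_between (lt_min hδ hw0)
    rw [lt_min_iff] at ht1
    obtain ⟨a, ha, q, hq1, hq2⟩ := hs.direction.exists_eq ⟨le_rfl, hδ⟩ ⟨ht0.le, ht1.1⟩ ht0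
    have h3 := hev (y := q) (by rw [dist_eq_norm]; linarith)
    have h4 := hZ.convex hε hC₀ hS₀ hCS ht0 ht1.2 (by linarith)
    simp only [hZ0] at h4 hq1
    rw [sub_eq_iff_eq_add'.1 hq1, det_cycle, det_add_right, det_smul_right] at h4
    simp only [det_self_right, zero_add] at h4
    rw [← det_cycle] at h4
    have := pos_of_mul_pos_right h4 ha.le
    linarith
  refine ⟨n, ?_, ?_, fun t => ?_⟩
  · rw [← hg.bil, hgm, hn, bil_e₀]; simp [tangent]
  · rw [← hg.bil, hn]
    have : u.re ^ 2 + u.im ^ 2 = 1 := by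
      have := Complex.sq_norm u
      rw [hu, Complex.normSq_apply] at this
      linarith
    simp [bil, tangent]
    linear_combination ε * this
  · have hper : X t = X (Int.fract (t - m) + m) := by
      have h : Function.Periodic X 1 := hX.periodic
      rw [← h.sub_int_mul_eq (x := t) ⌊t - m⌋]
      congr 1
      rw [Int.fract]; ring
    rw [hper, hdet]
    rcases (Int.fract_nonneg (t - m)).eq_or_lt with h0 | h0
    · rw [← h0, hZ0]; simp
    · exact hpos _ h0 (Int.fract_lt_one _)

/-! ### Curves in models of the space forms -/

open SpaceForm

/-- The list has two more entries than there are inner vertices, so the default value of `getD` is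
never read. -/
lemma sum_range_getD (f : ℝ → ℝ → ℝ → ℝ) (x y : ℝ) (l : List ℝ) :
    ∑ i ∈ Finset.range l.length, f ((x :: y :: l).getD i 0) ((x :: y :: l).getD (i + 1) 0)
      ((x :: y :: l).getD (i + 2) 0) = tripleSum f (x :: y :: l) := by
  induction l generalizing x y with
  | nil => simp [tripleSum]
  | cons z l ih =>
    rw [List.length_cons, Finset.sum_range_succ', tripleSum, ← ih y z, add_comm]
    rfl

lemma IsFine.tripleSum_congr {f g : ℝ → ℝ → ℝ → ℝ} {δ a b A : ℝ} {l : List ℝ}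
    (h : IsFine δ (a :: (l ++ [b]))) (hA : A ≤ a)
    (hfg : ∀ p q r, A ≤ p → p < q → q < r → r ≤ b → f p q r = g p q r) :
    tripleSum f (a :: (l ++ [b])) = tripleSum g (a :: (l ++ [b])) := by
  induction l generalizing a with
  | nil => simp [tripleSum]
  | cons c l ih =>
    have h' := isFine_cons_cons.1 h
    cases l with
    | nil =>
      have h'' := isFine_cons_cons.1 h'.2
      simp [tripleSum, hfg a c b hA h'.1.1 h''.1.1 le_rfl]
    | cons d l =>
      have h'' := isFine_cons_cons.1 h'.2
      have e := ih h'.2 (hA.trans h'.1.1.le)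
      simp only [List.cons_append] at e ⊢
      rw [tripleSum, tripleSum, e, hfg a c d hA h'.1.1 h''.1.1 h''.2.lt.le]

lemma IsFine.pairSum_le {M : Type} [MetricSpace M] {γ : ℝ → M} {g : ℝ → ℝ → ℝ} {δ a b A K : ℝ}
    {l : List ℝ} (h : IsFine δ (a :: (l ++ [b]))) (hA : A ≤ a) (hK : 0 ≤ K)
    (hg : ∀ p q, A ≤ p → p < q → q < p + δ → q ≤ b → g p q ≤ K * dist (γ p) (γ q)) :
    ENNReal.ofReal (pairSum g (a :: (l ++ [b]))) ≤
      ENNReal.ofReal K * eVariationOn γ (Set.Icc a b) := by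
  have key : ∀ p q, A ≤ p → p < q → q < p + δ → q ≤ b →
      ENNReal.ofReal (g p q) ≤ ENNReal.ofReal K * eVariationOn γ (Set.Icc p q) := by
    intro p q h1 h2 h3 h4
    calc ENNReal.ofReal (g p q) ≤ ENNReal.ofReal (K * dist (γ p) (γ q)) :=
          ENNReal.ofReal_le_ofReal (hg p q h1 h2 h3 h4)
      _ = ENNReal.ofReal K * edist (γ p) (γ q) := by rw [ENNReal.ofReal_mul hK, edist_dist]
      _ ≤ _ := by
          gcongr
          exact eVariationOn.edist_le _ ⟨le_rfl, h2.le⟩ ⟨h2.le, le_rfl⟩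
  induction l generalizing a with
  | nil =>
    have h' := isFine_cons_cons.1 h
    simpa [pairSum] using key a b hA h'.1.1 h'.1.2 le_rfl
  | cons c l ih =>
    have h' := isFine_cons_cons.1 h
    have hcb : c < b := h'.2.lt
    have e := eVariationOn.Icc_add_Icc γ (s := Set.univ) h'.1.1.le hcb.le (Set.mem_univ _)
    simp only [Set.univ_inter] at e
    rw [List.cons_append, pairSum, ← e, mul_add]
    exact ENNReal.ofReal_add_le.trans
      (add_le_add (key a c hA h'.1.1 h'.1.2 hcb.le) (ih h'.2 (hA.trans h'.1.1.le)))

/-- Equal fractional parts mean an integer difference, and there is no integer strictly between `-1`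
and `0`. -/
lemma injective_of_injOn {M : Type} {γ : ℝ → M} (hp : Function.Periodic γ 1)
    (hi : Set.InjOn γ (Set.Ico 0 1)) {s t : ℝ} (hst : s < t) (ht : t < s + 1) : γ s ≠ γ t := by
  have hfr : ∀ x, γ (Int.fract x) = γ x := fun x => by
    have := hp.sub_int_mul_eq (x := x) ⌊x⌋
    rwa [mul_one] at this
  intro h
  rw [← hfr s, ← hfr t] at h
  obtain ⟨z, hz⟩ := Int.fract_eq_fract.1 (hi ⟨Int.fract_nonneg _, Int.fract_lt_one _⟩
    ⟨Int.fract_nonneg _, Int.fract_lt_one _⟩ h)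
  have h1 : ((-1 : ℤ) : ℝ) < z := by push_cast; linarith
  have h2 : (z : ℝ) < (0 : ℤ) := by push_cast; linarith
  have h1 := Int.cast_lt.1 h1
  have h2 := Int.cast_lt.1 h2
  omega

/-- Curves of bounded specific curvature in a model of a space form. -/
theorem isCurved_of_specificCurvatureGE {ε k : ℝ} (hk : 0 < k) {M : Type} [MetricSpace M]
    {turnM : M → M → M → ℝ} {γ : ℝ → M} {v : M → Vec} (hv : Continuous v)
    (hvi : Function.Injective v) (hpt : ∀ p, IsPt ε (v p))
    (hturn : ∀ p q r, p ≠ q → q ≠ r → turnM p q r = turn ε (v p) (v q) (v r))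
    (hchord : ∀ η > 0, ∃ θ > 0, ∀ p q, dist p q < θ → chord ε (v p) (v q) ≤ (1 + η) * dist p q)
    (hγ : IsClosedEmbeddedRectifiable γ) (hs : SpecificCurvatureGE turnM γ k) :
    IsCurved ε k fun t => v (γ t) where
  continuous := hv.comp hγ.continuous
  isPt t := hpt _
  periodic t := by rw [hγ.periodic t]
  injective s t hst ht h := injective_of_injOn hγ.periodic hγ.injOn hst ht (hvi h)
  swerve a b hab hb := by
    obtain ⟨τ, hτ, hle⟩ := hs a b hab hb
    obtain ⟨ℓ, hℓ⟩ : ∃ ℓ, ℓ = arcLength γ a b := ⟨_, rfl⟩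
    rw [← hℓ] at hle
    -- A quotient by zero is zero, below `k`; so the length is nonzero. As `toReal ⊤ = 0`, this also
    -- makes the variation finite.
    have hℓ0 : 0 < ℓ := by
      refine lt_of_le_of_ne (hℓ ▸ ENNReal.toReal_nonneg) fun h => ?_
      rw [← h, div_zero] at hle
      linarith
    have hfin : eVariationOn γ (Set.Icc a b) = ENNReal.ofReal ℓ := by
      rw [hℓ, arcLength, ENNReal.ofReal_toReal]
      intro h
      rw [hℓ, arcLength, h] at hℓ0
      simp at hℓ0
    refine ⟨τ, ℓ, hℓ0, by rwa [le_div_iff₀ hℓ0] at hle, fun η hη => ?_, fun η hη => ?_⟩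
    · obtain ⟨δ, hδ, h⟩ := hτ η hη
      refine ⟨δ, hδ, fun l hl => ?_⟩
      have h1 := h l.length (fun i => (a :: (l ++ [b])).getD i 0) (by simp) (by simp)
        (fun i hi => by
          have h2 := List.isChain_iff_getElem.1 hl i (by simp; omega)
          have e1 : (a :: (l ++ [b])).getD i 0 = (a :: (l ++ [b]))[i]'(by simp; omega) :=
            List.getD_eq_getElem _ _ _
          have e2 : (a :: (l ++ [b])).getD (i + 1) 0 = (a :: (l ++ [b]))[i + 1]'(by simp; omega) :=
            List.getD_eq_getElem _ _ _
          simp only [e1, e2]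
          exact h2)
      have h3 : ∑ i ∈ Finset.range l.length, turnM (γ ((a :: (l ++ [b])).getD i 0))
          (γ ((a :: (l ++ [b])).getD (i + 1) 0)) (γ ((a :: (l ++ [b])).getD (i + 2) 0)) =
          tripleSum (fun p q r => turnM (γ p) (γ q) (γ r)) (a :: (l ++ [b])) := by
        cases l with
        | nil => simp [tripleSum]
        | cons c l =>
          have := sum_range_getD (fun p q r => turnM (γ p) (γ q) (γ r)) a c (l ++ [b])
          rw [List.length_append] at this
          exact this
      rw [h3] at h1
      rwa [← hl.tripleSum_congr le_rfl (f := fun p q r => turnM (γ p) (γ q) (γ r))]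
      intro p q r h4 h5 h6 h7
      exact hturn _ _ _ (injective_of_injOn hγ.periodic hγ.injOn h5 (by linarith))
        (injective_of_injOn hγ.periodic hγ.injOn h6 (by linarith))
    -- Chords exceed distances by a factor of at most `1 + η / ℓ`, and `(1 + η / ℓ) * ℓ = ℓ + η`.
    · obtain ⟨θ, hθ, hch⟩ := hchord (η / ℓ) (by positivity)
      obtain ⟨δ, hδ, hunif⟩ := Metric.uniformContinuousOn_iff.1
        ((isCompact_Icc (a := a) (b := b)).uniformContinuousOn_of_continuous
          hγ.continuous.continuousOn) θ hθ
      refine ⟨δ, hδ, fun l hl => ?_⟩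
      have h1 := hl.pairSum_le (γ := γ) (g := fun p q => chord ε (v (γ p)) (v (γ q))) le_rfl
        (K := 1 + η / ℓ) (by positivity) fun p q h1 h2 h3 h4 => hch _ _ (hunif p ⟨h1, by linarith⟩ q
          ⟨by linarith, h4⟩ (by rw [dist_comm, Real.dist_eq, abs_of_pos (by linarith)]; linarith))
      rw [hfin, ← ENNReal.ofReal_mul (by positivity),
        ENNReal.ofReal_le_ofReal_iff (by positivity)] at h1
      refine h1.trans_eq ?_
      field_simp

/-- The centre is reached from `p` along the unit normal. On the line orthogonal to `n`, its product
with `x` is `C₀ * bil ε p x`, so only `p` itself is at the right distance. -/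
lemma tangentCenter {ε C₀ S₀ : ℝ} (hε : ε = 1 ∨ ε = -1) (hC₀ : 0 < C₀)
    (hCS : S₀ ^ 2 = ε * (1 - C₀ ^ 2)) {p n : Vec} (hp : IsPt ε p) (hpn : bil ε p n = 0)
    (hn : bil ε n n = ε) : IsPt ε (C₀ • p + S₀ • n) ∧ ε * bil ε n (C₀ • p + S₀ • n) = S₀ ∧
      ∀ x, IsPt ε x → bil ε n x = 0 → (bil ε (C₀ • p + S₀ • n) x = C₀ ↔ x = p) := by
  have h2 := sq_of_sign hε
  have hnp : bil ε n p = 0 := by rw [bil_comm, hpn]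
  obtain ⟨c, hc⟩ : ∃ c, c = C₀ • p + S₀ • n := ⟨_, rfl⟩
  have hcc : bil ε c c = 1 := by
    rw [hc]
    simp only [bil_add_left, bil_add_right, bil_smul_left, bil_smul_right, hpn, hnp, hn, hp.1]
    linear_combination ε * hCS + (1 - C₀ ^ 2) * h2
  have hcp : bil ε c p = C₀ := by
    rw [hc, bil_add_left, bil_smul_left, bil_smul_left, hnp, hp.1]; ring
  refine ⟨hc ▸ ⟨hcc, ?_⟩, ?_, fun x hx hnx => ?_⟩
  · rintro rfl
    by_contra! hneg
    -- On the lower sheet `-c` would be a point with a negative product with `p`, but such products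
    -- are at least `1`.
    rcases hneg.lt_or_eq with hneg | h0
    · have hm : IsPt (-1) ((-1 : ℝ) • c) := by
        refine ⟨?_, fun _ => by simpa using hneg⟩
        rw [bil_smul_left, bil_smul_right, hcc]; norm_num
      have := one_le_bil hm hp
      rw [bil_smul_left, hcp] at this
      linarith
    · simp only [bil, h0] at hcc
      nlinarith [sq_nonneg (c 1), sq_nonneg (c 2)]
  · rw [bil_add_right, bil_smul_right, bil_smul_right, hnp, hn]
    linear_combination S₀ * h2
  · rw [bil_add_left, bil_smul_left, bil_smul_left, hnx, mul_zero, add_zero]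
    constructor
    · intro h
      refine ((bil_cases hε hp hx).2 ?_).symm
      exact mul_left_cancel₀ hC₀.ne' (by rw [h, mul_one])
    · rintro rfl
      rw [hp.1, mul_one]

/-- Transfer of the result on support lines and tangent discs to a model of a space form. -/
theorem support_and_disc {ε C₀ S₀ : ℝ} (hε : ε = 1 ∨ ε = -1) (hC₀ : 0 < C₀) (hS₀ : 0 < S₀)
    (hCS : S₀ ^ 2 = ε * (1 - C₀ ^ 2)) {M : Type} [MetricSpace M] {γ : ℝ → M} {v : M → Vec}
    (hvi : Function.Injective v) (hpt : ∀ p, IsPt ε (v p)) (hsurj : ∀ x, IsPt ε x → ∃ p, v p = x)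
    {d : M → M → ℝ} {R : ℝ} (hd : ∀ p q, d p q = R ↔ bil ε (v p) (v q) = C₀)
    (hd' : ∀ p q, ε * C₀ ≤ ε * bil ε (v p) (v q) → d p q ≤ R) {IsLine : (M → ℝ) → Prop}
    (hline : ∀ n, bil ε n n = ε → ∃ f, IsLine f ∧ ∃ ρ : M → ℝ, (∀ x, 0 < ρ x) ∧
      ∀ x, f x = ρ x * (ε * bil ε n (v x)))
    (hline' : ∀ f, IsLine f → ∃ n, bil ε n n = ε ∧ ∃ ρ : M → ℝ, (∀ x, 0 < ρ x) ∧
      ∀ x, f x = ρ x * (ε * bil ε n (v x)))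
    (hX : IsCurved ε (C₀ / S₀) fun t => v (γ t)) (t : ℝ) :
    (∃ f, IsSupportLine IsLine γ (γ t) f) ∧
      ∀ f, IsSupportLine IsLine γ (γ t) f → LiesInTangentDisc d γ (γ t) f R := by
  have hε0 : ε ≠ 0 := by rcases hε with rfl | rfl <;> norm_num
  constructor
  · obtain ⟨n, hn⟩ := hX.exists_isSupport hε hC₀ hS₀ hCS t
    obtain ⟨f, hf, ρ, hρ, hfx⟩ := hline n hn.bil_self
    refine ⟨f, hf, ?_, fun s => ?_⟩
    · rw [hfx, bil_comm, hn.bil_eq_zero, mul_zero, mul_zero]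
    · rw [hfx]; exact mul_nonneg (hρ _).le (hn.nonneg s)
  · rintro f ⟨hf, hf0, hfs⟩
    obtain ⟨n, hn, ρ, hρ, hfx⟩ := hline' f hf
    have hzero : ∀ x, f x = 0 ↔ bil ε n (v x) = 0 := fun x => by
      rw [hfx, mul_eq_zero, mul_eq_zero, or_iff_right (hρ x).ne', or_iff_right hε0]
    have hpn : bil ε (v (γ t)) n = 0 := by rw [bil_comm]; exact (hzero _).1 hf0
    have hsup : IsSupport ε (fun t => v (γ t)) (v (γ t)) n := by
      refine ⟨hpn, hn, fun s => ?_⟩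
      have := hfs s
      rw [hfx] at this
      exact nonneg_of_mul_nonneg_right this (hρ _)
    obtain ⟨hc, hnc, huniq⟩ := tangentCenter hε hC₀ hCS (hpt (γ t)) hpn hn
    obtain ⟨c, hvc⟩ := hsurj _ hc
    refine ⟨c, ?_, ?_, fun s => hd' _ _ ?_⟩
    · rw [hfx, hvc, hnc]; exact (mul_pos (hρ _) hS₀).le
    · ext x
      simp only [Set.mem_inter_iff, Set.mem_ofPred_eq, Set.mem_singleton_iff]
      rw [hzero, hd, hvc]
      constructor
      · rintro ⟨h1, h2⟩
        exact hvi ((huniq _ (hpt x) h1).1 h2)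
      · rintro rfl
        have h1 : bil ε n (v (γ t)) = 0 := by rw [bil_comm, hpn]
        exact ⟨h1, (huniq _ (hpt _) h1).2 rfl⟩
    · rw [hvc]; exact hX.le_bil_center hε hC₀ hS₀ hCS hsup s

/-! ### The upper half-plane -/

open SpaceForm

/-- The isometry of the upper half-plane to the hyperboloid. -/
def hypVec (z : ℍ) : Vec :=
  ![(Complex.normSq (z : ℂ) + 1) / (2 * z.im), (Complex.normSq (z : ℂ) - 1) / (2 * z.im),
    -z.re / z.im]

lemma normSq_coe (z : ℍ) : Complex.normSq (z : ℂ) = z.re ^ 2 + z.im ^ 2 := by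
  rw [Complex.normSq_apply, UpperHalfPlane.coe_re, UpperHalfPlane.coe_im]; ring

lemma continuous_hypVec : Continuous hypVec := by
  have h1 : Continuous fun z : ℍ => z.im := UpperHalfPlane.continuous_im
  have h2 : Continuous fun z : ℍ => z.re := UpperHalfPlane.continuous_re
  refine continuous_pi fun i => ?_
  fin_cases i
  · simp only [hypVec, normSq_coe]
    exact ((h2.pow 2).add (h1.pow 2) |>.add continuous_const).div (continuous_const.mul h1)
      fun z => mul_ne_zero two_ne_zero z.im_pos.ne'
  · simp only [hypVec, normSq_coe]
    exact ((h2.pow 2).add (h1.pow 2) |>.sub continuous_const).div (continuous_const.mul h1)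
      fun z => mul_ne_zero two_ne_zero z.im_pos.ne'
  · exact h2.neg.div h1 fun z => z.im_pos.ne'

lemma bil_hypVec (z w : ℍ) : bil (-1) (hypVec z) (hypVec w) = Real.cosh (dist z w) := by
  have hz := z.im_pos.ne'
  have hw := w.im_pos.ne'
  rw [UpperHalfPlane.cosh_dist, Complex.dist_eq, Complex.sq_norm, Complex.normSq_apply]
  simp only [Complex.sub_re, Complex.sub_im, UpperHalfPlane.coe_re, UpperHalfPlane.coe_im, bil,
    hypVec, normSq_coe, Matrix.cons_val]
  field_simp
  ring

lemma isPt_hypVec (z : ℍ) : IsPt (-1) (hypVec z) := by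
  refine ⟨by rw [bil_hypVec, dist_self, Real.cosh_zero], fun _ => ?_⟩
  have := z.im_pos
  have := Complex.normSq_nonneg (z : ℂ)
  simp only [hypVec, Matrix.cons_val]
  positivity

lemma bil_hypVec_eq_iff {R : ℝ} (hR : 0 ≤ R) (z w : ℍ) :
    dist z w = R ↔ bil (-1) (hypVec z) (hypVec w) = Real.cosh R := by
  rw [bil_hypVec]
  exact ⟨fun h => by rw [h], fun h => Real.cosh_strictMonoOn.injOn dist_nonneg hR h⟩

lemma hypVec_injective : Function.Injective hypVec := fun z w h => by
  rw [← dist_eq_zero, bil_hypVec_eq_iff le_rfl, h, (isPt_hypVec w).1, Real.cosh_zero]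

lemma exists_hypVec_eq (x : Vec) (hx : IsPt (-1) x) : ∃ z, hypVec z = x := by
  obtain ⟨h1, h0⟩ := hx
  have h0 := h0 rfl
  simp only [bil] at h1
  have h2 : 0 < x 0 - x 1 := by
    rw [sub_pos]
    refine (abs_lt_of_sq_lt_sq' ?_ h0.le).2
    linarith [sq_nonneg (x 2)]
  have h3 : x 0 + x 1 = (1 + x 2 ^ 2) / (x 0 - x 1) := by
    rw [eq_div_iff h2.ne']; linarith
  refine ⟨⟨⟨-x 2 / (x 0 - x 1), 1 / (x 0 - x 1)⟩, by simpa using h2⟩, ?_⟩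
  ext i
  fin_cases i
  · simp [hypVec, Complex.normSq_apply]
    field_simp
    linarith
  · simp [hypVec, Complex.normSq_apply]
    field_simp
    linarith
  · simp [hypVec]
    field_simp

/-- Both sides have the argument of the exterior angle: the left one is the quotient of the
directions cleared of squared moduli. The sign of the last coordinate of `hypVec` makes left turns
correspond to positive determinants. -/
lemma hypDir_mul (p q r : ℍ) :
    -(((r : ℂ) - q) * (starRingEnd ℂ (r : ℂ) - q) *
      ((p : ℂ) - starRingEnd ℂ (q : ℂ)) * (starRingEnd ℂ (p : ℂ) - starRingEnd ℂ (q : ℂ))) =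
    ((4 * p.im * r.im * q.im ^ 2 : ℝ) : ℂ) * turnC (-1) (hypVec p) (hypVec q) (hypVec r) := by
  have hp := p.im_pos.ne'
  have hq := q.im_pos.ne'
  have hr := r.im_pos.ne'
  apply Complex.ext
  · rw [Complex.re_ofReal_mul]
    simp only [turnC, bil, hypVec, normSq_coe, Matrix.cons_val, Complex.neg_re, Complex.mul_re,
      Complex.mul_im, Complex.sub_re, Complex.sub_im, Complex.conj_re, Complex.conj_im,
      UpperHalfPlane.coe_re, UpperHalfPlane.coe_im]
    field_simp
    ring
  · rw [Complex.im_ofReal_mul]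
    simp only [turnC, det, hypVec, normSq_coe, Matrix.cons_val, Complex.neg_im, Complex.mul_re,
      Complex.mul_im, Complex.sub_re, Complex.sub_im, Complex.conj_re, Complex.conj_im,
      UpperHalfPlane.coe_re, UpperHalfPlane.coe_im]
    field_simp
    ring

lemma hypTurn_eq (p q r : ℍ) (hpq : p ≠ q) (_ : q ≠ r) :
    hypTurn p q r = turn (-1) (hypVec p) (hypVec q) (hypVec r) := by
  have h1 : (p : ℂ) - q ≠ 0 := sub_ne_zero.2 fun h => hpq (UpperHalfPlane.ext h)
  have him : ∀ z : ℍ, (z : ℂ) - starRingEnd ℂ (q : ℂ) ≠ 0 := fun z h => by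
    have := congrArg Complex.im h
    simp at this
    linarith [z.im_pos, q.im_pos]
  have hc : ∀ z w : ℂ, starRingEnd ℂ z - w = starRingEnd ℂ (z - starRingEnd ℂ w) := by simp
  have e : hypDir q r / -hypDir q p =
      (((Complex.normSq ((r : ℂ) - starRingEnd ℂ (q : ℂ)) * Complex.normSq ((p : ℂ) - q))⁻¹ *
        (4 * p.im * r.im * q.im ^ 2) : ℝ) : ℂ) *
        turnC (-1) (hypVec p) (hypVec q) (hypVec r) := by
    rw [Complex.ofReal_mul, mul_assoc, ← hypDir_mul, Complex.ofReal_inv, Complex.ofReal_mul,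
      Complex.normSq_eq_conj_mul_self, Complex.normSq_eq_conj_mul_self, hypDir, hypDir, map_sub,
      map_sub, Complex.conj_conj]
    have h2 := him p
    have h3 := him r
    have h4 : starRingEnd ℂ (r : ℂ) - q ≠ 0 := by
      rw [hc]; exact (map_ne_zero _).2 h3
    have h5 : starRingEnd ℂ (p : ℂ) - starRingEnd ℂ (q : ℂ) ≠ 0 := by
      rw [← map_sub]; exact (map_ne_zero _).2 h1
    have hI := Complex.I_ne_zero
    field_simp
  have h6 : 0 < (Complex.normSq ((r : ℂ) - starRingEnd ℂ (q : ℂ)) *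
      Complex.normSq ((p : ℂ) - q))⁻¹ * (4 * p.im * r.im * q.im ^ 2) := by
    have := p.im_pos
    have := q.im_pos
    have := r.im_pos
    have := Complex.normSq_pos.2 h1
    have := Complex.normSq_pos.2 (him r)
    positivity
  rw [hypTurn, e, Complex.arg_real_mul _ h6, turn]

lemma exists_sinh_le {η : ℝ} (hη : 0 < η) :
    ∃ θ > 0, ∀ x, 0 ≤ x → x < θ → Real.sinh x ≤ (1 + η) * x := by
  have h := (hasDerivAt_iff_isLittleO.1 (Real.hasDerivAt_sinh 0)).def hη
  obtain ⟨θ, hθ, h⟩ := Metric.eventually_nhds_iff.1 h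
  refine ⟨θ, hθ, fun x hx0 hx => ?_⟩
  have h1 := h (y := x) (by rwa [Real.dist_eq, sub_zero, abs_of_nonneg hx0])
  simp only [Real.sinh_zero, sub_zero, Real.cosh_zero, smul_eq_mul, mul_one, Real.norm_eq_abs,
    abs_of_nonneg hx0] at h1
  linarith [le_abs_self (Real.sinh x - x)]

lemma chord_hypVec (z w : ℍ) :
    chord (-1) (hypVec z) (hypVec w) = 2 * Real.sinh (dist z w / 2) := by
  rw [chord, bil_hypVec]
  have h : Real.cosh (dist z w) = 2 * Real.sinh (dist z w / 2) ^ 2 + 1 := by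
    rw [← mul_div_cancel₀ (dist z w) (two_ne_zero' ℝ), Real.cosh_two_mul, Real.cosh_sq,
      mul_div_cancel_left₀ _ (two_ne_zero' ℝ)]
    ring
  rw [h, show 2 * (-1 * (1 - (2 * Real.sinh (dist z w / 2) ^ 2 + 1))) =
    (2 * Real.sinh (dist z w / 2)) ^ 2 by ring, Real.sqrt_sq]
  have := Real.sinh_nonneg_iff.2 (show 0 ≤ dist z w / 2 by positivity)
  positivity

/-- The quadratic equation of a line is linear on the hyperboloid; `D ^ 2 = B ^ 2 - 4 * A * C` makes
its normal vector a unit vector. -/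
lemma hypLine_eq {A B C D : ℝ} (hD : 0 < D) (z : ℍ) :
    A * Complex.normSq (z : ℂ) + B * z.re + C = z.im * D *
      (-1 * bil (-1) ![-(A + C) / D, (A - C) / D, -B / D] (hypVec z)) := by
  have hz := z.im_pos.ne'
  simp only [bil, hypVec, Matrix.cons_val]
  field_simp
  ring

theorem hyperbolic {γ : ℝ → ℍ} {R : ℝ} (hR : 0 < R) (hγ : IsClosedEmbeddedRectifiable γ)
    (hs : SpecificCurvatureGE hypTurn γ (Real.cosh R / Real.sinh R)) (t : ℝ) :
    (∃ f, IsSupportLine IsHypLine γ (γ t) f) ∧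
      ∀ f, IsSupportLine IsHypLine γ (γ t) f → LiesInTangentDisc dist γ (γ t) f R := by
  have hC := Real.cosh_pos R
  have hS := Real.sinh_pos_iff.2 hR
  refine support_and_disc (ε := -1) (Or.inr rfl) hC hS (by rw [Real.cosh_sq]; ring)
    hypVec_injective isPt_hypVec exists_hypVec_eq (bil_hypVec_eq_iff hR.le) (fun p q h => ?_)
    (fun n hn => ?_) (fun f hf => ?_)
    (isCurved_of_specificCurvatureGE (div_pos hC hS) continuous_hypVec hypVec_injective isPt_hypVec
      hypTurn_eq (fun η hη => ?_) hγ hs) t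
  · rw [bil_hypVec] at h
    have h : Real.cosh (dist p q) ≤ Real.cosh R := by linarith
    rwa [Real.cosh_le_cosh, abs_of_nonneg dist_nonneg, abs_of_pos hR] at h
  · simp only [bil] at hn
    refine ⟨_, ⟨(n 1 - n 0) / 2, -n 2, -(n 0 + n 1) / 2, by linarith, fun z => rfl⟩,
      fun z => z.im, fun z => z.im_pos, fun z => ?_⟩
    rw [hypLine_eq one_pos, mul_one]
    congr 3
    ext i
    fin_cases i <;> simp <;> ring
  · obtain ⟨A, B, C, h, hf⟩ := hf
    obtain ⟨D, hD, hD2⟩ : ∃ D : ℝ, 0 < D ∧ D ^ 2 = B ^ 2 - 4 * A * C :=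
      ⟨√(B ^ 2 - 4 * A * C), Real.sqrt_pos.2 (by linarith), Real.sq_sqrt (by linarith)⟩
    refine ⟨_, ?_, fun z => z.im * D, fun z => mul_pos z.im_pos hD,
      fun z => (hf z).trans (hypLine_eq hD z)⟩
    simp only [bil, Matrix.cons_val]
    field_simp
    rw [hD2]
    ring
  · obtain ⟨θ, hθ, h⟩ := exists_sinh_le hη
    refine ⟨θ, hθ, fun p q hpq => ?_⟩
    have h0 : 0 ≤ dist p q := dist_nonneg
    rw [chord_hypVec]
    linarith [h (dist p q / 2) (by linarith) (by linarith)]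

/-! ### The sphere -/

/-- Coordinates of a point of the sphere. -/
def sphVec (p : S2) : Vec := fun i => (p : E3) i

lemma inner_eq_bil (x y : E3) : inner ℝ x y = bil 1 (fun i => x i) (fun i => y i) := by
  rw [PiLp.inner_apply, Fin.sum_univ_three]
  simp [bil]
  ring

lemma inner_sphVec (p q : S2) : inner ℝ (p : E3) (q : E3) = bil 1 (sphVec p) (sphVec q) :=
  inner_eq_bil _ _

lemma isPt_sphVec (p : S2) : IsPt 1 (sphVec p) := by
  refine ⟨?_, fun h => by norm_num at h⟩
  have : ‖(p : E3)‖ = 1 := norm_eq_of_mem_sphere p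
  rw [← inner_sphVec, real_inner_self_eq_norm_sq, this, one_pow]

lemma sphVec_injective : Function.Injective sphVec := fun _ _ h =>
  Subtype.ext (PiLp.ext fun i => congrFun h i)

lemma continuous_sphVec : Continuous sphVec := by
  unfold sphVec; fun_prop

lemma exists_sphVec_eq (x : Vec) (hx : IsPt 1 x) : ∃ p, sphVec p = x := by
  refine ⟨⟨WithLp.toLp 2 x, ?_⟩, rfl⟩
  rw [mem_sphere_zero_iff_norm, ← sq_eq_sq₀ (norm_nonneg _) zero_le_one,
    ← real_inner_self_eq_norm_sq, inner_eq_bil, one_pow]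
  exact hx.1

lemma sphDist_eq (p q : S2) : sphDist p q = Real.arccos (bil 1 (sphVec p) (sphVec q)) := by
  rw [sphDist, InnerProductGeometry.angle, norm_eq_of_mem_sphere p, norm_eq_of_mem_sphere q,
    mul_one, div_one, inner_eq_bil]
  rfl

lemma sphTurn_eq (p q r : S2) : sphTurn p q r = turn 1 (sphVec p) (sphVec q) (sphVec r) := by
  have h := (isPt_sphVec q).1
  rw [sphTurn, turn, turnC]
  congr 2
  · simp only [sphDir, inner_neg_left, inner_sub_left, inner_sub_right, inner_smul_left,
      inner_smul_right, inner_sphVec]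
    rw [h, bil_comm 1 (sphVec q) (sphVec r)]
    simp
  · simp [det3, sphDir, Matrix.det_fin_three, det, sphVec]
    ring

/-- The metric of the sphere is the ambient one, so the chord is the distance itself and the
comparison of lengths is trivial. -/
lemma chord_sphVec (p q : S2) : chord 1 (sphVec p) (sphVec q) = dist p q := by
  rw [Subtype.dist_eq, EuclideanSpace.dist_eq, chord]
  have h1 := (isPt_sphVec p).1
  have h2 := (isPt_sphVec q).1
  congr 1
  simp only [Fin.sum_univ_three, Real.dist_eq, sq_abs]
  simp only [bil, sphVec] at *
  linarith

theorem spherical {γ : ℝ → S2} {R : ℝ} (hR : 0 < R) (hR' : R < Real.pi / 2)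
    (hγ : IsClosedEmbeddedRectifiable γ) (hs : SpecificCurvatureGE sphTurn γ (Real.cot R)) (t : ℝ) :
    (∃ f, IsSupportLine IsSphLine γ (γ t) f) ∧
      ∀ f, IsSupportLine IsSphLine γ (γ t) f → LiesInTangentDisc sphDist γ (γ t) f R := by
  have hC := Real.cos_pos_of_mem_Ioo ⟨by linarith, hR'⟩
  have hS := Real.sin_pos_of_pos_of_lt_pi hR (by linarith)
  rw [Real.cot_eq_cos_div_sin] at hs
  have harc := Real.arccos_cos hR.le (by linarith)
  have hb : ∀ p q : S2, -1 ≤ bil 1 (sphVec p) (sphVec q) ∧ bil 1 (sphVec p) (sphVec q) ≤ 1 := by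
    intro p q
    have h1 := bil_le (Or.inl rfl) (isPt_sphVec p) (isPt_sphVec q)
    have h2 := bil_le (Or.inl rfl) (isPt_sphVec p) (y := (-1 : ℝ) • sphVec q)
      ⟨by rw [bil_smul_left, bil_smul_right, (isPt_sphVec q).1]; norm_num,
        fun h => by norm_num at h⟩
    rw [bil_smul_right] at h2
    constructor <;> linarith
  refine support_and_disc (ε := 1) (Or.inl rfl) hC hS (by rw [Real.sin_sq]; ring)
    sphVec_injective isPt_sphVec exists_sphVec_eq (fun p q => ?_) (fun p q h => ?_)
    (fun n hn => ?_) (fun f hf => ?_)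
    (isCurved_of_specificCurvatureGE (div_pos hC hS) continuous_sphVec sphVec_injective isPt_sphVec
      (fun p q r _ _ => sphTurn_eq p q r) (fun η hη => ?_) hγ hs) t
  · rw [sphDist_eq]
    constructor
    · rintro rfl
      exact (Real.cos_arccos (hb p q).1 (hb p q).2).symm
    · intro h
      rw [h, harc]
  · rw [one_mul, one_mul] at h
    rw [sphDist_eq, ← harc]
    exact Real.arccos_le_arccos h
  · refine ⟨_, ⟨WithLp.toLp 2 n, fun h => ?_, fun x => rfl⟩, fun _ => 1, fun _ => one_pos,
      fun x => ?_⟩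
    · have h0 : n = 0 := by simpa using h
      rw [h0] at hn
      simp [bil] at hn
    · rw [inner_eq_bil, one_mul, one_mul]; rfl
  · obtain ⟨n, hn, hf⟩ := hf
    have hn0 : 0 < ‖n‖ := norm_pos_iff.2 hn
    have e : bil 1 (fun i => n i) (fun i => n i) = ‖n‖ ^ 2 := by
      rw [← inner_eq_bil, real_inner_self_eq_norm_sq]
    refine ⟨‖n‖⁻¹ • fun i => n i, ?_, fun _ => ‖n‖, fun _ => hn0, fun x => ?_⟩
    · rw [bil_smul_left, bil_smul_right, e]
      field_simp
    · rw [hf, inner_eq_bil, bil_smul_left, one_mul, mul_inv_cancel_left₀ hn0.ne']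
      rfl
  · refine ⟨1, one_pos, fun p q _ => ?_⟩
    rw [chord_sphVec]
    have := mul_nonneg hη.le (dist_nonneg (x := p) (y := q))
    linarith

end CayleyKlein

end

open SpaceForm in
theorem lemma2 :
    (∀ (γ : ℝ → ℍ) (R₀ : ℝ), 0 < R₀ → IsClosedEmbeddedRectifiable γ →
      SpecificCurvatureGE hypTurn γ (Real.cosh R₀ / Real.sinh R₀) →
      ∀ t : ℝ, (∃ f, IsSupportLine IsHypLine γ (γ t) f) ∧
        ∀ f, IsSupportLine IsHypLine γ (γ t) f → LiesInTangentDisc dist γ (γ t) f R₀) ∧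
    (∀ (γ : ℝ → S2) (R₀ : ℝ), 0 < R₀ → R₀ < Real.pi / 2 → IsClosedEmbeddedRectifiable γ →
      SpecificCurvatureGE sphTurn γ (Real.cot R₀) →
      ∀ t : ℝ, (∃ f, IsSupportLine IsSphLine γ (γ t) f) ∧
        ∀ f, IsSupportLine IsSphLine γ (γ t) f → LiesInTangentDisc sphDist γ (γ t) f R₀) := by
  exact ⟨fun γ R₀ hR hγ hs t => CayleyKlein.hyperbolic hR hγ hs t,
    fun γ R₀ hR hR' hγ hs t => CayleyKlein.spherical hR hR' hγ hs t⟩
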